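/- Let $m,n\ge 1$, $N>n$, $0<\gamma\le 1$, and let $\theta_t:\mathbb R^n\times(\mathbb R^n)^m\to\mathbb C$, $t>0$, be kernels, jointly measurable in $(t,x,y_1,\dots,y_m)$, such that for some constant $C$ and all $t>0$, $x,y_1,\dots,y_m,y_i'\in\mathbb R^n$, $1\le i\le m$, $$(1.4)\quad |\theta_t(x,y_1,\dots,y_m)|\le C\prod_{j=1}^m\frac{t^{-n}}{(1+t^{-1}|x-y_j|)^N},$$ $$(1.5)\quad |\theta_t(x,y_1,\dots,y_m)-\theta_t(x,y_1,\dots,y_i',\dots,y_m)|\le C\,t^{-mn}(t^{-1}|y_i-y_i'|)^\gamma .$$ Put $\Theta_t(f_1,\dots,f_m)(x)=\int_{\mathbb R^{mn}}\theta_t(x,y_1,\dots,y_m)\prod_{i=1}^m f_i(y_i)\,dy_1\cdots dy_m$ and $S(f_1,\dots,f_m)(x)=\big(\int_0^\infty|\Theta_t(f_1,\dots,f_m)(x)|^2\frac{dt}{t}\big)^{1/2}$. Cubes have sides parallel to the axes and positive side length; $\ell(Q)$ is the side length and $|Q|$ the Lebesgue measure of $Q$, $2Q$ is the cube with the same center and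 side length $2\ell(Q)$, and $\chi_A$ is the indicator function of $A$. One says that $\Theta_t$ satisfies - the Carleson condition if $\displaystyle\sup_Q\frac1{|Q|}\int_Q\int_0^{\ell(Q)}|\Theta_t(1,\dots,1)(x)|^2\frac{dt}{t}\,dx<\infty$; - the two-cube testing condition if $\displaystyle\sup_{R\subset Q}\frac1{|R|}\int_R\int_{\ell(R)}^{\ell(Q)}|\Theta_t(\chi_{(2R)^c},\dots,\chi_{(2R)^c})(x)-\Theta_t(\chi_{(2Q)^c},\dots,\chi_{(2Q)^c})(x)|^2\frac{dt}{t}\,dx<\infty$; - the strong Carleson condition if $|\Theta_t(1,\dots,1)(x)|^2$ is locally integrable on $\mathbb R^n\times(0,\infty)$ with respect to $\frac{dt}{t}\,dx$ and $\displaystyle\sup_Q\operatorname*{ess\,sup}_{x\in Q}\int_0^{\ell(Q)}|\Theta_t(1,\dots,1)(x)|^2\frac{dt}{t}<\infty$, with suprema over all cubes $Q$, respectively all pairs of cubes $R\subset Q$. **Proposition 3.4.** Suppose that $\theta_t$ satisfies (1.4) and (1.5) and that $\Theta_t$ satisfies the Carleson condition. Then: 1. if $\Theta_t$ also satisfies the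 two-cube testing condition, then $\Theta_t$ satisfies the strong Carleson condition; 2. for all $1<p_1,\dots,p_m<\infty$ with $\frac1{p_1}+\cdots+\frac1{p_m}=\frac12$ there is a constant $C'<\infty$ such that $\|S(f_1,\dots,f_m)\|_{L^2}\le C'\prod_{i=1}^m\|f_i\|_{L^{p_i}}$ for all $f_i\in L^{p_i}(\mathbb R^n)$, $i=1,\dots,m$. -/

import Mathlib

open MeasureTheory Set
open scoped ENNReal NNReal

noncomputable section

namespace MultilinearSquare

/-- The Euclidean space `ℝⁿ`. -/
abbrev E (n : ℕ) : Type := EuclideanSpace ℝ (Fin n)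

/-- A cube in `ℝⁿ` with sides parallel to the axes, given by its center and its side length. -/
structure Cube (n : ℕ) where
  center : E n
  side : ℝ
  side_pos : 0 < side

/-- The (closed) set of points of a cube. -/
def Cube.toSet {n : ℕ} (Q : Cube n) : Set (E n) :=
  {x | ∀ i, |x i - Q.center i| ≤ Q.side / 2}

/-- The double `2Q`: same center, twice the side length. -/
def Cube.double {n : ℕ} (Q : Cube n) : Cube n where
  center := Q.center
  side := 2 * Q.side
  side_pos := mul_pos two_pos Q.side_pos

/-- The measure `dt / t` on `(0, ∞)`, as a measure on `ℝ` that does not charge `(-∞, 0]`. -/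
def dtOverT : Measure ℝ :=
  (volume.restrict (Ioi (0 : ℝ))).withDensity (fun t => ENNReal.ofReal (1 / t))

/-- A family of kernels `θ_t(x, y₁, …, y_m)`; only the values at `t > 0` matter. -/
abbrev Kernels (n m : ℕ) : Type := ℝ → E n → (Fin m → E n) → ℂ

/-- Joint Lebesgue measurability of `(t, x, y₁, …, y_m) ↦ θ_t(x, y₁, …, y_m)` on `t > 0`. -/
def KernelMeasurable {n m : ℕ} (θ : Kernels n m) : Prop :=
  AEStronglyMeasurable (fun q : ℝ × E n × (Fin m → E n) => θ q.1 q.2.1 q.2.2)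
    ((volume.restrict (Ioi (0 : ℝ))).prod volume)

/-- The size condition
`|θ_t(x, y₁, …, y_m)| ≲ ∏ i, t⁻ⁿ / (1 + t⁻¹ |x - y_i|) ^ N`, uniformly in `t > 0`. -/
def SizeCondition {n m : ℕ} (θ : Kernels n m) (N : ℝ) : Prop :=
  ∃ C : ℝ, ∀ t : ℝ, 0 < t → ∀ (x : E n) (y : Fin m → E n),
    ‖θ t x y‖ ≤ C * ∏ i, (t ^ n)⁻¹ / (1 + t⁻¹ * ‖x - y i‖) ^ N

/-- The regularity condition
`|θ_t(x, y₁, …, y_m) - θ_t(x, y₁, …, y_i', …, y_m)| ≲ t^{-mn} (t⁻¹ |y_i - y_i'|) ^ γ`,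
for each `i`, uniformly in `t > 0`. -/
def RegularityCondition {n m : ℕ} (θ : Kernels n m) (γ : ℝ) : Prop :=
  ∃ C : ℝ, ∀ t : ℝ, 0 < t → ∀ (x : E n) (y : Fin m → E n) (i : Fin m) (z : E n),
    ‖θ t x y - θ t x (Function.update y i z)‖ ≤
      C * ((t ^ (m * n))⁻¹ * (t⁻¹ * ‖y i - z‖) ^ γ)

/-- `Θ_t(f₁, …, f_m)(x) = ∫ θ_t(x, y₁, …, y_m) ∏ i, f_i(y_i) dy`. -/
def Theta {n m : ℕ} (θ : Kernels n m) (t : ℝ) (f : Fin m → E n → ℂ) (x : E n) : ℂ :=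
  ∫ y : Fin m → E n, θ t x y * ∏ i, f i (y i)

/-- The square function
`S(f₁, …, f_m)(x) = (∫₀^∞ |Θ_t(f₁, …, f_m)(x)|² dt / t) ^ (1/2)`, with values in `[0, ∞]`. -/
def squareFunction {n m : ℕ} (θ : Kernels n m) (f : Fin m → E n → ℂ) (x : E n) : ℝ≥0∞ :=
  (∫⁻ t, ‖Theta θ t f x‖ₑ ^ 2 ∂dtOverT) ^ (1 / 2 : ℝ)

/-- A measure on the upper half space is a Carleson measure if `sup_Q μ(T(Q)) / |Q| < ∞`, where
`T(Q) = Q × (0, ℓ(Q)]`. -/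
def IsCarlesonMeasure {n : ℕ} (μ : Measure (E n × ℝ)) : Prop :=
  ∃ C : ℝ≥0, ∀ Q : Cube n, μ (Q.toSet ×ˢ Ioc 0 Q.side) ≤ C * volume Q.toSet

/-- The measure `F(x, t) dτ(t) dx` with a nonnegative density `F` that is locally integrable on the
upper half space is a strong Carleson measure if
`sup_Q (ess sup)_{x ∈ Q} ∫_0^{ℓ(Q)} F(x, t) dτ(t) < ∞`. -/
def IsStrongCarleson {n : ℕ} (τ : Measure ℝ) (F : E n × ℝ → ℝ) : Prop :=
  LocallyIntegrableOn F (univ ×ˢ Ioi (0 : ℝ)) (volume.prod τ) ∧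
  ∃ C : ℝ≥0, ∀ Q : Cube n, ∀ᵐ x ∂(volume.restrict Q.toSet),
    ∫⁻ t in Ioc 0 Q.side, ENNReal.ofReal (F (x, t)) ∂τ ≤ C

/-- The density `|Θ_t(1, …, 1)(x)|²`. -/
def thetaOneSq {n m : ℕ} (θ : Kernels n m) (q : E n × ℝ) : ℝ :=
  ‖Theta θ q.2 (fun _ _ => 1) q.1‖ ^ 2

/-- `Θ_t` satisfies the Carleson condition: `|Θ_t(1, …, 1)(x)|² dt/t dx` is a Carleson measure. -/
def CarlesonCondition {n m : ℕ} (θ : Kernels n m) : Prop :=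
  IsCarlesonMeasure
    ((volume.prod dtOverT).withDensity (fun q => ENNReal.ofReal (thetaOneSq θ q)))

/-- `Θ_t` satisfies the strong Carleson condition: `|Θ_t(1, …, 1)(x)|² dt/t dx` is a strong Carleson
measure. -/
def StrongCarlesonCondition {n m : ℕ} (θ : Kernels n m) : Prop :=
  IsStrongCarleson dtOverT (thetaOneSq θ)

/-- `Θ_t(χ_{(2Q)ᶜ}, …, χ_{(2Q)ᶜ})(x)`. -/
def thetaOff {n m : ℕ} (θ : Kernels n m) (t : ℝ) (Q : Cube n) (x : E n) : ℂ :=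
  Theta θ t (fun _ => (Q.double.toSet)ᶜ.indicator (fun _ => (1 : ℂ))) x

/-- The two-cube testing condition. -/
def TwoCubeCondition {n m : ℕ} (θ : Kernels n m) : Prop :=
  ∃ C : ℝ≥0, ∀ R Q : Cube n, R.toSet ⊆ Q.toSet →
    ∫⁻ x in R.toSet, ∫⁻ t in Ioc R.side Q.side,
      ‖thetaOff θ t R x - thetaOff θ t Q x‖ₑ ^ 2 ∂dtOverT ≤ C * volume R.toSet

end MultilinearSquare

end

open MultilinearSquare

open MeasureTheory Set Filter Topology
open scoped ENNReal NNReal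

noncomputable section

namespace MultilinearSquare

section

/-! ### The model kernel -/

/-- The model kernel `t⁻ⁿ (1 + |z| / t) ^ (-N)`, with values in `[0, ∞]`. -/
def bump {n : ℕ} (N t : ℝ) (z : E n) : ℝ≥0∞ :=
  ENNReal.ofReal ((t ^ n)⁻¹ / (1 + t⁻¹ * ‖z‖) ^ N)

/-- The integral of the model kernel. -/
def bumpMass (n : ℕ) (N : ℝ) : ℝ≥0∞ := ∫⁻ z : E n, ENNReal.ofReal ((1 + ‖z‖) ^ (-N))

variable {n : ℕ}

lemma measurable_bump (N t : ℝ) : Measurable (bump (n := n) N t) := by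
  unfold bump
  fun_prop

lemma bump_neg (N t : ℝ) (z : E n) : bump N t (-z) = bump N t z := by
  simp [bump]

lemma bump_comm (N t : ℝ) (x y : E n) : bump N t (x - y) = bump N t (y - x) := by
  rw [← bump_neg, neg_sub]

lemma bumpMass_lt_top {N : ℝ} (hN : (n : ℝ) < N) : bumpMass n N < ∞ := by
  have h := integrable_one_add_norm (E := E n) (μ := volume) (r := N) (by simpa using hN)
  exact h.lintegral_lt_top

lemma lintegral_bump (N : ℝ) {t : ℝ} (ht : 0 < t) :
    ∫⁻ z : E n, bump N t z = bumpMass n N := by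
  have hm : Measurable (fun z : E n => ENNReal.ofReal ((1 + ‖z‖) ^ (-N))) := by fun_prop
  have h1 : ∫⁻ z : E n, ENNReal.ofReal ((1 + ‖t⁻¹ • z‖) ^ (-N)) =
      ENNReal.ofReal (t ^ n) * bumpMass n N := by
    have h := Measure.map_addHaar_smul (volume : Measure (E n)) (inv_ne_zero ht.ne')
    have h2 := lintegral_map (μ := (volume : Measure (E n))) hm
      (measurable_const_smul (t⁻¹ : ℝ))
    rw [← h2, h, lintegral_smul_measure, finrank_euclideanSpace_fin, smul_eq_mul]
    congr 2
    rw [inv_pow, inv_inv, abs_of_pos (pow_pos ht n)]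
  have h3 : ∀ z : E n, bump N t z =
      ENNReal.ofReal ((t ^ n)⁻¹) * ENNReal.ofReal ((1 + ‖t⁻¹ • z‖) ^ (-N)) := by
    intro z
    rw [bump, ← ENNReal.ofReal_mul (by positivity), norm_smul, Real.norm_of_nonneg (by positivity),
      Real.rpow_neg (by positivity), div_eq_mul_inv]
  simp_rw [h3]
  rw [lintegral_const_mul' _ _ ENNReal.ofReal_ne_top, h1, ← mul_assoc,
    ← ENNReal.ofReal_mul (by positivity), inv_mul_cancel₀ (by positivity), ENNReal.ofReal_one,
    one_mul]

lemma lintegral_bump_sub (N : ℝ) {t : ℝ} (ht : 0 < t) (x : E n) :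
    ∫⁻ y : E n, bump N t (x - y) = bumpMass n N := by
  rw [lintegral_sub_left_eq_self (fun y => bump N t y) x, lintegral_bump N ht]

lemma lintegral_bump_sub' (N : ℝ) {t : ℝ} (ht : 0 < t) (y : E n) :
    ∫⁻ x : E n, bump N t (x - y) = bumpMass n N := by
  simp_rw [fun x => bump_comm N t x y]
  exact lintegral_bump_sub N ht y

lemma bump_le {N : ℝ} (hN : 0 ≤ N) {t : ℝ} (ht : 0 < t) (z : E n) :
    bump N t z ≤ ENNReal.ofReal ((t ^ n)⁻¹) := by
  refine ENNReal.ofReal_le_ofReal (div_le_self (by positivity) ?_)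
  exact Real.one_le_rpow (le_add_of_nonneg_right (by positivity)) hN

lemma bump_anti {N N' : ℝ} (h : N' ≤ N) {t : ℝ} (ht : 0 < t) (z : E n) :
    bump N t z ≤ bump N' t z := by
  refine ENNReal.ofReal_le_ofReal ?_
  have h1 : 1 ≤ 1 + t⁻¹ * ‖z‖ := le_add_of_nonneg_right (by positivity)
  gcongr

lemma bump_mul_rpow_le {N δ : ℝ} (hδ : 0 ≤ δ) {t : ℝ} (ht : 0 < t) (z : E n) :
    bump (N + δ) t z * ENNReal.ofReal ((‖z‖ / t) ^ δ) ≤ bump N t z := by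
  rw [bump, bump, ← ENNReal.ofReal_mul (by positivity)]
  refine ENNReal.ofReal_le_ofReal ?_
  have h1 : 0 < 1 + t⁻¹ * ‖z‖ := by positivity
  rw [Real.rpow_add h1, div_mul_eq_mul_div, ← div_div, div_right_comm, mul_div_assoc,
    div_le_div_iff_of_pos_right (by positivity)]
  refine mul_le_of_le_one_right (by positivity) ?_
  refine div_le_one_of_le₀ (Real.rpow_le_rpow (by positivity) ?_ hδ) (by positivity)
  rw [div_eq_inv_mul]; linarith

lemma bump_le_of_le_norm {N δ : ℝ} (hδ : 0 ≤ δ) {t r : ℝ} (ht : 0 < t) (hr : 0 < r) {z : E n}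
    (hz : r ≤ ‖z‖) :
    bump (N + δ) t z ≤ ENNReal.ofReal ((t / r) ^ δ) * bump N t z := by
  have h1 : (1 : ℝ≥0∞) ≤ ENNReal.ofReal ((t / r) ^ δ) * ENNReal.ofReal ((‖z‖ / t) ^ δ) := by
    rw [← ENNReal.ofReal_mul (by positivity), ← Real.mul_rpow (by positivity) (by positivity),
      ENNReal.one_le_ofReal]
    apply Real.one_le_rpow _ hδ
    rw [div_mul_div_comm, mul_comm t, mul_div_mul_right _ _ ht.ne', one_le_div hr]
    exact hz
  calc bump (N + δ) t z ≤ (ENNReal.ofReal ((t / r) ^ δ) * ENNReal.ofReal ((‖z‖ / t) ^ δ)) *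
        bump (N + δ) t z := le_mul_of_one_le_left (zero_le) h1
    _ = ENNReal.ofReal ((t / r) ^ δ) * (bump (N + δ) t z * ENNReal.ofReal ((‖z‖ / t) ^ δ)) := by
        ring
    _ ≤ _ := by gcongr; exact bump_mul_rpow_le hδ ht z

lemma bump_sub_le {N c : ℝ} (hN : 0 ≤ N) (hc : 0 ≤ c) {t : ℝ} (ht : 0 < t) (x : E n) {y z : E n}
    (h : ‖y - z‖ ≤ c * t) :
    bump N t (x - z) ≤ ENNReal.ofReal ((1 + c) ^ N) * bump N t (x - y) := by
  rw [bump, bump, ← ENNReal.ofReal_mul (by positivity)]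
  refine ENNReal.ofReal_le_ofReal ?_
  have h0 : ‖x - y‖ ≤ ‖x - z‖ + c * t := by
    calc ‖x - y‖ = ‖(x - z) - (y - z)‖ := by congr 1; abel
      _ ≤ ‖x - z‖ + ‖y - z‖ := norm_sub_le _ _
      _ ≤ _ := by linarith
  have h1 : 1 + t⁻¹ * ‖x - y‖ ≤ (1 + c) * (1 + t⁻¹ * ‖x - z‖) := by
    have : t⁻¹ * ‖x - y‖ ≤ t⁻¹ * ‖x - z‖ + c := by
      calc t⁻¹ * ‖x - y‖ ≤ t⁻¹ * (‖x - z‖ + c * t) := by gcongr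
        _ = _ := by field_simp
    have h3 : 0 ≤ c * (t⁻¹ * ‖x - z‖) := by positivity
    nlinarith
  have h2 := Real.rpow_le_rpow (by positivity) h1 hN
  rw [Real.mul_rpow (by positivity) (by positivity)] at h2
  rw [mul_div_left_comm]
  rw [div_eq_mul_inv ((t ^ n)⁻¹)]
  refine mul_le_mul_of_nonneg_left ?_ (by positivity)
  rw [inv_eq_one_div, div_le_div_iff₀ (by positivity) (by positivity)]
  linarith

end

section

/-! ### Dyadic cells -/

/-- The index of the dyadic cell of side `2 ^ k` containing `x`. -/
def cellIndex {n : ℕ} (k : ℤ) (x : E n) : Fin n → ℤ := fun i => ⌊x i / 2 ^ k⌋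

/-- The dyadic cell of side `2 ^ k` and index `v`. -/
def cell {n : ℕ} (k : ℤ) (v : Fin n → ℤ) : Set (E n) := cellIndex k ⁻¹' {v}

variable {n : ℕ}

lemma measurable_cellIndex (k : ℤ) : Measurable (cellIndex (n := n) k) := by
  refine measurable_pi_lambda _ fun i => Int.measurable_floor.comp ?_
  fun_prop

lemma measurableSet_cell (k : ℤ) (v : Fin n → ℤ) : MeasurableSet (cell k v) :=
  measurable_cellIndex k (measurableSet_singleton v)

lemma mem_cell_iff {k : ℤ} {v : Fin n → ℤ} {x : E n} :
    x ∈ cell k v ↔ ∀ i, x i ∈ Ico ((v i : ℝ) * 2 ^ k) ((v i + 1 : ℝ) * 2 ^ k) := by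
  have h2 : (0 : ℝ) < 2 ^ k := by positivity
  simp only [cell, mem_preimage, mem_singleton_iff, funext_iff, cellIndex, Int.floor_eq_iff,
    mem_Ico, le_div_iff₀ h2, div_lt_iff₀ h2]

lemma mem_cell_cellIndex (k : ℤ) (x : E n) : x ∈ cell k (cellIndex k x) := rfl

lemma volume_box (s : Fin n → Set ℝ) (hs : ∀ i, MeasurableSet (s i)) :
    volume {x : E n | ∀ i, x i ∈ s i} = ∏ i, volume (s i) := by
  have h := (PiLp.volume_preserving_ofLp (Fin n)).measure_preimage
    (MeasurableSet.univ_pi hs).nullMeasurableSet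
  rw [volume_pi_pi] at h
  rw [← h]
  congr 1
  ext x
  simp

lemma volume_cell (k : ℤ) (v : Fin n → ℤ) :
    volume (cell k v) = ENNReal.ofReal (2 ^ k) ^ n := by
  have : cell k v = {x : E n | ∀ i, x i ∈ Ico ((v i : ℝ) * 2 ^ k) ((v i + 1 : ℝ) * 2 ^ k)} := by
    ext x; exact mem_cell_iff
  rw [this, volume_box _ (fun i => measurableSet_Ico)]
  have h : ∀ i, volume (Ico ((v i : ℝ) * 2 ^ k) ((v i + 1 : ℝ) * 2 ^ k)) =
      ENNReal.ofReal (2 ^ k) := by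
    intro i
    rw [Real.volume_Ico]
    congr 1
    ring
  simp [h]

lemma volume_cell_ne_zero (k : ℤ) (v : Fin n → ℤ) : volume (cell k v) ≠ 0 := by
  rw [volume_cell]
  exact pow_ne_zero _ (ENNReal.ofReal_pos.2 (by positivity)).ne'

lemma volume_cell_ne_top (k : ℤ) (v : Fin n → ℤ) : volume (cell k v) ≠ ∞ := by
  rw [volume_cell]
  exact ENNReal.pow_ne_top ENNReal.ofReal_ne_top

lemma norm_le_card_mul {x : E n} {c : ℝ} (h : ∀ i, |x i| ≤ c) : ‖x‖ ≤ n * c := by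
  rcases Nat.eq_zero_or_pos n with rfl | hn
  · simp [Subsingleton.elim x 0]
  have hc : 0 ≤ c := (abs_nonneg _).trans (h ⟨0, hn⟩)
  rw [EuclideanSpace.norm_eq, Real.sqrt_le_left (by positivity)]
  calc ∑ i, ‖x i‖ ^ 2 ≤ ∑ _i : Fin n, c ^ 2 := by
        refine Finset.sum_le_sum fun i _ => ?_
        gcongr
        exact h i
    _ = n * c ^ 2 := by simp
    _ ≤ (n * c) ^ 2 := by
        have : (1 : ℝ) ≤ n := by exact_mod_cast hn
        nlinarith [sq_nonneg c, mul_nonneg (sub_nonneg.2 this) (by positivity : 0 ≤ n * c ^ 2)]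

lemma norm_sub_le_of_mem_cell {k : ℤ} {v : Fin n → ℤ} {x y : E n} (hx : x ∈ cell k v)
    (hy : y ∈ cell k v) : ‖x - y‖ ≤ n * 2 ^ k := by
  rw [mem_cell_iff] at hx hy
  refine norm_le_card_mul fun i => ?_
  have h1 := hx i
  have h2 := hy i
  simp only [mem_Ico, add_mul, one_mul] at h1 h2
  simp only [PiLp.sub_apply, abs_le]
  constructor <;> linarith

lemma cellIndex_succ (k : ℤ) (x : E n) :
    cellIndex (k + 1) x = fun i => cellIndex k x i / 2 := by
  funext i
  simp only [cellIndex]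
  have h := Int.floor_div_natCast (x i / 2 ^ k) 2
  rw [div_div, Nat.cast_ofNat, ← zpow_add_one₀ two_ne_zero] at h
  exact h

lemma cellIndex_eq_of_le {k l : ℤ} (h : k ≤ l) {x y : E n} (hxy : cellIndex k x = cellIndex k y) :
    cellIndex l x = cellIndex l y := by
  induction l, h using Int.leInduction with
  | base => exact hxy
  | succ l _ ih => rw [cellIndex_succ, cellIndex_succ, ih]

lemma volume_cell_diff_shift (k : ℤ) (v : Fin n → ℤ) (z : E n) :
    volume {y : E n | y ∈ cell k v ∧ y - z ∉ cell k v} ≤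
      ENNReal.ofReal (n * ‖z‖ / 2 ^ k) * volume (cell k v) := by
  set I : Fin n → Set ℝ := fun i => Ico ((v i : ℝ) * 2 ^ k) ((v i + 1 : ℝ) * 2 ^ k) with hI
  have hIm : ∀ i, MeasurableSet (I i) := fun i => measurableSet_Ico
  set J : Fin n → Set ℝ := fun i => I i ∩ {u | u - z i ∉ I i} with hJ
  have hJm : ∀ i, MeasurableSet (J i) := fun i =>
    (hIm i).inter ((measurable_id.sub_const (z i)) (hIm i)).compl
  have hIv : ∀ i, volume (I i) = ENNReal.ofReal (2 ^ k) := by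
    intro i
    rw [hI, Real.volume_Ico]
    congr 1
    ring
  have hJv : ∀ i, volume (J i) ≤ ENNReal.ofReal ‖z‖ := by
    intro i
    have hzi : |z i| ≤ ‖z‖ := PiLp.norm_apply_le z i
    have hsub : J i ⊆ Ico ((v i : ℝ) * 2 ^ k) (v i * 2 ^ k + z i) ∪
        Ico ((v i + 1 : ℝ) * 2 ^ k + z i) ((v i + 1 : ℝ) * 2 ^ k) := by
      rintro u ⟨⟨h1, h2⟩, h3⟩
      simp only [hI, mem_Ico, mem_ofPred_eq, not_and_or, not_le, not_lt] at h3
      rcases h3 with h3 | h3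
      · left; exact ⟨h1, by linarith⟩
      · right; exact ⟨by linarith, h2⟩
    refine (measure_mono hsub).trans ((measure_union_le _ _).trans ?_)
    rw [Real.volume_Ico, Real.volume_Ico, add_sub_cancel_left, sub_add_cancel_left]
    rcases le_total 0 (z i) with h | h
    · rw [ENNReal.ofReal_of_nonpos (neg_nonpos.2 h), add_zero]
      exact ENNReal.ofReal_le_ofReal ((le_abs_self _).trans hzi)
    · rw [ENNReal.ofReal_of_nonpos h, zero_add]
      exact ENNReal.ofReal_le_ofReal ((neg_le_abs _).trans hzi)
  have hsub : {y : E n | y ∈ cell k v ∧ y - z ∉ cell k v} ⊆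
      ⋃ i, {y : E n | ∀ l, y l ∈ Function.update I i (J i) l} := by
    rintro y ⟨hy, hyz⟩
    rw [mem_cell_iff] at hy hyz
    push Not at hyz
    obtain ⟨i, hi⟩ := hyz
    simp only [mem_Ico, not_and, not_lt, PiLp.sub_apply] at hi
    refine mem_iUnion.2 ⟨i, fun l => ?_⟩
    rcases eq_or_ne l i with rfl | hl
    · rw [Function.update_self]
      exact ⟨hy l, fun h => absurd h.2 (not_lt.2 (hi h.1))⟩
    · rw [Function.update_of_ne hl]
      exact hy l
  refine (measure_mono hsub).trans ((measure_iUnion_fintype_le _ _).trans ?_)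
  have h2 : (0 : ℝ) < 2 ^ k := by positivity
  have key : ∀ i, volume {y : E n | ∀ l, y l ∈ Function.update I i (J i) l} ≤
      ENNReal.ofReal (‖z‖ / 2 ^ k) * volume (cell k v) := by
    intro i
    rw [volume_box]
    · rw [volume_cell, ← Finset.mul_prod_erase Finset.univ _ (Finset.mem_univ i),
        Function.update_self]
      have h3 : ∏ l ∈ Finset.univ.erase i, volume (Function.update I i (J i) l) =
          ENNReal.ofReal (2 ^ k) ^ (n - 1) := by
        rw [Finset.prod_congr rfl (g := fun _ => ENNReal.ofReal (2 ^ k))]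
        · simp
        · intro l hl
          rw [Function.update_of_ne (Finset.ne_of_mem_erase hl), hIv]
      have hn : ENNReal.ofReal (2 ^ k) ^ n =
          ENNReal.ofReal (2 ^ k) * ENNReal.ofReal (2 ^ k) ^ (n - 1) := by
        rw [← pow_succ', Nat.sub_add_cancel i.pos]
      rw [h3, hn, ← mul_assoc, ← ENNReal.ofReal_mul (by positivity), div_mul_cancel₀ _ h2.ne']
      gcongr
      exact hJv i
    · intro l
      rcases eq_or_ne l i with rfl | hl
      · rw [Function.update_self]; exact hJm l
      · rw [Function.update_of_ne hl]; exact hIm l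
  refine (Finset.sum_le_sum fun i _ => key i).trans ?_
  rw [Finset.sum_const, Finset.card_univ, Fintype.card_fin, nsmul_eq_mul, ← mul_assoc,
    mul_div_assoc, ENNReal.ofReal_mul (by positivity), ENNReal.ofReal_natCast]

/-! ### Averages over dyadic cells -/

lemma measurable_comp_cellIndex {α : Type*} [MeasurableSpace α] (k : ℤ) (F : (Fin n → ℤ) → α) :
    Measurable (fun x : E n => F (cellIndex k x)) :=
  (measurable_of_countable F).comp (measurable_cellIndex k)

/-- The average over dyadic cells of side `2 ^ k` of a function with values in `[0, ∞]`. -/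
def cellAvg (k : ℤ) (g : E n → ℝ≥0∞) (x : E n) : ℝ≥0∞ :=
  (ENNReal.ofReal (2 ^ k) ^ n)⁻¹ * ∫⁻ y in cell k (cellIndex k x), g y

/-- The average over dyadic cells of side `2 ^ k` of a complex valued function. -/
def cellMean (k : ℤ) (f : E n → ℂ) (x : E n) : ℂ :=
  (((2 : ℝ) ^ k) ^ n)⁻¹ • ∫ y in cell k (cellIndex k x), f y

lemma measurable_cellAvg (k : ℤ) (g : E n → ℝ≥0∞) : Measurable (cellAvg k g) :=
  measurable_comp_cellIndex k (fun v => (ENNReal.ofReal (2 ^ k) ^ n)⁻¹ * ∫⁻ y in cell k v, g y)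

lemma measurable_cellMean (k : ℤ) (f : E n → ℂ) : Measurable (cellMean k f) :=
  measurable_comp_cellIndex k (fun v => (((2 : ℝ) ^ k) ^ n)⁻¹ • ∫ y in cell k v, f y)

lemma cellAvg_congr_cell {k l : ℤ} (h : k ≤ l) (g : E n → ℝ≥0∞) {x y : E n}
    (hxy : cellIndex k x = cellIndex k y) : cellAvg l g x = cellAvg l g y := by
  rw [cellAvg, cellAvg, cellIndex_eq_of_le h hxy]

lemma cellMean_congr_cell {k l : ℤ} (h : k ≤ l) (f : E n → ℂ) {x y : E n}
    (hxy : cellIndex k x = cellIndex k y) : cellMean l f x = cellMean l f y := by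
  rw [cellMean, cellMean, cellIndex_eq_of_le h hxy]

lemma lintegral_eq_tsum_cell (k : ℤ) (g : E n → ℝ≥0∞) :
    ∫⁻ x, g x = ∑' v : Fin n → ℤ, ∫⁻ x in cell k v, g x := by
  rw [← lintegral_iUnion (fun v => measurableSet_cell k v)]
  · rw [← setLIntegral_univ]
    congr 2
    refine (eq_univ_of_forall fun x => ?_).symm
    exact mem_iUnion.2 ⟨cellIndex k x, rfl⟩
  · intro v w hvw
    exact Disjoint.preimage _ (disjoint_singleton.2 hvw)

lemma setLIntegral_cell_const_mul {k : ℤ} {v : Fin n → ℤ} {h : E n → ℝ≥0∞}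
    (hh : ∀ x y, cellIndex k x = cellIndex k y → h x = h y)
    {g : E n → ℝ≥0∞} (hg : AEMeasurable g) {x₀ : E n} (hx₀ : x₀ ∈ cell k v) :
    ∫⁻ x in cell k v, h x * g x = h x₀ * ∫⁻ x in cell k v, g x := by
  have h0 : ∀ x ∈ cell k v, h x = h x₀ := fun x hx => hh _ _ (Eq.trans hx (Eq.symm hx₀))
  rw [← lintegral_const_mul'' _ hg.restrict]
  exact setLIntegral_congr_fun (measurableSet_cell k v) (fun x hx => by simp only [h0 x hx])

lemma exists_mem_cell (k : ℤ) (v : Fin n → ℤ) : ∃ x, x ∈ cell k v :=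
  nonempty_of_measure_ne_zero (volume_cell_ne_zero k v)

lemma cellAvg_eq (k : ℤ) (g : E n → ℝ≥0∞) {v : Fin n → ℤ} {x : E n} (hx : x ∈ cell k v) :
    cellAvg k g x = (volume (cell k v))⁻¹ * ∫⁻ y in cell k v, g y := by
  have : cellIndex k x = v := hx
  rw [cellAvg, volume_cell, this]

lemma setLIntegral_cellAvg (k : ℤ) (g : E n → ℝ≥0∞) (v : Fin n → ℤ) :
    ∫⁻ x in cell k v, cellAvg k g x = ∫⁻ x in cell k v, g x := by
  rw [setLIntegral_congr_fun (measurableSet_cell k v) (fun x hx => cellAvg_eq k g hx),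
    setLIntegral_const, mul_right_comm,
    ENNReal.inv_mul_cancel (volume_cell_ne_zero k v) (volume_cell_ne_top k v), one_mul]

/-- Averaging is symmetric: a function that is constant on cells sees only averages. -/
lemma lintegral_mul_cellAvg {k : ℤ} {h : E n → ℝ≥0∞}
    (hh : ∀ x y, cellIndex k x = cellIndex k y → h x = h y)
    {g : E n → ℝ≥0∞} (hg : AEMeasurable g) :
    ∫⁻ x, h x * cellAvg k g x = ∫⁻ x, h x * g x := by
  rw [lintegral_eq_tsum_cell k, lintegral_eq_tsum_cell k (fun x => h x * g x)]
  congr 1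
  funext v
  obtain ⟨x₀, hx₀⟩ := exists_mem_cell k v
  rw [setLIntegral_cell_const_mul hh hg hx₀,
    setLIntegral_cell_const_mul hh (measurable_cellAvg k g).aemeasurable hx₀, setLIntegral_cellAvg]

lemma lintegral_cellAvg (k : ℤ) {g : E n → ℝ≥0∞} (hg : AEMeasurable g) :
    ∫⁻ x, cellAvg k g x = ∫⁻ x, g x := by
  simpa using lintegral_mul_cellAvg (k := k) (h := fun _ => 1) (fun _ _ _ => rfl) hg

lemma cellAvg_cellAvg {k l : ℤ} (hkl : k ≤ l) {g : E n → ℝ≥0∞} (hg : AEMeasurable g) (x : E n) :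
    cellAvg l (cellAvg k g) x = cellAvg l g x := by
  rw [cellAvg, cellAvg]
  congr 1
  have h := lintegral_mul_cellAvg (k := k)
    (h := (cell l (cellIndex l x)).indicator (fun _ => 1)) (fun y z hyz => by
      have := cellIndex_eq_of_le hkl hyz
      simp only [indicator, cell, mem_preimage, mem_singleton_iff, this]) hg
  rw [← lintegral_indicator (measurableSet_cell _ _), ← lintegral_indicator (measurableSet_cell _ _)]
  have e : ∀ g' : E n → ℝ≥0∞, (cell l (cellIndex l x)).indicator g' =
      fun y => (cell l (cellIndex l x)).indicator (fun _ => 1) y * g' y := fun g' => by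
    funext y
    by_cases hy : y ∈ cell l (cellIndex l x) <;> simp [hy]
  rw [e (cellAvg k g), e g]
  exact h

lemma cellAvg_const (k : ℤ) (c : ℝ≥0∞) (x : E n) : cellAvg k (fun _ => c) x = c := by
  rw [cellAvg_eq k _ (mem_cell_cellIndex k x), setLIntegral_const, mul_left_comm,
    ENNReal.inv_mul_cancel (volume_cell_ne_zero k _) (volume_cell_ne_top k _), mul_one]

lemma cellAvg_add (k : ℤ) {g : E n → ℝ≥0∞} (hg : Measurable g) (g' : E n → ℝ≥0∞) (x : E n) :
    cellAvg k (fun y => g y + g' y) x = cellAvg k g x + cellAvg k g' x := by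
  rw [cellAvg, lintegral_add_left hg, mul_add]
  rfl

lemma sq_lintegral_mul_le {α : Type*} [MeasurableSpace α] (μ : Measure α) {f g : α → ℝ≥0∞}
    (hf : AEMeasurable f μ) (hg : AEMeasurable g μ) :
    (∫⁻ a, f a * g a ∂μ) ^ 2 ≤ (∫⁻ a, f a ^ 2 ∂μ) * ∫⁻ a, g a ^ 2 ∂μ := by
  have h := ENNReal.lintegral_mul_le_Lp_mul_Lq μ Real.HolderConjugate.two_two hf hg
  simp only [Pi.mul_apply, ENNReal.rpow_ofNat] at h
  calc _ ≤ _ := pow_le_pow_left' h 2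
    _ = _ := by
      rw [mul_pow, ← ENNReal.rpow_natCast, ← ENNReal.rpow_natCast, ← ENNReal.rpow_mul,
        ← ENNReal.rpow_mul]
      norm_num

/-- Cauchy–Schwarz with respect to a weight. -/
lemma sq_lintegral_mul_le' {α : Type*} [MeasurableSpace α] (μ : Measure α) {w f : α → ℝ≥0∞}
    (hw : AEMeasurable w μ) (hf : AEMeasurable f μ) :
    (∫⁻ a, w a * f a ∂μ) ^ 2 ≤ (∫⁻ a, w a ∂μ) * ∫⁻ a, w a * f a ^ 2 ∂μ := by
  have h := sq_lintegral_mul_le μ (f := fun a => w a ^ (1 / 2 : ℝ))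
    (g := fun a => w a ^ (1 / 2 : ℝ) * f a) (hw.pow_const _) ((hw.pow_const _).mul hf)
  have h2 : ∀ a, (w a ^ (1 / 2 : ℝ)) ^ 2 = w a := fun a => by
    rw [← ENNReal.rpow_natCast, ← ENNReal.rpow_mul]; norm_num
  simp only [mul_pow, h2, ← mul_assoc, ← sq] at h
  exact h

lemma sq_cellAvg_mul_le (k : ℤ) {f g : E n → ℝ≥0∞} (hf : Measurable f) (hg : Measurable g)
    (x : E n) : cellAvg k (fun y => f y * g y) x ^ 2 ≤
      cellAvg k (fun y => f y ^ 2) x * cellAvg k (fun y => g y ^ 2) x := by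
  unfold cellAvg
  rw [mul_pow, mul_mul_mul_comm, ← sq]
  gcongr
  exact sq_lintegral_mul_le _ hf.aemeasurable hg.aemeasurable

lemma sq_cellAvg_le (k : ℤ) {f : E n → ℝ≥0∞} (hf : Measurable f) (x : E n) :
    cellAvg k f x ^ 2 ≤ cellAvg k (fun y => f y ^ 2) x := by
  have h := sq_cellAvg_mul_le k hf (measurable_const (a := (1 : ℝ≥0∞))) x
  simpa [cellAvg_const] using h

lemma enorm_cellMean_le (k : ℤ) (f : E n → ℂ) (x : E n) :
    ‖cellMean k f x‖ₑ ≤ cellAvg k (fun y => ‖f y‖ₑ) x := by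
  rw [cellMean, cellAvg, enorm_smul, enorm_inv (by positivity), enorm_pow,
    Real.enorm_of_nonneg (by positivity)]
  gcongr
  exact enorm_integral_le_lintegral_enorm _

lemma integrable_cellMean (k : ℤ) {f : E n → ℂ} (hf : Integrable f) :
    Integrable (cellMean k f) := by
  refine ⟨(measurable_cellMean k f).aestronglyMeasurable, ?_⟩
  refine lt_of_le_of_lt (lintegral_mono (enorm_cellMean_le k f)) ?_
  rw [lintegral_cellAvg k hf.1.enorm]
  exact hf.2

lemma lintegral_cellMean_sq_le (k : ℤ) {f : E n → ℂ} (hf : Measurable f) :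
    ∫⁻ x, ‖cellMean k f x‖ₑ ^ 2 ≤ ∫⁻ x, ‖f x‖ₑ ^ 2 := by
  rw [← lintegral_cellAvg k (g := fun x => ‖f x‖ₑ ^ 2) (by fun_prop)]
  refine lintegral_mono fun x => ?_
  exact (pow_le_pow_left' (enorm_cellMean_le k f x) 2).trans (sq_cellAvg_le k hf.enorm x)

lemma integral_eq_tsum_cell (k : ℤ) {f : E n → ℂ} (hf : Integrable f) :
    ∫ x, f x = ∑' v : Fin n → ℤ, ∫ x in cell k v, f x := by
  have hu : ⋃ v : Fin n → ℤ, cell k v = univ :=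
    eq_univ_of_forall fun x => mem_iUnion.2 ⟨cellIndex k x, rfl⟩
  rw [← integral_iUnion (fun v => measurableSet_cell k v), hu, setIntegral_univ]
  · intro v w hvw
    exact Disjoint.preimage _ (disjoint_singleton.2 hvw)
  · exact hf.integrableOn

lemma cellMean_eq (k : ℤ) (f : E n → ℂ) {v : Fin n → ℤ} {x : E n} (hx : x ∈ cell k v) :
    cellMean k f x = (((2 : ℝ) ^ k) ^ n)⁻¹ • ∫ y in cell k v, f y := by
  have : cellIndex k x = v := hx
  rw [cellMean, this]

lemma volume_real_cell (k : ℤ) (v : Fin n → ℤ) : volume.real (cell k v) = ((2 : ℝ) ^ k) ^ n := by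
  rw [measureReal_def, volume_cell, ENNReal.toReal_pow, ENNReal.toReal_ofReal (by positivity)]

lemma setIntegral_cellMean (k : ℤ) (f : E n → ℂ) (v : Fin n → ℤ) :
    ∫ x in cell k v, cellMean k f x = ∫ x in cell k v, f x := by
  rw [setIntegral_congr_fun (measurableSet_cell k v) (fun x hx => cellMean_eq k f hx),
    setIntegral_const, volume_real_cell, smul_smul, mul_inv_cancel₀ (by positivity), one_smul]

lemma integral_cellMean (k : ℤ) {f : E n → ℂ} (hf : Integrable f) :
    ∫ x, cellMean k f x = ∫ x, f x := by
  rw [integral_eq_tsum_cell k hf, integral_eq_tsum_cell k (integrable_cellMean k hf)]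
  simp_rw [setIntegral_cellMean]

lemma cellMean_cellMean {k l : ℤ} (hkl : k ≤ l) {f : E n → ℂ} (hf : Integrable f) (x : E n) :
    cellMean l (cellMean k f) x = cellMean l f x := by
  rw [cellMean, cellMean]
  congr 1
  set A := cell l (cellIndex l x) with hA
  have hAm : MeasurableSet A := measurableSet_cell _ _
  have h := integral_cellMean k (hf.indicator hAm)
  have h2 : cellMean k (A.indicator f) = A.indicator (cellMean k f) := by
    funext y
    have hmem : ∀ z ∈ cell k (cellIndex k y), (z ∈ A ↔ y ∈ A) := fun z hz => by
      have := cellIndex_eq_of_le hkl (show cellIndex k z = cellIndex k y from hz)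
      simp only [hA, cell, mem_preimage, mem_singleton_iff, this]
    by_cases hy : y ∈ A
    · rw [indicator_of_mem hy, cellMean, cellMean]
      congr 1
      refine setIntegral_congr_fun (measurableSet_cell _ _) fun z hz => ?_
      exact indicator_of_mem ((hmem z hz).2 hy) f
    · rw [indicator_of_notMem hy, cellMean, setIntegral_congr_fun (g := fun _ => 0)
        (measurableSet_cell _ _) fun z hz => ?_]
      · simp
      · exact indicator_of_notMem (fun hz' => hy ((hmem z hz).1 hz')) f
  rw [h2, integral_indicator hAm, integral_indicator hAm] at h
  exact h

/-- The variance identity. -/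
lemma lintegral_sub_sq_add {α : Type*} [MeasurableSpace α] (μ : Measure α) [IsFiniteMeasure μ]
    {f : α → ℂ} (hf : MemLp f 2 μ) {c : ℂ} (hc : μ.real univ • c = ∫ a, f a ∂μ) :
    ∫⁻ a, ‖f a - c‖ₑ ^ 2 ∂μ + ∫⁻ _, ‖c‖ₑ ^ 2 ∂μ = ∫⁻ a, ‖f a‖ₑ ^ 2 ∂μ := by
  have key : ∀ {g : α → ℂ}, MemLp g 2 μ →
      ∫⁻ a, ‖g a‖ₑ ^ 2 ∂μ = ENNReal.ofReal (∫ a, ‖g a‖ ^ 2 ∂μ) := by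
    intro g hg
    rw [ofReal_integral_eq_lintegral_ofReal hg.norm.integrable_sq
      (ae_of_all _ fun a => by positivity)]
    refine lintegral_congr fun a => ?_
    rw [ENNReal.ofReal_pow (norm_nonneg _), ofReal_norm]
  have h1 : MemLp (fun a => f a - c) 2 μ := hf.sub (memLp_const c)
  rw [key h1, key (memLp_const c), key hf, ← ENNReal.ofReal_add
    (integral_nonneg fun _ => by positivity) (integral_nonneg fun _ => by positivity)]
  congr 1
  have hi : Integrable (fun a => (starRingEnd ℂ) c * (f a - c)) μ :=
    (h1.integrable (by norm_num)).const_mul _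
  have h0 : ∫ a, ((starRingEnd ℂ) c * (f a - c)).re ∂μ = 0 := by
    have := integral_re hi
    simp only [RCLike.re_to_complex] at this
    rw [this, integral_const_mul, integral_sub (hf.integrable (by norm_num)) (integrable_const _),
      integral_const, hc, sub_self, mul_zero, Complex.zero_re]
  have hpt : ∀ a, ‖f a‖ ^ 2 = ‖f a - c‖ ^ 2 + ‖c‖ ^ 2 +
      2 * ((starRingEnd ℂ) c * (f a - c)).re := by
    intro a
    simp only [← Complex.normSq_eq_norm_sq, Complex.normSq_apply, Complex.mul_re, Complex.conj_re,
      Complex.conj_im, Complex.sub_re, Complex.sub_im]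
    ring
  simp_rw [hpt]
  have hi1 : Integrable (fun a => ‖f a - c‖ ^ 2 + ‖c‖ ^ 2) μ :=
    h1.norm.integrable_sq.add (integrable_const _)
  have hi2 : Integrable (fun a => 2 * ((starRingEnd ℂ) c * (f a - c)).re) μ := hi.re.const_mul 2
  rw [integral_add hi1 hi2, integral_const_mul, h0,
    integral_add h1.norm.integrable_sq (integrable_const _)]
  simp

/-- The variance identity for dyadic averages. -/
lemma lintegral_sub_cellMean_sq_add (k : ℤ) {f : E n → ℂ} (hf2 : MemLp f 2) :
    (∫⁻ x, ‖f x - cellMean k f x‖ₑ ^ 2) + ∫⁻ x, ‖cellMean k f x‖ₑ ^ 2 = ∫⁻ x, ‖f x‖ₑ ^ 2 := by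
  rw [lintegral_eq_tsum_cell k (fun x => ‖f x - cellMean k f x‖ₑ ^ 2),
    lintegral_eq_tsum_cell k (fun x => ‖cellMean k f x‖ₑ ^ 2),
    lintegral_eq_tsum_cell k (fun x => ‖f x‖ₑ ^ 2), ← ENNReal.tsum_add]
  congr 1
  funext v
  have : IsFiniteMeasure (volume.restrict (cell k v)) :=
    ⟨by rw [Measure.restrict_apply_univ]; exact (volume_cell_ne_top k v).lt_top⟩
  rw [setLIntegral_congr_fun (f := fun x => ‖f x - cellMean k f x‖ₑ ^ 2) (measurableSet_cell k v)
      (fun x hx => by simp only [cellMean_eq k f hx]; rfl),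
    setLIntegral_congr_fun (f := fun x => ‖cellMean k f x‖ₑ ^ 2) (measurableSet_cell k v)
      (fun x hx => by simp only [cellMean_eq k f hx]; rfl)]
  refine lintegral_sub_sq_add _ (hf2.restrict _) ?_
  rw [measureReal_restrict_apply_univ, volume_real_cell, smul_smul, mul_inv_cancel₀ (by positivity),
    one_smul]

end

section

variable {n : ℕ}

/-! ### Telescoping -/

lemma tsum_int_le_of_telescoping {u w : ℤ → ℝ≥0∞} {B : ℝ≥0∞}
    (h : ∀ j, w j + u (j + 1) ≤ u j) (hu : ∀ j, u j ≤ B) : ∑' j, w j ≤ B := by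
  have key : ∀ (a : ℤ) (N : ℕ), ∑ i ∈ Finset.range N, w (a + i) + u (a + N) ≤ u a := by
    intro a N
    induction N with
    | zero => simp
    | succ N ih =>
      refine le_trans ?_ ih
      rw [Finset.sum_range_succ, add_assoc]
      gcongr
      have := h (a + N)
      rwa [add_assoc a] at this
  rw [ENNReal.tsum_eq_iSup_sum]
  refine iSup_le fun s => ?_
  obtain ⟨a, ha⟩ := s.bddBelow
  obtain ⟨b, hb⟩ := s.bddAbove
  have hs : s ⊆ (Finset.range (b + 1 - a).toNat).image (fun i : ℕ => a + i) := by
    intro j hj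
    have h1 := ha hj
    have h2 := hb hj
    refine Finset.mem_image.2 ⟨(j - a).toNat, ?_, ?_⟩
    · rw [Finset.mem_range]; omega
    · omega
  calc ∑ j ∈ s, w j ≤ ∑ j ∈ (Finset.range (b + 1 - a).toNat).image (fun i : ℕ => a + i), w j :=
        Finset.sum_le_sum_of_subset hs
    _ = ∑ i ∈ Finset.range (b + 1 - a).toNat, w (a + i) :=
        Finset.sum_image (fun i _ j _ hij => by simpa using hij)
    _ ≤ u a := le_trans le_self_add (key a _)
    _ ≤ B := hu a

/-! ### Martingale differences -/

/-- The dyadic martingale difference at scale `2 ^ j`. -/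
def cellDiff (j : ℤ) (f : E n → ℂ) (x : E n) : ℂ := cellMean j f x - cellMean (j + 1) f x

lemma measurable_cellDiff (j : ℤ) (f : E n → ℂ) : Measurable (cellDiff j f) :=
  (measurable_cellMean _ _).sub (measurable_cellMean _ _)

lemma integrable_cellDiff (j : ℤ) {f : E n → ℂ} (hf : Integrable f) : Integrable (cellDiff j f) :=
  (integrable_cellMean _ hf).sub (integrable_cellMean _ hf)

lemma cellDiff_congr_cell {j : ℤ} (f : E n → ℂ) {x y : E n}
    (hxy : cellIndex j x = cellIndex j y) : cellDiff j f x = cellDiff j f y := by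
  rw [cellDiff, cellDiff, cellMean_congr_cell le_rfl f hxy,
    cellMean_congr_cell (Int.le_add_one le_rfl) f hxy]

lemma cellMean_sub (k : ℤ) {f g : E n → ℂ} (hf : Integrable f) (hg : Integrable g) (x : E n) :
    cellMean k (fun y => f y - g y) x = cellMean k f x - cellMean k g x := by
  rw [cellMean, integral_sub hf.integrableOn hg.integrableOn, smul_sub]
  rfl

lemma cellMean_cellDiff (j : ℤ) {f : E n → ℂ} (hf : Integrable f) (x : E n) :
    cellMean (j + 1) (cellDiff j f) x = 0 := by
  change cellMean (j + 1) (fun y => cellMean j f y - cellMean (j + 1) f y) x = 0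
  rw [cellMean_sub _ (integrable_cellMean _ hf) (integrable_cellMean _ hf),
    cellMean_cellMean (Int.le_add_one le_rfl) hf, cellMean_cellMean le_rfl hf, sub_self]

lemma tsum_lintegral_cellDiff_sq_le {f : E n → ℂ} (hfm : Measurable f) (hf : Integrable f)
    (hf2 : MemLp f 2) :
    ∑' j, ∫⁻ x, ‖cellDiff j f x‖ₑ ^ 2 ≤ ∫⁻ x, ‖f x‖ₑ ^ 2 := by
  refine tsum_int_le_of_telescoping (u := fun j => ∫⁻ x, ‖cellMean j f x‖ₑ ^ 2) (fun j => ?_)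
    (fun j => lintegral_cellMean_sq_le j hfm)
  have h2 : MemLp (cellMean j f) 2 := by
    refine ⟨(measurable_cellMean j f).aestronglyMeasurable, ?_⟩
    have h3 := hf2.2
    rw [eLpNorm_lt_top_iff_lintegral_rpow_enorm_lt_top (by norm_num) (by norm_num)] at h3 ⊢
    simp only [ENNReal.toReal_ofNat, ENNReal.rpow_ofNat] at h3 ⊢
    exact (lintegral_cellMean_sq_le j hfm).trans_lt h3
  have h := lintegral_sub_cellMean_sq_add (j + 1) h2
  simp only [cellMean_cellMean (Int.le_add_one (le_refl j)) hf] at h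
  exact h.le

/-! ### The dyadic Carleson embedding theorem -/

lemma inv_add_mul_le {C : ℝ≥0} {M ν : ℝ≥0∞} (h : M + ν ≤ C) :
    (1 + (M + ν))⁻¹ + ((1 + C : ℝ≥0∞) ^ 2)⁻¹ * ν ≤ (1 + M)⁻¹ := by
  have hM : M ≠ ∞ := ne_top_of_le_ne_top ENNReal.coe_ne_top (le_self_add.trans h)
  have hν : ν ≠ ∞ := ne_top_of_le_ne_top ENNReal.coe_ne_top (le_add_self.trans h)
  lift M to ℝ≥0 using hM
  lift ν to ℝ≥0 using hν
  have h' : (M : ℝ) + ν ≤ C := by exact_mod_cast h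
  norm_cast
  rw [← ENNReal.coe_inv (by positivity), ← ENNReal.coe_inv (by positivity),
    ← ENNReal.coe_inv (by positivity)]
  norm_cast
  rw [← NNReal.coe_le_coe]
  push_cast
  have hM0 : (0 : ℝ) ≤ M := M.2
  have hν0 : (0 : ℝ) ≤ ν := ν.2
  have e : (1 + (M : ℝ))⁻¹ - (1 + ((M : ℝ) + ν))⁻¹ =
      ((1 + (M : ℝ)) * (1 + ((M : ℝ) + ν)))⁻¹ * ν := by field_simp; ring
  have h3 : ((1 + (C : ℝ)) ^ 2)⁻¹ * ν ≤ ((1 + (M : ℝ)) * (1 + ((M : ℝ) + ν)))⁻¹ * ν := by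
    rw [sq]
    gcongr
    linarith
  linarith

lemma sq_cellAvg_mul_le' (k : ℤ) {w f : E n → ℝ≥0∞} (hw : Measurable w) (hf : Measurable f)
    (x : E n) : cellAvg k (fun y => w y * f y) x ^ 2 ≤
      cellAvg k w x * cellAvg k (fun y => w y * f y ^ 2) x := by
  unfold cellAvg
  rw [mul_pow, mul_mul_mul_comm, ← sq]
  gcongr
  exact sq_lintegral_mul_le' _ hw.aemeasurable hf.aemeasurable

lemma tsum_lintegral_mul_cellAvg_sq_le {β : ℤ → E n → ℝ≥0∞} (hβ : ∀ k, Measurable (β k))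
    {C : ℝ≥0} (hC : ∀ k x, cellAvg k (fun y => ∑' i : ℕ, β (k - i) y) x ≤ C)
    {F : E n → ℝ≥0∞} (hF : Measurable F) :
    ∑' k, ∫⁻ x, cellAvg k F x ^ 2 * β k x ≤ (1 + C : ℝ≥0∞) ^ 2 * ∫⁻ x, F x ^ 2 := by
  set B : ℤ → E n → ℝ≥0∞ := fun k y => ∑' i : ℕ, β (k - i) y with hB
  have hBm : ∀ k, Measurable (B k) := fun k => Measurable.tsum fun i => hβ _
  set m : ℤ → E n → ℝ≥0∞ := fun k => cellAvg k (B k) with hm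
  have hmm : ∀ k, Measurable (m k) := fun k => measurable_cellAvg _ _
  have hBs : ∀ k, B (k + 1) = fun y => β (k + 1) y + B k y := by
    intro k
    funext y
    simp only [hB]
    rw [tsum_eq_zero_add' ENNReal.summable]
    simp only [Nat.cast_zero, sub_zero, Nat.cast_add, Nat.cast_one, add_sub_add_right_eq_sub]
  have hms : ∀ k x, m (k + 1) x = cellAvg (k + 1) (m k) x + cellAvg (k + 1) (β (k + 1)) x := by
    intro k x
    simp only [hm]
    rw [hBs, cellAvg_add _ (hβ _), add_comm, cellAvg_cellAvg (Int.le_add_one le_rfl)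
      (hBm k).aemeasurable]
  set c : ℝ≥0∞ := ((1 + C : ℝ≥0∞) ^ 2)⁻¹ with hc
  have hc1 : (1 + C : ℝ≥0∞) ^ 2 * c = 1 := by
    rw [hc, ENNReal.mul_inv_cancel]
    · positivity
    · exact ENNReal.pow_ne_top (by simp)
  have key : ∑' j, c * ∫⁻ x, cellAvg (j + 1) F x ^ 2 * β (j + 1) x ≤ ∫⁻ x, F x ^ 2 := by
    refine tsum_int_le_of_telescoping
      (u := fun k => ∫⁻ x, cellAvg k F x ^ 2 * (1 + m k x)⁻¹) (fun k => ?_) (fun k => ?_)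
    · have h1 : ∫⁻ x, cellAvg (k + 1) F x ^ 2 * β (k + 1) x =
          ∫⁻ x, cellAvg (k + 1) F x ^ 2 * cellAvg (k + 1) (β (k + 1)) x := by
        rw [lintegral_mul_cellAvg (fun x y hxy => by
          rw [cellAvg_congr_cell le_rfl F hxy]) (hβ _).aemeasurable]
      have hc2 : c ≠ ∞ := ENNReal.inv_ne_top.2 (by positivity)
      have hm1 : Measurable (fun x => c * (cellAvg (k + 1) F x ^ 2 *
          cellAvg (k + 1) (β (k + 1)) x)) :=
        (((measurable_cellAvg _ _).pow_const 2).mul (measurable_cellAvg _ _)).const_mul _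
      rw [h1, ← lintegral_const_mul' _ _ hc2, ← lintegral_add_left hm1]
      · rw [← lintegral_cellAvg (k + 1)
          (g := fun x => cellAvg k F x ^ 2 * (1 + m k x)⁻¹)
          (((measurable_cellAvg k F).pow_const 2).mul
            ((hmm k).const_add 1).inv).aemeasurable]
        refine lintegral_mono fun x => ?_
        have h2 := inv_add_mul_le (by rw [← hms k x]; exact hC (k + 1) x)
        have h3 := sq_cellAvg_mul_le' (k + 1) ((hmm k).const_add 1)
          ((measurable_cellAvg k F).mul ((hmm k).const_add 1).inv) x
        have hne : ∀ y, (1 + m k y) * (1 + m k y)⁻¹ = 1 := fun y =>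
          ENNReal.mul_inv_cancel (by positivity)
            (by simpa using ne_top_of_le_ne_top ENNReal.coe_ne_top (hC k y))
        have e1 : (fun y => (1 + m k y) * (cellAvg k F y * (1 + m k y)⁻¹)) = cellAvg k F := by
          funext y
          rw [mul_left_comm, hne, mul_one]
        have e2 : (fun y => (1 + m k y) * (cellAvg k F y * (1 + m k y)⁻¹) ^ 2) =
            fun y => cellAvg k F y ^ 2 * (1 + m k y)⁻¹ := by
          funext y
          rw [mul_pow, sq (1 + m k y)⁻¹, mul_left_comm, ← mul_assoc (1 + m k y), hne, one_mul]
        simp only [Pi.mul_apply, Pi.inv_apply] at h3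
        rw [e1, e2, cellAvg_cellAvg (Int.le_add_one le_rfl) hF.aemeasurable,
          cellAvg_add _ measurable_const, cellAvg_const] at h3
        have hM : cellAvg (k + 1) (m k) x ≠ ∞ := by
          refine ne_top_of_le_ne_top ENNReal.coe_ne_top (le_trans ?_ (hC (k + 1) x))
          change _ ≤ m (k + 1) x
          rw [hms]
          exact le_self_add
        have h4 : cellAvg (k + 1) F x ^ 2 * (1 + cellAvg (k + 1) (m k) x)⁻¹ ≤
            cellAvg (k + 1) (fun y => cellAvg k F y ^ 2 * (1 + m k y)⁻¹) x := by
          rw [← div_eq_mul_inv]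
          refine ENNReal.div_le_of_le_mul ?_
          rw [mul_comm]
          exact h3
        refine le_trans ?_ h4
        calc _ = cellAvg (k + 1) F x ^ 2 * ((1 + (cellAvg (k + 1) (m k) x +
              cellAvg (k + 1) (β (k + 1)) x))⁻¹ + c * cellAvg (k + 1) (β (k + 1)) x) := by
              rw [hms]; ring
          _ ≤ _ := by gcongr
    · calc _ ≤ ∫⁻ x, cellAvg k (fun y => F y ^ 2) x := by
            refine lintegral_mono fun x => ?_
            refine (mul_le_of_le_one_right zero_le ?_).trans (sq_cellAvg_le k hF x)
            exact ENNReal.inv_le_one.2 le_self_add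
        _ = _ := lintegral_cellAvg k (hF.pow_const 2).aemeasurable
  rw [ENNReal.tsum_mul_left] at key
  have hshift := (Equiv.addRight (1 : ℤ)).tsum_eq (fun k => ∫⁻ x, cellAvg k F x ^ 2 * β k x)
  simp only [Equiv.coe_addRight] at hshift
  rw [hshift] at key
  calc _ = (1 + C : ℝ≥0∞) ^ 2 * (c * ∑' k, ∫⁻ x, cellAvg k F x ^ 2 * β k x) := by
        rw [← mul_assoc, hc1, one_mul]
    _ ≤ _ := by gcongr

end

section

/-! ### The measure `dt / t` -/

instance : SFinite dtOverT := by unfold dtOverT; infer_instance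

lemma dtOverT_absolutelyContinuous : dtOverT ≪ volume.restrict (Ioi (0 : ℝ)) :=
  withDensity_absolutelyContinuous _ _

lemma ae_dtOverT_pos : ∀ᵐ t ∂dtOverT, 0 < t :=
  dtOverT_absolutelyContinuous (ae_restrict_mem measurableSet_Ioi)

lemma setLIntegral_dtOverT {s : Set ℝ} (hs : MeasurableSet s) (hs0 : s ⊆ Ioi 0)
    {g : ℝ → ℝ≥0∞} (hg : Measurable g) :
    ∫⁻ t in s, g t ∂dtOverT = ∫⁻ t in s, ENNReal.ofReal (1 / t) * g t := by
  rw [dtOverT, setLIntegral_withDensity_eq_setLIntegral_mul _ (by fun_prop) hg hs,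
    Measure.restrict_restrict hs, inter_eq_left.2 hs0]
  rfl

lemma dtOverT_Ico_le (k : ℤ) : dtOverT (Ico ((2 : ℝ) ^ k) (2 ^ (k + 1))) ≤ 1 := by
  have h2 : (0 : ℝ) < 2 ^ k := by positivity
  have h := setLIntegral_dtOverT (s := Ico ((2 : ℝ) ^ k) (2 ^ (k + 1))) measurableSet_Ico
    (fun t ht => h2.trans_le ht.1) (g := fun _ => 1) measurable_const
  rw [setLIntegral_one] at h
  rw [h]
  calc _ ≤ ∫⁻ _t in Ico ((2 : ℝ) ^ k) (2 ^ (k + 1)), ENNReal.ofReal (1 / 2 ^ k) := by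
        refine setLIntegral_mono measurable_const fun t ht => ?_
        rw [mul_one]
        exact ENNReal.ofReal_le_ofReal (one_div_le_one_div_of_le h2 ht.1)
    _ = 1 := by
        rw [setLIntegral_const, Real.volume_Ico, ← ENNReal.ofReal_mul (by positivity),
          zpow_add_one₀ two_ne_zero]
        rw [show 1 / (2 : ℝ) ^ k * (2 ^ k * 2 - 2 ^ k) = 1 by field_simp; ring, ENNReal.ofReal_one]

lemma mem_Ico_zpow_iff {k : ℤ} {t : ℝ} :
    t ∈ Ico ((2 : ℝ) ^ k) (2 ^ (k + 1)) ↔ 0 < t ∧ Int.log 2 t = k := by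
  constructor
  · rintro ⟨h1, h2⟩
    have ht : 0 < t := lt_of_lt_of_le (by positivity) h1
    refine ⟨ht, le_antisymm ?_ ?_⟩
    · have := (Int.lt_zpow_iff_log_lt (b := 2) (by norm_num) ht (x := k + 1)).1 (by exact_mod_cast h2)
      omega
    · exact (Int.zpow_le_iff_le_log (b := 2) (by norm_num) ht).1 (by exact_mod_cast h1)
  · rintro ⟨ht, rfl⟩
    have h1 := Int.zpow_log_le_self (b := 2) (by norm_num) ht
    have h2 := Int.lt_zpow_succ_log_self (b := 2) (by norm_num) t
    exact ⟨by exact_mod_cast h1, by exact_mod_cast h2⟩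

lemma pairwise_disjoint_Ico_zpow :
    Pairwise (Function.onFun Disjoint fun k : ℤ => Ico ((2 : ℝ) ^ k) (2 ^ (k + 1))) := by
  intro k l hkl
  refine disjoint_left.2 fun t h1 h2 => hkl ?_
  rw [← (mem_Ico_zpow_iff.1 h1).2, (mem_Ico_zpow_iff.1 h2).2]

lemma lintegral_dtOverT_eq_tsum (g : ℝ → ℝ≥0∞) :
    ∫⁻ t, g t ∂dtOverT = ∑' k : ℤ, ∫⁻ t in Ico ((2 : ℝ) ^ k) (2 ^ (k + 1)), g t ∂dtOverT := by
  rw [← lintegral_iUnion (fun k => measurableSet_Ico) pairwise_disjoint_Ico_zpow]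
  have hu : (⋃ k : ℤ, Ico ((2 : ℝ) ^ k) (2 ^ (k + 1))) = Ioi 0 := by
    ext t
    simp only [mem_iUnion, mem_Ico_zpow_iff, mem_Ioi]
    exact ⟨fun ⟨_, h, _⟩ => h, fun h => ⟨_, h, rfl⟩⟩
  rw [hu, Measure.restrict_eq_self_of_ae_mem (s := Ioi 0) ae_dtOverT_pos]

lemma lintegral_Ioc_div_rpow {a ℓ : ℝ} (ha : 0 < a) (hℓ : 0 < ℓ) :
    ∫⁻ t in Ioc 0 ℓ, ENNReal.ofReal ((t / ℓ) ^ a) ∂dtOverT = ENNReal.ofReal a⁻¹ := by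
  rw [setLIntegral_dtOverT measurableSet_Ioc (fun t ht => ht.1) (by fun_prop)]
  have e : ∫⁻ t in Ioc 0 ℓ, ENNReal.ofReal (1 / t) * ENNReal.ofReal ((t / ℓ) ^ a) =
      ∫⁻ t in Ioc 0 ℓ, ENNReal.ofReal ((ℓ ^ a)⁻¹ * t ^ (a - 1)) := by
    refine setLIntegral_congr_fun measurableSet_Ioc fun t ht => ?_
    have ht0 : 0 < t := ht.1
    rw [← ENNReal.ofReal_mul (by positivity), Real.div_rpow ht0.le hℓ.le, Real.rpow_sub_one ht0.ne']
    congr 1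
    field_simp
  have hi : IntervalIntegrable (fun t : ℝ => (ℓ ^ a)⁻¹ * t ^ (a - 1)) volume 0 ℓ :=
    (intervalIntegral.intervalIntegrable_rpow' (by linarith)).const_mul _
  rw [e, ← ofReal_integral_eq_lintegral_ofReal ((intervalIntegrable_iff_integrableOn_Ioc_of_le
    hℓ.le).1 hi) ((ae_restrict_mem measurableSet_Ioc).mono fun t ht => by
      have : 0 < t := ht.1
      simp only [Pi.zero_apply]
      positivity), ← intervalIntegral.integral_of_le hℓ.le, intervalIntegral.integral_const_mul,
    integral_rpow (Or.inl (by linarith)), sub_add_cancel, Real.zero_rpow ha.ne', sub_zero]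
  congr 1
  field_simp

lemma lintegral_Ioi_div_rpow {a ℓ : ℝ} (ha : 0 < a) (hℓ : 0 < ℓ) :
    ∫⁻ t in Ioi ℓ, ENNReal.ofReal ((ℓ / t) ^ a) ∂dtOverT = ENNReal.ofReal a⁻¹ := by
  rw [setLIntegral_dtOverT measurableSet_Ioi (fun t ht => hℓ.trans ht) (by fun_prop)]
  have e : ∫⁻ t in Ioi ℓ, ENNReal.ofReal (1 / t) * ENNReal.ofReal ((ℓ / t) ^ a) =
      ∫⁻ t in Ioi ℓ, ENNReal.ofReal (ℓ ^ a * t ^ (-a - 1)) := by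
    refine setLIntegral_congr_fun measurableSet_Ioi fun t ht => ?_
    have ht0 : 0 < t := hℓ.trans ht
    rw [← ENNReal.ofReal_mul (by positivity), Real.div_rpow hℓ.le ht0.le, Real.rpow_sub_one ht0.ne',
      Real.rpow_neg ht0.le]
    congr 1
    field_simp
  have hi : IntegrableOn (fun t : ℝ => ℓ ^ a * t ^ (-a - 1)) (Ioi ℓ) :=
    (integrableOn_Ioi_rpow_of_lt (by linarith) hℓ).const_mul _
  rw [e, ← ofReal_integral_eq_lintegral_ofReal hi ((ae_restrict_mem measurableSet_Ioi).mono
    fun t ht => by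
      have : 0 < t := hℓ.trans ht
      simp only [Pi.zero_apply]
      positivity), integral_const_mul, integral_Ioi_rpow_of_lt (by linarith) hℓ, sub_add_cancel,
    Real.rpow_neg hℓ.le]
  congr 1
  field_simp

/-! ### Cubes and Carleson bounds -/

variable {n : ℕ}

lemma Cube.toSet_eq (Q : Cube n) : Q.toSet =
    {x | ∀ i, x i ∈ Icc (Q.center i - Q.side / 2) (Q.center i + Q.side / 2)} := by
  ext x
  simp only [Cube.toSet, mem_ofPred_eq, mem_Icc, abs_le]
  refine forall_congr' fun i => ⟨fun h => ⟨by linarith, by linarith⟩, fun h => ⟨?_, ?_⟩⟩ <;>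
    linarith

lemma Cube.volume_toSet (Q : Cube n) : volume Q.toSet = ENNReal.ofReal Q.side ^ n := by
  rw [Q.toSet_eq, volume_box _ fun i => measurableSet_Icc]
  simp [Real.volume_Icc]

lemma Cube.measurableSet_toSet (Q : Cube n) : MeasurableSet Q.toSet := by
  have : Q.toSet = ⋂ i, {x : E n | |x i - Q.center i| ≤ Q.side / 2} := by
    ext x; simp [Cube.toSet]
  rw [this]
  exact MeasurableSet.iInter fun i => measurableSet_le (by fun_prop) measurable_const

lemma Cube.volume_ne_top (Q : Cube n) : volume Q.toSet ≠ ∞ := by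
  rw [Q.volume_toSet]
  exact ENNReal.pow_ne_top ENNReal.ofReal_ne_top

lemma Cube.volume_double (Q : Cube n) : volume Q.double.toSet = 2 ^ n * volume Q.toSet := by
  rw [Q.volume_toSet, Q.double.volume_toSet, Cube.double, ENNReal.ofReal_mul zero_le_two, mul_pow,
    ENNReal.ofReal_ofNat]

/-- A function on the upper half space whose density with respect to `dt / t dx` is a Carleson
measure with constant `C`. -/
def CarlesonBound (b : E n × ℝ → ℝ≥0∞) (C : ℝ≥0) : Prop :=
  ∀ Q : Cube n, ∫⁻ x in Q.toSet, ∫⁻ t in Ioc 0 Q.side, b (x, t) ∂dtOverT ≤ C * volume Q.toSet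

lemma ae_ae_of_ae_eq {b b' : E n × ℝ → ℝ≥0∞} (h : b =ᵐ[volume.prod dtOverT] b') :
    ∀ᵐ x : E n, ∀ᵐ t ∂dtOverT, b (x, t) = b' (x, t) :=
  Measure.ae_ae_of_ae_prod h

lemma CarlesonBound.congr {b b' : E n × ℝ → ℝ≥0∞} {C : ℝ≥0} (hb : CarlesonBound b C)
    (h : b =ᵐ[volume.prod dtOverT] b') : CarlesonBound b' C := by
  intro Q
  refine le_of_eq_of_le ?_ (hb Q)
  refine lintegral_congr_ae (ae_restrict_of_ae ?_)
  filter_upwards [ae_ae_of_ae_eq h] with x hx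
  refine lintegral_congr_ae (ae_restrict_of_ae ?_)
  filter_upwards [hx] with t ht using ht.symm

/-- A cube containing a dyadic cell. -/
def cellCube (k : ℤ) (v : Fin n → ℤ) : Cube n where
  center := WithLp.toLp 2 fun i => (v i : ℝ) * 2 ^ k
  side := 2 ^ (k + 1)
  side_pos := by positivity

lemma cell_subset_cellCube (k : ℤ) (v : Fin n → ℤ) : cell k v ⊆ (cellCube k v).toSet := by
  intro x hx i
  rw [mem_cell_iff] at hx
  have h2 : (0 : ℝ) < 2 ^ k := by positivity
  have := hx i
  simp only [cellCube, zpow_add_one₀ (two_ne_zero (α := ℝ)), abs_le]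
  simp only [mem_Ico, add_mul, one_mul] at this
  constructor <;> linarith

lemma volume_cellCube (k : ℤ) (v : Fin n → ℤ) :
    volume (cellCube k v).toSet = 2 ^ n * volume (cell k v) := by
  have h : (cellCube k v).side = 2 * 2 ^ k := by
    rw [mul_comm, ← zpow_add_one₀ two_ne_zero]; rfl
  rw [Cube.volume_toSet, volume_cell, h, ENNReal.ofReal_mul zero_le_two, mul_pow, ENNReal.ofReal_ofNat]

/-- The Carleson embedding theorem for dyadic averages. -/
theorem CarlesonBound.lintegral_mul_cellAvg_sq_le {b : E n × ℝ → ℝ≥0∞} {C : ℝ≥0}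
    (hb : CarlesonBound b C) (hbm : AEMeasurable b (volume.prod dtOverT))
    {F : E n → ℝ≥0∞} (hF : Measurable F) :
    ∫⁻ x, ∫⁻ t, b (x, t) * cellAvg (Int.log 2 t) F x ^ 2 ∂dtOverT ≤
      (1 + 2 ^ n * C : ℝ≥0∞) ^ 2 * ∫⁻ x, F x ^ 2 := by
  wlog hm : Measurable b generalizing b
  · have hae := hbm.ae_eq_mk
    have h := this (hb.congr hae) hbm.measurable_mk.aemeasurable hbm.measurable_mk
    refine le_of_eq_of_le (lintegral_congr_ae ?_) h
    filter_upwards [ae_ae_of_ae_eq hae] with x hx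
    refine lintegral_congr_ae ?_
    filter_upwards [hx] with t ht
    rw [ht]
  set β : ℤ → E n → ℝ≥0∞ := fun k x =>
    ∫⁻ t in Ico ((2 : ℝ) ^ k) (2 ^ (k + 1)), b (x, t) ∂dtOverT with hβ
  have hβm : ∀ k, Measurable (β k) := fun k => hm.lintegral_prod_right'
  have hC : ∀ k x, cellAvg k (fun y => ∑' i : ℕ, β (k - i) y) x ≤ (2 ^ n * C : ℝ≥0) := by
    intro k x
    rw [cellAvg_eq k _ (mem_cell_cellIndex k x)]
    set v := cellIndex k x
    refine (ENNReal.inv_mul_le_iff (volume_cell_ne_zero k v) (volume_cell_ne_top k v)).2 ?_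
    calc _ ≤ ∫⁻ y in cell k v, ∫⁻ t in Ioc 0 (2 ^ (k + 1)), b (y, t) ∂dtOverT := by
          refine lintegral_mono fun y => ?_
          simp only [hβ]
          rw [← lintegral_iUnion (fun _ => measurableSet_Ico)]
          · refine lintegral_mono_set ?_
            refine iUnion_subset fun i t ht => ?_
            refine ⟨lt_of_lt_of_le (by positivity) ht.1, ht.2.le.trans ?_⟩
            exact zpow_le_zpow_right₀ one_le_two (by omega)
          · intro i j hij
            exact pairwise_disjoint_Ico_zpow (fun h => hij (by omega))
      _ ≤ ∫⁻ y in (cellCube k v).toSet, ∫⁻ t in Ioc 0 (2 ^ (k + 1)), b (y, t) ∂dtOverT :=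
          lintegral_mono_set (cell_subset_cellCube k v)
      _ ≤ C * volume (cellCube k v).toSet := hb (cellCube k v)
      _ = _ := by
          rw [volume_cellCube]
          push_cast
          ring
  have h := tsum_lintegral_mul_cellAvg_sq_le hβm hC hF
  push_cast at h
  refine le_of_eq_of_le ?_ h
  have hmk : ∀ k, AEMeasurable (fun x => cellAvg k F x ^ 2 * β k x) :=
    fun k => (((measurable_cellAvg k F).pow_const 2).mul (hβm k)).aemeasurable
  rw [← lintegral_tsum hmk]
  refine lintegral_congr fun x => ?_
  rw [lintegral_dtOverT_eq_tsum]
  congr 1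
  funext k
  have hbx : Measurable fun t => b (x, t) := by fun_prop
  rw [← lintegral_const_mul _ hbx]
  refine setLIntegral_congr_fun measurableSet_Ico fun t ht => ?_
  simp only [(mem_Ico_zpow_iff.1 ht).2]
  exact mul_comm _ _

end

section

variable {n : ℕ}

/-! ### Kernels with decay and regularity -/

/-- Size and regularity of a kernel function `κ` around `x` at scale `t`. -/
structure IsLocalKernel (κ : E n → ℂ) (M δ t : ℝ) (A : ℝ≥0) (x : E n) : Prop where
  size : ∀ y, ‖κ y‖ₑ ≤ A * bump (M + δ) t (x - y)
  reg : ∀ y z, ‖y - z‖ ≤ n * t →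
    ‖κ y - κ z‖ₑ ≤ A * ENNReal.ofReal ((‖y - z‖ / t) ^ δ) * bump M t (x - y)

namespace IsLocalKernel

variable {κ : E n → ℂ} {M δ t : ℝ} {A : ℝ≥0} {x : E n}

lemma continuous (h : IsLocalKernel κ M δ t A x) (hn : 1 ≤ n) (hM : (n : ℝ) < M) (hδ : 0 < δ)
    (ht : 0 < t) : Continuous κ := by
  have hM0 : 0 ≤ M := (Nat.cast_nonneg n).trans hM.le
  have hn' : (0 : ℝ) < n := by exact_mod_cast hn
  rw [continuous_iff_continuousAt]
  intro y
  rw [ContinuousAt, tendsto_iff_edist_tendsto_0]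
  have hlim : Tendsto (fun z => (A * ENNReal.ofReal ((‖y - z‖ / t) ^ δ)) *
      ENNReal.ofReal ((t ^ n)⁻¹)) (𝓝 y) (𝓝 0) := by
    have h1 : Tendsto (fun z : E n => (‖y - z‖ / t) ^ δ) (𝓝 y) (𝓝 0) := by
      have : Continuous fun z : E n => (‖y - z‖ / t) ^ δ :=
        (by fun_prop : Continuous fun z : E n => ‖y - z‖ / t).rpow_const fun _ => Or.inr hδ.le
      have h2 := this.tendsto y
      simpa [Real.zero_rpow hδ.ne'] using h2
    have h3 := ENNReal.tendsto_ofReal h1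
    have h4 := ENNReal.Tendsto.const_mul h3 (Or.inr (ENNReal.coe_ne_top (r := A)))
    have h5 := ENNReal.Tendsto.mul_const h4
      (Or.inr (ENNReal.ofReal_ne_top (r := (t ^ n)⁻¹)))
    simpa using h5
  refine tendsto_of_tendsto_of_tendsto_of_le_of_le' tendsto_const_nhds hlim
    (Eventually.of_forall fun _ => zero_le) ?_
  filter_upwards [Metric.ball_mem_nhds y (by positivity : 0 < n * t)] with z hz
  rw [edist_comm, edist_eq_enorm_sub]
  refine (h.reg y z ?_).trans ?_
  · rw [← dist_eq_norm, dist_comm]; exact (Metric.mem_ball.1 hz).le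
  · gcongr
    exact bump_le hM0 ht _

lemma enorm_le (h : IsLocalKernel κ M δ t A x) (hM : (n : ℝ) < M) (hδ : 0 < δ)
    (ht : 0 < t) (y : E n) : ‖κ y‖ₑ ≤ A * ENNReal.ofReal ((t ^ n)⁻¹) := by
  have hM0 : 0 ≤ M := (Nat.cast_nonneg n).trans hM.le
  refine (h.size y).trans ?_
  gcongr
  exact bump_le (by linarith) ht _

lemma norm_le (h : IsLocalKernel κ M δ t A x) (hM : (n : ℝ) < M) (hδ : 0 < δ)
    (ht : 0 < t) (y : E n) : ‖κ y‖ ≤ A * (t ^ n)⁻¹ := by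
  have h1 := h.enorm_le hM hδ ht y
  rw [← ENNReal.ofReal_coe_nnreal, ← ENNReal.ofReal_mul (by positivity), ← ofReal_norm] at h1
  exact (ENNReal.ofReal_le_ofReal_iff (by positivity)).1 h1

lemma integrable_mul (h : IsLocalKernel κ M δ t A x) (hn : 1 ≤ n) (hM : (n : ℝ) < M) (hδ : 0 < δ)
    (ht : 0 < t) {g : E n → ℂ} (hg : Integrable g) : Integrable (fun y => κ y * g y) :=
  hg.bdd_mul (h.continuous hn hM hδ ht).aestronglyMeasurable
    (ae_of_all _ fun y => h.norm_le hM hδ ht y)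

lemma integrable (h : IsLocalKernel κ M δ t A x) (hn : 1 ≤ n) (hM : (n : ℝ) < M) (hδ : 0 < δ)
    (ht : 0 < t) : Integrable κ := by
  refine ⟨(h.continuous hn hM hδ ht).aestronglyMeasurable, ?_⟩
  refine lt_of_le_of_lt (lintegral_mono h.size) ?_
  rw [lintegral_const_mul' _ _ ENNReal.coe_ne_top, lintegral_bump_sub _ ht]
  exact ENNReal.mul_lt_top ENNReal.coe_lt_top (bumpMass_lt_top (by linarith))

/-- The action of a kernel on functions with vanishing means at a scale below `t`. -/
lemma enorm_integral_mul_le (h : IsLocalKernel κ M δ t A x) (hn : 1 ≤ n) (hM : (n : ℝ) < M)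
    (hδ : 0 < δ) (ht : 0 < t) {j : ℤ} (hj : (2 : ℝ) ^ j ≤ t) {g : E n → ℂ} (hg : Integrable g)
    (h0 : ∀ y, cellMean j g y = 0) :
    ‖∫ y, κ y * g y‖ₑ ≤ A * ENNReal.ofReal ((n * 2 ^ j / t) ^ δ) *
      ∫⁻ y, bump M t (x - y) * ‖g y‖ₑ := by
  set rep : E n → E n := fun y => (exists_mem_cell j (cellIndex j y)).choose with hrep
  have hrepm : ∀ y, rep y ∈ cell j (cellIndex j y) :=
    fun y => (exists_mem_cell j (cellIndex j y)).choose_spec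
  have hm : Measurable fun y => κ (rep y) :=
    measurable_comp_cellIndex j (fun v => κ (exists_mem_cell j v).choose)
  have hi : Integrable fun y => κ (rep y) * g y :=
    hg.bdd_mul hm.aestronglyMeasurable (ae_of_all _ fun y => h.norm_le hM hδ ht (rep y))
  have hz : ∫ y, κ (rep y) * g y = 0 := by
    rw [integral_eq_tsum_cell j hi]
    refine (tsum_congr fun v => ?_).trans tsum_zero
    obtain ⟨x₀, hx₀⟩ := exists_mem_cell j v
    rw [setIntegral_congr_fun (g := fun y => κ (rep x₀) * g y) (measurableSet_cell j v)
      (fun y hy => by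
        have : cellIndex j y = cellIndex j x₀ := Eq.trans hy (Eq.symm hx₀)
        simp only [hrep, this]), integral_const_mul]
    have h1 := h0 x₀
    rw [cellMean_eq j g hx₀] at h1
    rw [(smul_eq_zero_iff_right (by positivity)).1 h1, mul_zero]
  have he : ∫ y, κ y * g y = ∫ y, (κ y - κ (rep y)) * g y := by
    simp_rw [sub_mul]
    rw [integral_sub (h.integrable_mul hn hM hδ ht hg) hi, hz, sub_zero]
  rw [he, ← lintegral_const_mul' _ _ (by finiteness)]
  refine (enorm_integral_le_lintegral_enorm _).trans (lintegral_mono fun y => ?_)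
  have hd : ‖y - rep y‖ ≤ n * 2 ^ j := norm_sub_le_of_mem_cell (mem_cell_cellIndex j y) (hrepm y)
  rw [enorm_mul, ← mul_assoc]
  gcongr
  refine (h.reg y (rep y) (hd.trans (by gcongr))).trans ?_
  gcongr

end IsLocalKernel

/-! ### Bounds in `L²` -/

lemma lintegral_lintegral_bump_mul_sq_le (M : ℝ) {t : ℝ} (ht : 0 < t) {G : E n → ℝ≥0∞}
    (hG : Measurable G) :
    ∫⁻ x : E n, (∫⁻ y, bump M t (x - y) * G y) ^ 2 ≤ bumpMass n M ^ 2 * ∫⁻ y, G y ^ 2 := by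
  have hb := measurable_bump (n := n) M t
  calc _ ≤ ∫⁻ x : E n, bumpMass n M * ∫⁻ y, bump M t (x - y) * G y ^ 2 := by
        refine lintegral_mono fun x => ?_
        have h := sq_lintegral_mul_le' volume (w := fun y => bump M t (x - y)) (f := G)
          (by fun_prop) hG.aemeasurable
        rwa [lintegral_bump_sub M ht] at h
    _ = bumpMass n M * ∫⁻ x : E n, ∫⁻ y, bump M t (x - y) * G y ^ 2 :=
        lintegral_const_mul _ (Measurable.lintegral_prod_right' (f := fun p : E n × E n =>
          bump M t (p.1 - p.2) * G p.2 ^ 2) (by fun_prop))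
    _ = bumpMass n M * ∫⁻ y : E n, ∫⁻ x, bump M t (x - y) * G y ^ 2 := by
        rw [lintegral_lintegral_swap (by fun_prop)]
    _ = _ := by
        simp_rw [fun y => lintegral_mul_const (μ := volume) (G y ^ 2)
          (f := fun x : E n => bump M t (x - y)) (by fun_prop), lintegral_bump_sub' M ht]
        rw [lintegral_const_mul _ (by fun_prop), sq, mul_assoc]

/-- The mass of the model kernel that leaks out of the cell of `x`. -/
def leak (M t : ℝ) (j : ℤ) (x : E n) : ℝ≥0∞ :=
  ∫⁻ y, bump M t (x - y) * (if cellIndex j x = cellIndex j y then 0 else 1)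

lemma measurableSet_cellIndex_eq (j : ℤ) :
    MeasurableSet {p : E n × E n | cellIndex j p.1 = cellIndex j p.2} :=
  measurableSet_eq_fun ((measurable_cellIndex j).comp measurable_fst)
    ((measurable_cellIndex j).comp measurable_snd)

lemma measurable_leak_integrand (M t : ℝ) (j : ℤ) : Measurable (fun p : E n × E n =>
    bump M t (p.1 - p.2) * (if cellIndex j p.1 = cellIndex j p.2 then (0 : ℝ≥0∞) else 1)) :=
  ((measurable_bump M t).comp (by fun_prop)).mul
    (Measurable.ite (measurableSet_cellIndex_eq j) measurable_const measurable_const)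

lemma measurable_leak (M t : ℝ) (j : ℤ) : Measurable (leak (n := n) M t j) :=
  (measurable_leak_integrand M t j).lintegral_prod_right'

lemma min_one_le_rpow {s δ : ℝ} (hs : 0 ≤ s) (hδ : 0 ≤ δ) (hδ1 : δ ≤ 1) : min 1 s ≤ s ^ δ := by
  rcases le_total 1 s with h | h
  · exact (min_le_left _ _).trans (Real.one_le_rpow h hδ)
  · refine (min_le_right _ _).trans ?_
    rcases hs.eq_or_lt with rfl | hs
    · exact Real.rpow_nonneg le_rfl _
    · calc s = s ^ (1 : ℝ) := (Real.rpow_one s).symm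
        _ ≤ s ^ δ := Real.rpow_le_rpow_of_exponent_ge hs h hδ1

lemma cellAvg_leak_le {M δ t : ℝ} (hδ : 0 < δ) (hδ1 : δ ≤ 1) (ht : 0 < t)
    (j : ℤ) (x : E n) :
    cellAvg j (leak (M + δ) t j) x ≤ ENNReal.ofReal ((n * t / 2 ^ j) ^ δ) * bumpMass n M := by
  rw [cellAvg_eq j _ (mem_cell_cellIndex j x)]
  set v := cellIndex j x
  have hb := measurable_bump (n := n) (M + δ) t
  have e1 : ∫⁻ y in cell j v, leak (M + δ) t j y =
      ∫⁻ y, ∫⁻ z, bump (M + δ) t z * {y | y ∈ cell j v ∧ y - z ∉ cell j v}.indicator 1 y := by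
    rw [← lintegral_indicator (measurableSet_cell j v)]
    refine lintegral_congr fun y => ?_
    by_cases hy : y ∈ cell j v
    · rw [indicator_of_mem hy, leak, ← lintegral_sub_left_eq_self _ y]
      refine lintegral_congr fun z => ?_
      rw [sub_sub_cancel]
      have hy' : cellIndex j y = v := hy
      by_cases hz : cellIndex j (y - z) = v
      · rw [if_pos (hy'.trans hz.symm), indicator_of_notMem]
        exact fun h => h.2 hz
      · rw [if_neg (fun h => hz (h.symm.trans hy')), indicator_of_mem]
        · rfl
        · exact ⟨hy, hz⟩
    · rw [indicator_of_notMem hy]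
      symm
      rw [lintegral_congr (g := fun _ => 0), lintegral_zero]
      intro z
      rw [indicator_of_notMem (fun h => hy h.1), mul_zero]
  have hms : MeasurableSet {p : E n × E n | p.1 ∈ cell j v ∧ p.1 - p.2 ∉ cell j v} :=
    (measurable_fst (measurableSet_cell j v)).inter
      ((measurable_fst.sub measurable_snd) (measurableSet_cell j v)).compl
  have e2 : ∫⁻ y, ∫⁻ z, bump (M + δ) t z *
        {y | y ∈ cell j v ∧ y - z ∉ cell j v}.indicator 1 y =
      ∫⁻ z, bump (M + δ) t z * volume {y | y ∈ cell j v ∧ y - z ∉ cell j v} := by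
    rw [lintegral_lintegral_swap]
    · refine lintegral_congr fun z => ?_
      have hmz : MeasurableSet {y | y ∈ cell j v ∧ y - z ∉ cell j v} :=
        (measurableSet_cell j v).inter
          ((measurable_id.sub_const z) (measurableSet_cell j v)).compl
      rw [lintegral_const_mul _ (measurable_one.indicator hmz), lintegral_indicator_one hmz]
    · exact ((hb.comp measurable_snd).mul (measurable_one.indicator hms)).aemeasurable
  rw [e1, e2, ENNReal.inv_mul_le_iff (volume_cell_ne_zero j v) (volume_cell_ne_top j v)]
  rw [← lintegral_bump (n := n) M ht, ← lintegral_const_mul _ (measurable_bump M t),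
    ← lintegral_const_mul _ (by have := measurable_bump (n := n) M t; fun_prop)]
  refine lintegral_mono fun z => ?_
  have h1 : volume {y | y ∈ cell j v ∧ y - z ∉ cell j v} ≤
      ENNReal.ofReal ((n * ‖z‖ / 2 ^ j) ^ δ) * volume (cell j v) := by
    calc _ ≤ ENNReal.ofReal (min 1 (n * ‖z‖ / 2 ^ j)) * volume (cell j v) := by
          rcases le_total 1 (n * ‖z‖ / 2 ^ j) with h | h
          · rw [min_eq_left h, ENNReal.ofReal_one, one_mul]
            exact measure_mono fun y hy => hy.1
          · rw [min_eq_right h]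
            exact volume_cell_diff_shift j v z
      _ ≤ _ := by
          gcongr
          exact min_one_le_rpow (by positivity) hδ.le hδ1
  calc _ ≤ bump (M + δ) t z * (ENNReal.ofReal ((n * ‖z‖ / 2 ^ j) ^ δ) * volume (cell j v)) := by
        gcongr
    _ = volume (cell j v) * (ENNReal.ofReal ((n * t / 2 ^ j) ^ δ) *
          (bump (M + δ) t z * ENNReal.ofReal ((‖z‖ / t) ^ δ))) := by
        have : (n * ‖z‖ / 2 ^ j) ^ δ = (n * t / 2 ^ j) ^ δ * (‖z‖ / t) ^ δ := by
          rw [← Real.mul_rpow (by positivity) (by positivity)]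
          congr 1
          field_simp
        rw [this, ENNReal.ofReal_mul (by positivity)]
        ring
    _ ≤ _ := by
        gcongr
        exact bump_mul_rpow_le hδ.le ht z

lemma add_sq_le_two_mul (a b : ℝ≥0∞) : (a + b) ^ 2 ≤ 2 * (a ^ 2 + b ^ 2) := by
  have h := ENNReal.rpow_add_le_mul_rpow_add_rpow a b (p := 2) (by norm_num)
  norm_num at h
  exact h

/-- The oscillation of a function that is constant on cells of side `2 ^ j ≥ t`. -/
lemma lintegral_lintegral_bump_mul_sub_sq_le {M δ t : ℝ} (hδ : 0 < δ)
    (hδ1 : δ ≤ 1) (ht : 0 < t) {j : ℤ} {g : E n → ℂ} (hg : Measurable g)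
    (hgc : ∀ x y, cellIndex j x = cellIndex j y → g x = g y) :
    ∫⁻ x : E n, (∫⁻ y, bump (M + δ) t (x - y) * ‖g y - g x‖ₑ) ^ 2 ≤
      4 * bumpMass n (M + δ) * bumpMass n M * ENNReal.ofReal ((n * t / 2 ^ j) ^ δ) *
        ∫⁻ y, ‖g y‖ₑ ^ 2 := by
  have hb := measurable_bump (n := n) (M + δ) t
  set χ : E n → E n → ℝ≥0∞ := fun x y => if cellIndex j x = cellIndex j y then 0 else 1 with hχ
  set Φ : E n × E n → ℝ≥0∞ := fun p => bump (M + δ) t (p.1 - p.2) * χ p.1 p.2 with hΦ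
  have hΦm : Measurable Φ := measurable_leak_integrand (M + δ) t j
  have hΦs : ∀ x y, Φ (x, y) = Φ (y, x) := by
    intro x y
    simp only [hΦ, hχ, bump_comm _ _ x y, eq_comm]
  set I := ∫⁻ x, ∫⁻ y, Φ (x, y) * ‖g x‖ₑ ^ 2 with hI
  have hΦm1 : ∀ x, Measurable fun y => Φ (x, y) := fun x => hΦm.comp (by fun_prop)
  have hI1 : I ≤ ENNReal.ofReal ((n * t / 2 ^ j) ^ δ) * bumpMass n M * ∫⁻ y, ‖g y‖ₑ ^ 2 := by
    calc I = ∫⁻ x, ‖g x‖ₑ ^ 2 * leak (M + δ) t j x := by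
          refine lintegral_congr fun x => ?_
          rw [lintegral_mul_const _ (hΦm1 x), mul_comm]
          rfl
      _ = ∫⁻ x, ‖g x‖ₑ ^ 2 * cellAvg j (leak (M + δ) t j) x :=
          (lintegral_mul_cellAvg (fun x y hxy => by rw [hgc x y hxy])
            (measurable_leak _ _ _).aemeasurable).symm
      _ ≤ ∫⁻ x, ‖g x‖ₑ ^ 2 * (ENNReal.ofReal ((n * t / 2 ^ j) ^ δ) * bumpMass n M) := by
          gcongr
          exact cellAvg_leak_le hδ hδ1 ht j _
      _ = _ := by rw [lintegral_mul_const _ (by fun_prop), mul_comm]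
  have hI2 : ∫⁻ x, ∫⁻ y, Φ (x, y) * ‖g y‖ₑ ^ 2 = I := by
    rw [lintegral_lintegral_swap, hI]
    · simp_rw [hΦs]
    · exact (hΦm.mul (by fun_prop)).aemeasurable
  calc _ ≤ ∫⁻ x, bumpMass n (M + δ) *
        (∫⁻ y, Φ (x, y) * ‖g y‖ₑ ^ 2 + Φ (x, y) * ‖g x‖ₑ ^ 2) * 2 := by
        refine lintegral_mono fun x => ?_
        have h := sq_lintegral_mul_le' volume (w := fun y => bump (M + δ) t (x - y))
          (f := fun y => ‖g y - g x‖ₑ) (by fun_prop) (by fun_prop)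
        rw [lintegral_bump_sub _ ht] at h
        refine h.trans ?_
        rw [mul_assoc, ← lintegral_mul_const' _ _ (by norm_num)]
        refine mul_le_mul' le_rfl (lintegral_mono fun y => ?_)
        by_cases hxy : cellIndex j x = cellIndex j y
        · simp [hgc x y hxy]
        · have : Φ (x, y) = bump (M + δ) t (x - y) := by simp [hΦ, hχ, hxy]
          rw [this, ← mul_add, mul_assoc]
          gcongr
          refine (pow_le_pow_left' enorm_sub_le 2).trans ?_
          rw [mul_comm _ (2 : ℝ≥0∞)]
          exact add_sq_le_two_mul _ _
    _ = bumpMass n (M + δ) * (I + I) * 2 := by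
        have hm1 : Measurable fun p : E n × E n => Φ p * ‖g p.2‖ₑ ^ 2 := hΦm.mul (by fun_prop)
        have hm2 : Measurable fun p : E n × E n => Φ p * ‖g p.1‖ₑ ^ 2 := hΦm.mul (by fun_prop)
        have e : ∀ x, ∫⁻ y, Φ (x, y) * ‖g y‖ₑ ^ 2 + Φ (x, y) * ‖g x‖ₑ ^ 2 =
            (∫⁻ y, Φ (x, y) * ‖g y‖ₑ ^ 2) + ∫⁻ y, Φ (x, y) * ‖g x‖ₑ ^ 2 := fun x =>
          lintegral_add_left (hm1.comp (by fun_prop : Measurable fun y => (x, y))) _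
        simp_rw [e]
        have hm3 : Measurable fun x => ∫⁻ y, Φ (x, y) * ‖g y‖ₑ ^ 2 := hm1.lintegral_prod_right'
        have hm4 : Measurable fun x => ∫⁻ y, Φ (x, y) * ‖g x‖ₑ ^ 2 := hm2.lintegral_prod_right'
        have hm5 : Measurable fun x => (∫⁻ y, Φ (x, y) * ‖g y‖ₑ ^ 2) +
            ∫⁻ y, Φ (x, y) * ‖g x‖ₑ ^ 2 := hm3.add hm4
        rw [lintegral_mul_const' _ _ (by norm_num), lintegral_const_mul _ hm5,
          lintegral_add_left hm3, hI2]
    _ ≤ bumpMass n (M + δ) * (ENNReal.ofReal ((n * t / 2 ^ j) ^ δ) * bumpMass n M *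
          (∫⁻ y, ‖g y‖ₑ ^ 2) + ENNReal.ofReal ((n * t / 2 ^ j) ^ δ) * bumpMass n M *
          ∫⁻ y, ‖g y‖ₑ ^ 2) * 2 := by gcongr
    _ = _ := by ring

end

section

variable {n : ℕ}

/-! ### The `T(1)` theorem for square functions on `L²` -/

namespace IsLocalKernel

variable {κ : E n → ℂ} {M δ t : ℝ} {A : ℝ≥0} {x : E n}

lemma integral_mul_sub (h : IsLocalKernel κ M δ t A x) (hn : 1 ≤ n) (hM : (n : ℝ) < M)
    (hδ : 0 < δ) (ht : 0 < t) {f g : E n → ℂ} (hf : Integrable f) (hg : Integrable g) :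
    ∫ y, κ y * (f y - g y) = (∫ y, κ y * f y) - ∫ y, κ y * g y := by
  simp_rw [mul_sub]
  exact integral_sub (h.integrable_mul hn hM hδ ht hf) (h.integrable_mul hn hM hδ ht hg)

lemma enorm_fine_le (h : IsLocalKernel κ M δ t A x) (hn : 1 ≤ n) (hM : (n : ℝ) < M)
    (hδ : 0 < δ) (ht : 0 < t) {k : ℤ} (hk : (2 : ℝ) ^ k ≤ t) {f : E n → ℂ} (hf : Integrable f) :
    ‖(∫ y, κ y * f y) - ∫ y, κ y * cellMean k f y‖ₑ ≤
      ∑' i : ℕ, ‖∫ y, κ y * cellDiff (k - 1 - i) f y‖ₑ := by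
  have step : ∀ N : ℕ, ‖(∫ y, κ y * cellMean (k - N) f y) - ∫ y, κ y * cellMean k f y‖ₑ ≤
      ∑ i ∈ Finset.range N, ‖∫ y, κ y * cellDiff (k - 1 - i) f y‖ₑ := by
    intro N
    induction N with
    | zero => simp
    | succ N ih =>
      have e : ∫ y, κ y * cellDiff (k - 1 - N) f y =
          (∫ y, κ y * cellMean (k - (N + 1 : ℕ)) f y) - ∫ y, κ y * cellMean (k - N) f y := by
        rw [← h.integral_mul_sub hn hM hδ ht (integrable_cellMean _ hf) (integrable_cellMean _ hf)]
        have e1 : k - 1 - (N : ℤ) = k - (N + 1 : ℕ) := by push_cast; ring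
        have e2 : k - 1 - (N : ℤ) + 1 = k - N := by ring
        simp only [cellDiff, e2]
        rw [e1]
      rw [Finset.sum_range_succ, e, ← sub_add_sub_cancel' (∫ y, κ y * cellMean (k - N) f y)]
      refine (enorm_add_le _ _).trans ?_
      gcongr
  have lim : Tendsto (fun N : ℕ => ‖(∫ y, κ y * f y) - ∫ y, κ y * cellMean (k - N) f y‖ₑ) atTop
      (𝓝 0) := by
    have hle : ∀ N : ℕ, ‖(∫ y, κ y * f y) - ∫ y, κ y * cellMean (k - N) f y‖ₑ ≤
        A * ENNReal.ofReal ((n * 2 ^ (k - N) / t) ^ δ) *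
          (ENNReal.ofReal ((t ^ n)⁻¹) * ((∫⁻ y, ‖f y‖ₑ) + ∫⁻ y, ‖f y‖ₑ)) := by
      intro N
      have hi : Integrable (fun y => f y - cellMean (k - N) f y) :=
        hf.sub (integrable_cellMean _ hf)
      rw [← h.integral_mul_sub hn hM hδ ht hf (integrable_cellMean _ hf)]
      have hk' : (2 : ℝ) ^ (k - N : ℤ) ≤ t :=
        (zpow_le_zpow_right₀ one_le_two (by omega)).trans hk
      refine (h.enorm_integral_mul_le hn hM hδ ht hk' hi fun y => ?_).trans ?_
      · rw [cellMean_sub _ hf (integrable_cellMean _ hf), cellMean_cellMean le_rfl hf, sub_self]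
      · refine mul_le_mul' le_rfl ?_
        calc _ ≤ ∫⁻ y, ENNReal.ofReal ((t ^ n)⁻¹) * ‖f y - cellMean (k - N) f y‖ₑ := by
              gcongr
              exact bump_le ((Nat.cast_nonneg n).trans hM.le) ht _
          _ = ENNReal.ofReal ((t ^ n)⁻¹) * ∫⁻ y, ‖f y - cellMean (k - N) f y‖ₑ :=
              lintegral_const_mul' _ _ ENNReal.ofReal_ne_top
          _ ≤ ENNReal.ofReal ((t ^ n)⁻¹) * ∫⁻ y, ‖f y‖ₑ + ‖cellMean (k - N) f y‖ₑ := by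
              gcongr
              exact enorm_sub_le
          _ ≤ _ := by
              gcongr
              rw [lintegral_add_left' hf.1.enorm]
              refine add_le_add le_rfl ?_
              rw [← lintegral_cellAvg (k - N) (g := fun y => ‖f y‖ₑ) hf.1.enorm]
              exact lintegral_mono (enorm_cellMean_le _ _)
    have hfin : ENNReal.ofReal ((t ^ n)⁻¹) * ((∫⁻ y, ‖f y‖ₑ) + ∫⁻ y, ‖f y‖ₑ) ≠ ∞ :=
      ENNReal.mul_ne_top ENNReal.ofReal_ne_top (ENNReal.add_ne_top.2 ⟨hf.2.ne, hf.2.ne⟩)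
    have h1 : Tendsto (fun N : ℕ => (n * 2 ^ (k - N : ℤ) / t : ℝ) ^ δ) atTop (𝓝 0) := by
      have h2 : Tendsto (fun N : ℕ => (n * 2 ^ k / t : ℝ) * (1 / 2) ^ N) atTop (𝓝 0) := by
        simpa using (tendsto_pow_atTop_nhds_zero_of_lt_one (r := (1 / 2 : ℝ)) (by norm_num)
          (by norm_num)).const_mul (n * 2 ^ k / t : ℝ)
      have h3 := h2.rpow_const (p := δ) (Or.inr hδ.le)
      rw [Real.zero_rpow hδ.ne'] at h3
      refine h3.congr fun N => ?_
      congr 1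
      rw [zpow_sub₀ two_ne_zero, zpow_natCast, one_div, inv_pow]
      field_simp
    have h4 := ENNReal.Tendsto.mul_const (ENNReal.Tendsto.const_mul (ENNReal.tendsto_ofReal h1)
      (Or.inr (ENNReal.coe_ne_top (r := A)))) (Or.inr hfin)
    simp only [ENNReal.ofReal_zero, mul_zero, zero_mul] at h4
    exact tendsto_of_tendsto_of_tendsto_of_le_of_le tendsto_const_nhds h4 (fun _ => zero_le) hle
  have hlim := lim.add_const (∑' i : ℕ, ‖∫ y, κ y * cellDiff (k - 1 - i) f y‖ₑ)
  rw [zero_add] at hlim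
  refine ge_of_tendsto' hlim fun N => ?_
  rw [← sub_add_sub_cancel _ (∫ y, κ y * cellMean (k - N) f y)]
  refine (enorm_add_le _ _).trans ?_
  gcongr
  exact (step N).trans (ENNReal.sum_le_tsum _)

lemma enorm_coarse_le (h : IsLocalKernel κ M δ t A x) (hn : 1 ≤ n) (hM : (n : ℝ) < M)
    (hδ : 0 < δ) (ht : 0 < t) (k : ℤ) {f : E n → ℂ} (hf : Integrable f) :
    ‖(∫ y, κ y * cellMean k f y) - (∫ y, κ y) * cellMean k f x‖ₑ ≤
      ∑' i : ℕ, A * ∫⁻ y, bump (M + δ) t (x - y) *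
        ‖cellDiff (k + i) f y - cellDiff (k + i) f x‖ₑ := by
  have hb := measurable_bump (n := n) (M + δ) t
  have e : (∫ y, κ y * cellMean k f y) - (∫ y, κ y) * cellMean k f x =
      ∫ y, κ y * (cellMean k f y - cellMean k f x) := by
    simp_rw [mul_sub]
    rw [integral_sub (h.integrable_mul hn hM hδ ht (integrable_cellMean k hf))
      ((h.integrable hn hM hδ ht).mul_const _), integral_mul_const]
  set D : ℤ → E n → ℝ≥0∞ := fun j y => ‖cellMean j f y - cellMean j f x‖ₑ with hD
  set d : ℤ → E n → ℝ≥0∞ := fun j y => ‖cellDiff j f y - cellDiff j f x‖ₑ with hd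
  have hdm : ∀ j, Measurable (d j) := fun j =>
    ((measurable_cellDiff j f).sub measurable_const).enorm
  have hstep : ∀ j y, D j y ≤ d j y + D (j + 1) y := by
    intro j y
    simp only [hD, hd, cellDiff]
    refine le_trans (le_of_eq ?_) (enorm_add_le _ _)
    congr 1
    ring
  have hpt : ∀ (N : ℕ) y, D k y ≤ ∑ i ∈ Finset.range N, d (k + i) y + D (k + N) y := by
    intro N y
    induction N with
    | zero => simp
    | succ N ih =>
      refine ih.trans ?_
      rw [Finset.sum_range_succ, add_assoc]
      gcongr
      have := hstep (k + N) y
      rwa [add_assoc k] at this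
  have hDb : ∀ j y, D j y ≤ 2 * ((ENNReal.ofReal (2 ^ j) ^ n)⁻¹ * ∫⁻ z, ‖f z‖ₑ) := by
    intro j y
    have h1 : ∀ z, ‖cellMean j f z‖ₑ ≤ (ENNReal.ofReal (2 ^ j) ^ n)⁻¹ * ∫⁻ z, ‖f z‖ₑ := fun z =>
      (enorm_cellMean_le j f z).trans (mul_le_mul' le_rfl (setLIntegral_le_lintegral _ _))
    refine enorm_sub_le.trans ?_
    rw [two_mul]
    exact add_le_add (h1 y) (h1 x)
  have main : ∀ N : ℕ, ‖∫ y, κ y * (cellMean k f y - cellMean k f x)‖ₑ ≤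
      (∑' i : ℕ, A * ∫⁻ y, bump (M + δ) t (x - y) * d (k + i) y) +
        A * bumpMass n (M + δ) *
          (2 * ((ENNReal.ofReal (2 ^ (k + N)) ^ n)⁻¹ * ∫⁻ z, ‖f z‖ₑ)) := by
    intro N
    calc _ ≤ ∫⁻ y, A * (bump (M + δ) t (x - y) * D k y) := by
          refine (enorm_integral_le_lintegral_enorm _).trans (lintegral_mono fun y => ?_)
          rw [enorm_mul, ← mul_assoc]
          exact mul_le_mul' (h.size y) le_rfl
      _ = A * ∫⁻ y, bump (M + δ) t (x - y) * D k y :=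
          lintegral_const_mul' _ _ ENNReal.coe_ne_top
      _ ≤ A * ∫⁻ y, ∑ i ∈ Finset.range N, bump (M + δ) t (x - y) * d (k + i) y +
            bump (M + δ) t (x - y) *
              (2 * ((ENNReal.ofReal (2 ^ (k + N)) ^ n)⁻¹ * ∫⁻ z, ‖f z‖ₑ)) := by
          refine mul_le_mul' le_rfl (lintegral_mono fun y => ?_)
          rw [← Finset.mul_sum, ← mul_add]
          exact mul_le_mul' le_rfl ((hpt N y).trans (add_le_add le_rfl (hDb _ _)))
      _ = A * (∑ i ∈ Finset.range N, ∫⁻ y, bump (M + δ) t (x - y) * d (k + i) y) +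
            A * (bumpMass n (M + δ) *
              (2 * ((ENNReal.ofReal (2 ^ (k + N)) ^ n)⁻¹ * ∫⁻ z, ‖f z‖ₑ))) := by
          rw [lintegral_add_right _ (by fun_prop), lintegral_finsetSum, mul_add,
            lintegral_mul_const _ (by fun_prop), lintegral_bump_sub _ ht]
          intro i _
          exact (hb.comp (by fun_prop)).mul (hdm _)
      _ ≤ _ := by
          rw [Finset.mul_sum, ← mul_assoc (A : ℝ≥0∞)]
          gcongr
          exact ENNReal.sum_le_tsum (f := fun i : ℕ =>
            A * ∫⁻ y, bump (M + δ) t (x - y) * d (k + i) y) _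
  rw [e]
  have hlim : Tendsto (fun N : ℕ => (∑' i : ℕ, A * ∫⁻ y, bump (M + δ) t (x - y) * d (k + i) y) +
      A * bumpMass n (M + δ) *
        (2 * ((ENNReal.ofReal (2 ^ (k + N)) ^ n)⁻¹ * ∫⁻ z, ‖f z‖ₑ))) atTop
      (𝓝 (∑' i : ℕ, A * ∫⁻ y, bump (M + δ) t (x - y) * d (k + i) y)) := by
    have h1 : Tendsto (fun N : ℕ => ENNReal.ofReal ((2 : ℝ) ^ (k + N)) ^ n) atTop (𝓝 ∞) := by
      have h2 : Tendsto (fun N : ℕ => ((2 : ℝ) ^ k * 2 ^ N) ^ n) atTop atTop :=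
        (tendsto_pow_atTop (by omega)).comp ((tendsto_pow_atTop_atTop_of_one_lt
          (one_lt_two)).const_mul_atTop (by positivity))
      refine (ENNReal.tendsto_ofReal_nhds_top.2 h2).congr fun N => ?_
      rw [← ENNReal.ofReal_pow (by positivity), zpow_add₀ two_ne_zero, zpow_natCast]
    have h3 : Tendsto (fun N : ℕ => (ENNReal.ofReal ((2 : ℝ) ^ (k + N)) ^ n)⁻¹) atTop (𝓝 0) := by
      simpa using tendsto_inv_iff.2 h1
    have h4 := ENNReal.Tendsto.mul_const h3 (Or.inr hf.2.ne)
    have h5 := ENNReal.Tendsto.const_mul h4 (Or.inr (by norm_num : (2 : ℝ≥0∞) ≠ ∞))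
    have h6 := ENNReal.Tendsto.const_mul h5 (Or.inr (ENNReal.mul_ne_top (ENNReal.coe_ne_top (r := A))
      (bumpMass_lt_top (n := n) (N := M + δ) (by linarith)).ne))
    have h7 := h6.const_add (∑' i : ℕ, A * ∫⁻ y, bump (M + δ) t (x - y) * d (k + i) y)
    simpa using h7
  exact ge_of_tendsto' hlim main

end IsLocalKernel

lemma sq_tsum_le (ρ : ℝ≥0∞) (h0 : ρ ≠ 0) (h1 : ρ ≠ ∞) (W : ℕ → ℝ≥0∞) :
    (∑' i, W i) ^ 2 ≤ (∑' i : ℕ, ρ ^ i) * ∑' i, (ρ ^ i)⁻¹ * W i ^ 2 := by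
  have h := sq_lintegral_mul_le' Measure.count (w := fun i : ℕ => ρ ^ i)
    (f := fun i => (ρ ^ i)⁻¹ * W i) (measurable_of_countable _).aemeasurable
    (measurable_of_countable _).aemeasurable
  simp only [lintegral_count] at h
  have hc : ∀ i : ℕ, ρ ^ i * (ρ ^ i)⁻¹ = 1 := fun i =>
    ENNReal.mul_inv_cancel (pow_ne_zero _ h0) (ENNReal.pow_ne_top h1)
  refine le_of_eq_of_le ?_ (h.trans (le_of_eq ?_))
  · simp_rw [← mul_assoc, hc, one_mul]
  · congr 2
    funext i
    rw [mul_pow, sq (ρ ^ i)⁻¹, ← mul_assoc, ← mul_assoc, hc, one_mul]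

/-- Geometrically weighted sums of functions. -/
lemma lintegral_sq_tsum_le {α : Type*} [MeasurableSpace α] {μ : Measure α} {ρ K : ℝ≥0∞}
    (h0 : ρ ≠ 0) (h1 : ρ ≠ ∞) {W : ℕ → α → ℝ≥0∞} (hW : ∀ i, Measurable (W i)) {a : ℕ → ℝ≥0∞}
    (hWa : ∀ i, ∫⁻ x, W i x ^ 2 ∂μ ≤ K * (ρ ^ i) ^ 2 * a i) :
    ∫⁻ x, (∑' i, W i x) ^ 2 ∂μ ≤ (∑' i : ℕ, ρ ^ i) * (K * ∑' i, ρ ^ i * a i) := by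
  calc _ ≤ ∫⁻ x, (∑' i : ℕ, ρ ^ i) * ∑' i, (ρ ^ i)⁻¹ * W i x ^ 2 ∂μ :=
        lintegral_mono fun x => sq_tsum_le ρ h0 h1 _
    _ = (∑' i : ℕ, ρ ^ i) * ∑' i, (ρ ^ i)⁻¹ * ∫⁻ x, W i x ^ 2 ∂μ := by
        have hm : ∀ i, Measurable fun x => (ρ ^ i)⁻¹ * W i x ^ 2 := fun i =>
          ((hW i).pow_const 2).const_mul _
        rw [lintegral_const_mul _ (Measurable.tsum hm),
          lintegral_tsum fun i => (hm i).aemeasurable]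
        simp_rw [fun i => lintegral_const_mul (μ := μ) ((ρ ^ i)⁻¹) ((hW i).pow_const 2)]
    _ ≤ _ := by
        refine mul_le_mul' le_rfl ?_
        rw [← ENNReal.tsum_mul_left]
        refine ENNReal.tsum_le_tsum fun i => ?_
        calc (ρ ^ i)⁻¹ * ∫⁻ x, W i x ^ 2 ∂μ ≤ (ρ ^ i)⁻¹ * (K * (ρ ^ i) ^ 2 * a i) := by
              gcongr
              exact hWa i
          _ = (ρ ^ i * (ρ ^ i)⁻¹) * (K * (ρ ^ i * a i)) := by ring
          _ = _ := by
              rw [ENNReal.mul_inv_cancel (pow_ne_zero _ h0) (ENNReal.pow_ne_top h1), one_mul]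

lemma lintegral_dtOverT_comp_log_add_le (F : ℤ → ℝ≥0∞) (g : ℝ → ℝ≥0∞) :
    ∫⁻ t, F (Int.log 2 t) + g t ∂dtOverT ≤ ∑' k, F k + ∫⁻ t, g t ∂dtOverT := by
  rw [lintegral_dtOverT_eq_tsum, lintegral_dtOverT_eq_tsum g, ← ENNReal.tsum_add]
  refine ENNReal.tsum_le_tsum fun k => ?_
  rw [setLIntegral_congr_fun (g := fun t => F k + g t) measurableSet_Ico
    (fun t ht => by simp only [(mem_Ico_zpow_iff.1 ht).2]), lintegral_add_left measurable_const,
    setLIntegral_const]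
  gcongr
  exact mul_le_of_le_one_right zero_le (dtOverT_Ico_le k)

end

section

variable {n : ℕ}

/-- The constant in the almost orthogonality estimates. -/
def orthoConst (n : ℕ) (M δ : ℝ) (A : ℝ≥0) : ℝ≥0∞ :=
  A ^ 2 * ENNReal.ofReal ((2 * n) ^ δ) *
    (ENNReal.ofReal ((2 * n) ^ δ) * bumpMass n M ^ 2 + 4 * bumpMass n (M + δ) * bumpMass n M)

/-- The ratio of the geometric series in the almost orthogonality estimates. -/
def orthoRatio (δ : ℝ) : ℝ≥0∞ := ENNReal.ofReal (2 ^ (-(δ / 2)))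

lemma orthoRatio_ne_zero (δ : ℝ) : orthoRatio δ ≠ 0 :=
  (ENNReal.ofReal_pos.2 (by positivity)).ne'

lemma orthoRatio_ne_top (δ : ℝ) : orthoRatio δ ≠ ∞ := ENNReal.ofReal_ne_top

lemma orthoRatio_lt_one {δ : ℝ} (hδ : 0 < δ) : orthoRatio δ < 1 := by
  rw [orthoRatio, ENNReal.ofReal_lt_one]
  exact Real.rpow_lt_one_of_one_lt_of_neg one_lt_two (by linarith)

lemma tsum_orthoRatio_pow_ne_top {δ : ℝ} (hδ : 0 < δ) : ∑' i : ℕ, orthoRatio δ ^ i ≠ ∞ := by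
  rw [ENNReal.tsum_geometric]
  exact ENNReal.inv_ne_top.2 (tsub_pos_of_lt (orthoRatio_lt_one hδ)).ne'

lemma orthoConst_ne_top {M δ : ℝ} (hM : (n : ℝ) < M) (hδ : 0 < δ) (A : ℝ≥0) :
    orthoConst n M δ A ≠ ∞ := by
  have h1 := (bumpMass_lt_top (n := n) hM).ne
  have h2 := (bumpMass_lt_top (n := n) (N := M + δ) (by linarith)).ne
  unfold orthoConst
  finiteness

lemma ofReal_rpow_le_orthoRatio {s δ : ℝ} (hδ : 0 < δ) (hs0 : 0 ≤ s) {i : ℕ}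
    (hs : s ≤ 2 * n * (1 / 2) ^ i) :
    ENNReal.ofReal (s ^ δ) ≤ ENNReal.ofReal ((2 * n) ^ δ) * (orthoRatio δ ^ i) ^ 2 := by
  have h : (((2 : ℝ) ^ (-(δ / 2))) ^ i) ^ 2 = ((1 / 2 : ℝ) ^ i) ^ δ := by
    rw [← Real.rpow_natCast, ← Real.rpow_natCast, ← Real.rpow_mul (by positivity),
      ← Real.rpow_mul (by positivity), ← Real.rpow_natCast, ← Real.rpow_mul (by positivity),
      one_div, Real.inv_rpow (by norm_num), ← Real.rpow_neg (by norm_num)]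
    congr 1
    push_cast
    ring
  rw [orthoRatio, ← ENNReal.ofReal_pow (by positivity), ← ENNReal.ofReal_pow (by positivity), h,
    ← ENNReal.ofReal_mul (by positivity), ← Real.mul_rpow (by positivity) (by positivity)]
  exact ENNReal.ofReal_le_ofReal (Real.rpow_le_rpow hs0 hs hδ.le)

/-- Pointwise domination of a kernel operator by its paraproduct part and an error which is small
in `L²`, at a fixed scale `t`. -/
lemma exists_majorant {κ : E n → E n → ℂ} {M δ t : ℝ} {A : ℝ≥0} (hn : 1 ≤ n) (hM : (n : ℝ) < M)
    (hδ : 0 < δ) (hδ1 : δ ≤ 1) (ht : 0 < t) (hκ : ∀ x, IsLocalKernel (κ x) M δ t A x)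
    {f : E n → ℂ} (hf : Integrable f) {k : ℤ} (hk : (2 : ℝ) ^ k ≤ t) (hk' : t ≤ 2 ^ (k + 1)) :
    ∃ G : E n → ℝ≥0∞, Measurable G ∧
      (∀ x, ‖∫ y, κ x y * f y‖ₑ ≤ G x + ‖∫ y, κ x y‖ₑ * cellAvg k (fun y => ‖f y‖ₑ) x) ∧
      ∫⁻ x, G x ^ 2 ≤ 2 * ((∑' i : ℕ, orthoRatio δ ^ i) * (orthoConst n M δ A *
        ∑' i : ℕ, orthoRatio δ ^ i * ((∫⁻ x, ‖cellDiff (k - 1 - i) f x‖ₑ ^ 2) +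
          ∫⁻ x, ‖cellDiff (k + i) f x‖ₑ ^ 2))) := by
  have hn' : (1 : ℝ) ≤ n := by exact_mod_cast hn
  have h2k : (0 : ℝ) < 2 ^ k := by positivity
  have hb := measurable_bump (n := n) M t
  have hb' := measurable_bump (n := n) (M + δ) t
  have hdm := fun j => measurable_cellDiff (n := n) j f
  set ρ := orthoRatio δ
  set c := ENNReal.ofReal ((2 * n) ^ δ) with hc
  have hρ1 : ρ ≤ 1 := (orthoRatio_lt_one hδ).le
  set U : ℕ → E n → ℝ≥0∞ := fun i x => A * (c * (ρ ^ i) ^ 2) *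
    ∫⁻ y, bump M t (x - y) * ‖cellDiff (k - 1 - i) f y‖ₑ with hU
  set V : ℕ → E n → ℝ≥0∞ := fun i x => A * ∫⁻ y, bump (M + δ) t (x - y) *
    ‖cellDiff (k + i) f y - cellDiff (k + i) f x‖ₑ with hV
  have hI1 : ∀ i : ℕ, Measurable fun x : E n =>
      ∫⁻ y, bump M t (x - y) * ‖cellDiff (k - 1 - i) f y‖ₑ := fun i =>
    Measurable.lintegral_prod_right' (f := fun p : E n × E n =>
      bump M t (p.1 - p.2) * ‖cellDiff (k - 1 - i) f p.2‖ₑ)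
      (by have := hdm (k - 1 - i); fun_prop)
  have hI2 : ∀ i : ℕ, Measurable fun x : E n => ∫⁻ y, bump (M + δ) t (x - y) *
      ‖cellDiff (k + i) f y - cellDiff (k + i) f x‖ₑ := fun i =>
    Measurable.lintegral_prod_right' (f := fun p : E n × E n =>
      bump (M + δ) t (p.1 - p.2) * ‖cellDiff (k + i) f p.2 - cellDiff (k + i) f p.1‖ₑ)
      (by have := hdm (k + i); fun_prop)
  have hUm : ∀ i, Measurable (U i) := fun i => (hI1 i).const_mul _
  have hVm : ∀ i, Measurable (V i) := fun i => (hI2 i).const_mul _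
  have hUa : ∀ i, ∫⁻ x, U i x ^ 2 ≤ orthoConst n M δ A * (ρ ^ i) ^ 2 *
      ∫⁻ x, ‖cellDiff (k - 1 - i) f x‖ₑ ^ 2 := by
    intro i
    simp only [hU, mul_pow _ (∫⁻ y, _) 2]
    rw [lintegral_const_mul _ ((hI1 i).pow_const 2)]
    calc _ ≤ (A * (c * (ρ ^ i) ^ 2)) ^ 2 *
          (bumpMass n M ^ 2 * ∫⁻ x, ‖cellDiff (k - 1 - i) f x‖ₑ ^ 2) := by
          refine mul_le_mul' le_rfl (lintegral_lintegral_bump_mul_sq_le M ht (hdm _).enorm)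
      _ = A ^ 2 * c * (c * bumpMass n M ^ 2) * (ρ ^ i) ^ 2 *
            (∫⁻ x, ‖cellDiff (k - 1 - i) f x‖ₑ ^ 2) * (ρ ^ i) ^ 2 := by ring
      _ ≤ A ^ 2 * c * (c * bumpMass n M ^ 2) * (ρ ^ i) ^ 2 *
            (∫⁻ x, ‖cellDiff (k - 1 - i) f x‖ₑ ^ 2) :=
          mul_le_of_le_one_right zero_le (pow_le_one₀ zero_le (pow_le_one₀ zero_le hρ1))
      _ ≤ _ := by
          rw [orthoConst]
          gcongr
          exact le_self_add
  have hVa : ∀ i, ∫⁻ x, V i x ^ 2 ≤ orthoConst n M δ A * (ρ ^ i) ^ 2 *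
      ∫⁻ x, ‖cellDiff (k + i) f x‖ₑ ^ 2 := by
    intro i
    simp only [hV, mul_pow _ (∫⁻ y, _) 2]
    rw [lintegral_const_mul _ ((hI2 i).pow_const 2)]
    have hs : n * t / 2 ^ (k + i : ℤ) ≤ 2 * n * (1 / 2 : ℝ) ^ i := by
      rw [zpow_add₀ two_ne_zero, zpow_natCast, div_le_iff₀ (by positivity), one_div, inv_pow]
      rw [zpow_add_one₀ two_ne_zero] at hk'
      calc n * t ≤ n * (2 ^ k * 2) := by gcongr
        _ = _ := by field_simp
    calc _ ≤ (A : ℝ≥0∞) ^ 2 * (4 * bumpMass n (M + δ) * bumpMass n M * (c * (ρ ^ i) ^ 2) *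
          ∫⁻ x, ‖cellDiff (k + i) f x‖ₑ ^ 2) := by
          refine mul_le_mul' le_rfl ((lintegral_lintegral_bump_mul_sub_sq_le hδ hδ1 ht (hdm _)
            (fun x y hxy => cellDiff_congr_cell f hxy)).trans ?_)
          gcongr
          exact ofReal_rpow_le_orthoRatio hδ (by positivity) hs
      _ = A ^ 2 * c * (4 * bumpMass n (M + δ) * bumpMass n M) * (ρ ^ i) ^ 2 *
            ∫⁻ x, ‖cellDiff (k + i) f x‖ₑ ^ 2 := by ring
      _ ≤ _ := by
          rw [orthoConst]
          gcongr
          exact le_add_self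
  refine ⟨fun x => (∑' i, U i x) + ∑' i, V i x,
    (Measurable.tsum hUm).add (Measurable.tsum hVm), fun x => ?_, ?_⟩
  · have hfine := (hκ x).enorm_fine_le hn hM hδ ht hk hf
    have hcoarse := (hκ x).enorm_coarse_le hn hM hδ ht k hf
    have hU' : ∀ i : ℕ, ‖∫ y, κ x y * cellDiff (k - 1 - i) f y‖ₑ ≤ U i x := by
      intro i
      have hj : (2 : ℝ) ^ (k - 1 - i + 1 : ℤ) = 2 ^ k * (1 / 2) ^ i := by
        rw [show k - 1 - (i : ℤ) + 1 = k - i by ring, zpow_sub₀ two_ne_zero, zpow_natCast, one_div,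
          inv_pow, div_eq_mul_inv]
      have hj' : (2 : ℝ) ^ (k - 1 - i + 1 : ℤ) ≤ t := by
        rw [hj]
        exact (mul_le_of_le_one_right h2k.le (pow_le_one₀ (by norm_num) (by norm_num))).trans hk
      refine ((hκ x).enorm_integral_mul_le hn hM hδ ht hj' (integrable_cellDiff _ hf)
        (fun y => cellMean_cellDiff _ hf y)).trans ?_
      simp only [hU]
      gcongr
      refine ofReal_rpow_le_orthoRatio hδ (by positivity) ?_
      rw [hj, div_le_iff₀ ht]
      calc (n : ℝ) * (2 ^ k * (1 / 2) ^ i) ≤ n * (t * (1 / 2) ^ i) := by gcongr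
        _ ≤ 2 * (n * (t * (1 / 2) ^ i)) := by
            have : 0 ≤ n * (t * (1 / 2) ^ i) := by positivity
            linarith
        _ = _ := by ring
    have e : ∫ y, κ x y * f y = ((∫ y, κ x y * f y) - ∫ y, κ x y * cellMean k f y) +
        ((∫ y, κ x y * cellMean k f y) - (∫ y, κ x y) * cellMean k f x) +
        (∫ y, κ x y) * cellMean k f x := by ring
    rw [e]
    refine (enorm_add_le _ _).trans (add_le_add ((enorm_add_le _ _).trans
      (add_le_add (hfine.trans (ENNReal.tsum_le_tsum hU')) hcoarse)) ?_)
    rw [enorm_mul]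
    gcongr
    exact enorm_cellMean_le k f x
  · calc _ ≤ ∫⁻ x, 2 * ((∑' i, U i x) ^ 2 + (∑' i, V i x) ^ 2) :=
          lintegral_mono fun x => add_sq_le_two_mul _ _
      _ = 2 * ((∫⁻ x, (∑' i, U i x) ^ 2) + ∫⁻ x, (∑' i, V i x) ^ 2) := by
          have h1 : Measurable fun x => (∑' i, U i x) ^ 2 := (Measurable.tsum hUm).pow_const 2
          have h2 : Measurable fun x => (∑' i, V i x) ^ 2 := (Measurable.tsum hVm).pow_const 2
          rw [lintegral_const_mul' _ _ (by norm_num), lintegral_add_left h1]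
      _ ≤ _ := by
          simp_rw [mul_add (ρ ^ _)]
          rw [ENNReal.tsum_add, mul_add (orthoConst n M δ A), mul_add (∑' i : ℕ, ρ ^ i)]
          refine mul_le_mul' le_rfl (add_le_add ?_ ?_)
          · exact lintegral_sq_tsum_le (orthoRatio_ne_zero δ) (orthoRatio_ne_top δ) hUm hUa
          · exact lintegral_sq_tsum_le (orthoRatio_ne_zero δ) (orthoRatio_ne_top δ) hVm hVa

/-- The constant in the `T(1)` theorem. -/
def squareConst (n : ℕ) (M δ : ℝ) (A C : ℝ≥0) : ℝ≥0∞ :=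
  2 * (4 * ((∑' i : ℕ, orthoRatio δ ^ i) * (orthoConst n M δ A * ∑' i : ℕ, orthoRatio δ ^ i)) +
    (1 + 2 ^ n * C : ℝ≥0∞) ^ 2)

lemma squareConst_ne_top {M δ : ℝ} (hM : (n : ℝ) < M) (hδ : 0 < δ) (A C : ℝ≥0) :
    squareConst n M δ A C ≠ ∞ := by
  have h1 := orthoConst_ne_top hM hδ A
  have h2 := tsum_orthoRatio_pow_ne_top hδ
  unfold squareConst
  have h3 : (1 + 2 ^ n * C : ℝ≥0∞) ≠ ∞ := by finiteness
  finiteness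

lemma measurable_intLog : Measurable fun t : ℝ => Int.log 2 t := by
  refine measurable_to_countable' fun k => ?_
  have e : (fun t : ℝ => Int.log 2 t) ⁻¹' {k} =
      Ico ((2 : ℝ) ^ k) (2 ^ (k + 1)) ∪ (if k = 0 then Iic 0 else ∅) := by
    ext t
    rw [mem_union, mem_Ico_zpow_iff, mem_preimage, mem_singleton_iff]
    rcases lt_or_ge 0 t with h | h
    · split_ifs <;> simp [h]
    · rw [Int.log_of_right_le_zero _ h]
      split_ifs with hk <;> simp [h, eq_comm, hk]
  rw [e]
  refine measurableSet_Ico.union ?_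
  split_ifs
  exacts [measurableSet_Iic, MeasurableSet.empty]

lemma measurable_cellAvg_intLog (F : E n → ℝ≥0∞) :
    Measurable fun q : E n × ℝ => cellAvg (Int.log 2 q.2) F q.1 := by
  have h1 : Measurable fun p : E n × ℤ => cellAvg p.2 F p.1 :=
    measurable_from_prod_countable_left (f := fun p : E n × ℤ => cellAvg p.2 F p.1)
      (fun l => (measurable_cellAvg l F : Measurable fun x => cellAvg l F x))
  have h3 : Measurable fun q : E n × ℝ => Int.log 2 q.2 := measurable_intLog.comp measurable_snd
  have h2 : Measurable fun q : E n × ℝ => (q.1, Int.log 2 q.2) :=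
    Measurable.prodMk measurable_fst h3
  have h4 := Measurable.comp h1 h2
  simp only [Function.comp_def] at h4
  exact h4

/-- The `T(1)` theorem for square functions. -/
theorem lintegral_square_le {k : ℝ → E n → E n → ℂ} {M δ : ℝ} {A C : ℝ≥0} (hn : 1 ≤ n)
    (hM : (n : ℝ) < M) (hδ : 0 < δ) (hδ1 : δ ≤ 1)
    (hk : ∀ t, 0 < t → ∀ x, IsLocalKernel (k t x) M δ t A x)
    (hC : CarlesonBound (fun q => ‖∫ y, k q.2 q.1 y‖ₑ ^ 2) C)
    (hm1 : AEMeasurable (fun q : E n × ℝ => ‖∫ y, k q.2 q.1 y‖ₑ ^ 2) (volume.prod dtOverT))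
    {f : E n → ℂ} (hfm : Measurable f) (hf : Integrable f) (hf2 : MemLp f 2)
    (hmf : AEMeasurable (fun q : E n × ℝ => ‖∫ y, k q.2 q.1 y * f y‖ₑ ^ 2)
      (volume.prod dtOverT)) :
    ∫⁻ x, ∫⁻ t, ‖∫ y, k t x y * f y‖ₑ ^ 2 ∂dtOverT ≤
      squareConst n M δ A C * ∫⁻ x, ‖f x‖ₑ ^ 2 := by
  set a : ℤ → ℝ≥0∞ := fun j => ∫⁻ x, ‖cellDiff j f x‖ₑ ^ 2 with ha
  set ρ := orthoRatio δ
  set S := ∑' i : ℕ, ρ ^ i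
  set K := orthoConst n M δ A
  set F : E n → ℝ≥0∞ := fun y => ‖f y‖ₑ with hF
  have hFm : Measurable F := hfm.enorm
  set H : ℤ → ℝ≥0∞ := fun j =>
    2 * (S * (K * ∑' i : ℕ, ρ ^ i * (a (j - 1 - i) + a (j + i)))) with hH
  set P : ℝ → ℝ≥0∞ := fun t => ∫⁻ x, ‖∫ y, k t x y‖ₑ ^ 2 * cellAvg (Int.log 2 t) F x ^ 2 with hP
  have hfix : ∀ t, 0 < t → ∫⁻ x, ‖∫ y, k t x y * f y‖ₑ ^ 2 ≤ 2 * (H (Int.log 2 t) + P t) := by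
    intro t ht
    obtain ⟨h1, h2⟩ := mem_Ico_zpow_iff.2 ⟨ht, rfl⟩
    obtain ⟨G, hG, hle, hG2⟩ := exists_majorant hn hM hδ hδ1 ht (hk t ht) hf h1 h2.le
    calc _ ≤ ∫⁻ x, 2 * (G x ^ 2 + ‖∫ y, k t x y‖ₑ ^ 2 * cellAvg (Int.log 2 t) F x ^ 2) := by
          refine lintegral_mono fun x => (pow_le_pow_left' (hle x) 2).trans ?_
          rw [← mul_pow]
          exact add_sq_le_two_mul _ _
      _ = 2 * ((∫⁻ x, G x ^ 2) + P t) := by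
          rw [lintegral_const_mul' _ _ (by norm_num), lintegral_add_left (hG.pow_const 2)]
      _ ≤ _ := by gcongr
  have hPle : ∫⁻ t, P t ∂dtOverT ≤ (1 + 2 ^ n * C : ℝ≥0∞) ^ 2 * ∫⁻ x, F x ^ 2 := by
    refine le_of_eq_of_le ?_ (hC.lintegral_mul_cellAvg_sq_le hm1 hFm)
    simp only [hP]
    symm
    refine lintegral_lintegral_swap ?_
    have hlog : Measurable fun q : E n × ℝ => cellAvg (Int.log 2 q.2) F q.1 :=
      measurable_cellAvg_intLog F
    exact hm1.mul (hlog.pow_const 2).aemeasurable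
  have hHle : ∑' j, H j ≤ 4 * (S * (K * S)) * ∫⁻ x, F x ^ 2 := by
    have hsum := tsum_lintegral_cellDiff_sq_le hfm hf hf2
    simp only [hH]
    rw [ENNReal.tsum_mul_left, ENNReal.tsum_mul_left, ENNReal.tsum_mul_left, ENNReal.tsum_comm]
    have e : ∀ i : ℕ, ∑' j : ℤ, ρ ^ i * (a (j - 1 - i) + a (j + i)) =
        ρ ^ i * (∑' j, a j + ∑' j, a j) := by
      intro i
      rw [ENNReal.tsum_mul_left, ENNReal.tsum_add]
      congr 2
      · have := (Equiv.addRight (-1 - i : ℤ)).tsum_eq a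
        rw [← this]
        congr 1
        funext j
        simp only [Equiv.coe_addRight]
        congr 1
        ring
      · exact (Equiv.addRight (i : ℤ)).tsum_eq a
    simp_rw [e]
    rw [ENNReal.tsum_mul_right]
    calc _ = 4 * (S * (K * S)) * ∑' j, a j := by ring
      _ ≤ _ := by gcongr
  calc _ = ∫⁻ t, ∫⁻ x, ‖∫ y, k t x y * f y‖ₑ ^ 2 ∂volume ∂dtOverT := lintegral_lintegral_swap hmf
    _ ≤ ∫⁻ t, 2 * (H (Int.log 2 t) + P t) ∂dtOverT := by
        refine lintegral_mono_ae ?_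
        filter_upwards [ae_dtOverT_pos] with t ht using hfix t ht
    _ = 2 * ∫⁻ t, (H (Int.log 2 t) + P t) ∂dtOverT := lintegral_const_mul' _ _ (by norm_num)
    _ ≤ 2 * (4 * (S * (K * S)) * (∫⁻ x, F x ^ 2) +
          (1 + 2 ^ n * C : ℝ≥0∞) ^ 2 * ∫⁻ x, F x ^ 2) := by
        gcongr
        exact (lintegral_dtOverT_comp_log_add_le H P).trans (add_le_add hHle hPle)
    _ = _ := by
        rw [squareConst]
        ring

end

section

variable {n : ℕ}

/-! ### Tails -/

lemma Cube.side_div_two_le_norm {Q : Cube n} {x y : E n} (hx : x ∈ Q.toSet)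
    (hy : y ∉ Q.double.toSet) : Q.side / 2 ≤ ‖x - y‖ := by
  simp only [Cube.toSet, Cube.double, mem_ofPred_eq, not_forall, not_le] at hx hy
  obtain ⟨i, hi⟩ := hy
  have h1 := hx i
  have h2 : |x i - y i| ≤ ‖x - y‖ := PiLp.norm_apply_le (x - y) i
  have h3 : |y i - Q.center i| ≤ |x i - y i| + |x i - Q.center i| := by
    rw [abs_sub_comm (x i) (y i)]
    exact abs_sub_le _ _ _
  linarith

lemma setLIntegral_compl_double_bump_le {M δ t : ℝ} (hδ : 0 ≤ δ) (ht : 0 < t) (Q : Cube n)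
    {x : E n} (hx : x ∈ Q.toSet) :
    ∫⁻ y in (Q.double.toSet)ᶜ, bump (M + δ) t (x - y) ≤
      ENNReal.ofReal ((2 * t / Q.side) ^ δ) * bumpMass n M := by
  have hs := Q.side_pos
  have hb := measurable_bump (n := n) M t
  calc _ ≤ ∫⁻ y in (Q.double.toSet)ᶜ, ENNReal.ofReal ((2 * t / Q.side) ^ δ) * bump M t (x - y) := by
        refine setLIntegral_mono (by fun_prop) fun y hy => ?_
        have h := bump_le_of_le_norm (N := M) hδ ht (by positivity)
          (Cube.side_div_two_le_norm hx hy)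
        rwa [show t / (Q.side / 2) = 2 * t / Q.side by field_simp] at h
    _ ≤ ∫⁻ y, ENNReal.ofReal ((2 * t / Q.side) ^ δ) * bump M t (x - y) :=
        setLIntegral_le_lintegral _ _
    _ = _ := by rw [lintegral_const_mul' _ _ ENNReal.ofReal_ne_top, lintegral_bump_sub M ht]

lemma setLIntegral_Ioc_tail_sq {δ ℓ : ℝ} (hδ : 0 < δ) (hℓ : 0 < ℓ) (c : ℝ≥0∞) :
    ∫⁻ t in Ioc 0 ℓ, (ENNReal.ofReal ((2 * t / ℓ) ^ δ) * c) ^ 2 ∂dtOverT =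
      ENNReal.ofReal (2 ^ (2 * δ) * (2 * δ)⁻¹) * c ^ 2 := by
  have e : ∫⁻ t in Ioc 0 ℓ, (ENNReal.ofReal ((2 * t / ℓ) ^ δ) * c) ^ 2 ∂dtOverT =
      ∫⁻ t in Ioc 0 ℓ, (ENNReal.ofReal (2 ^ (2 * δ)) * c ^ 2) *
        ENNReal.ofReal ((t / ℓ) ^ (2 * δ)) ∂dtOverT := by
    refine setLIntegral_congr_fun measurableSet_Ioc fun t ht => ?_
    have ht0 : 0 < t := ht.1
    have h1 : ((2 * t / ℓ) ^ δ) ^ 2 = 2 ^ (2 * δ) * (t / ℓ) ^ (2 * δ) := by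
      rw [← Real.rpow_natCast, ← Real.rpow_mul (by positivity),
        ← Real.mul_rpow (by positivity) (by positivity), mul_comm δ]
      congr 1
      ring
    simp only [mul_pow]
    rw [← ENNReal.ofReal_pow (by positivity), h1, ENNReal.ofReal_mul (by positivity)]
    ring
  rw [e, lintegral_const_mul _ (by fun_prop), lintegral_Ioc_div_rpow (by positivity) hℓ,
    ENNReal.ofReal_mul (by positivity)]
  ring

/-- The Carleson constant of the image of a bounded function. -/
def boundedCarlesonConst (n : ℕ) (M δ : ℝ) (A : ℝ≥0) (B : ℝ≥0∞) : ℝ≥0∞ :=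
  2 * (B * 2 ^ n + ENNReal.ofReal (2 ^ (2 * δ) * (2 * δ)⁻¹) * (A * bumpMass n M) ^ 2)

lemma boundedCarlesonConst_ne_top {M δ : ℝ} (hM : (n : ℝ) < M) (A : ℝ≥0) {B : ℝ≥0∞}
    (hB : B ≠ ∞) : boundedCarlesonConst n M δ A B ≠ ∞ := by
  have h1 := (bumpMass_lt_top (n := n) hM).ne
  unfold boundedCarlesonConst
  finiteness

/-- An operator that is bounded on `L²` maps bounded functions to Carleson measures. -/
theorem lintegral_cube_le_of_bounded {k : ℝ → E n → E n → ℂ} {M δ : ℝ} {A : ℝ≥0} {B : ℝ≥0∞}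
    (hn : 1 ≤ n) (hM : (n : ℝ) < M) (hδ : 0 < δ)
    (hk : ∀ t, 0 < t → ∀ x, IsLocalKernel (k t x) M δ t A x)
    (hB : ∀ f : E n → ℂ, Measurable f → Integrable f → MemLp f 2 →
      ∫⁻ x, ∫⁻ t, ‖∫ y, k t x y * f y‖ₑ ^ 2 ∂dtOverT ≤ B * ∫⁻ x, ‖f x‖ₑ ^ 2)
    {f : E n → ℂ} (hf : Measurable f) (hf1 : ∀ y, ‖f y‖ ≤ 1) (Q : Cube n) :
    ∫⁻ x in Q.toSet, ∫⁻ t in Ioc 0 Q.side, ‖∫ y, k t x y * f y‖ₑ ^ 2 ∂dtOverT ≤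
      boundedCarlesonConst n M δ A B * volume Q.toSet := by
  have hD := Q.double.measurableSet_toSet
  have hs := Q.side_pos
  set g := Q.double.toSet.indicator f with hg
  have hgm : Measurable g := hf.indicator hD
  have hf1e : ∀ y, ‖f y‖ₑ ≤ 1 := fun y => by
    rw [← ofReal_norm]
    exact ENNReal.ofReal_le_one.2 (hf1 y)
  have hge : ∀ y, ‖g y‖ₑ ^ 2 ≤ Q.double.toSet.indicator 1 y := by
    intro y
    by_cases hy : y ∈ Q.double.toSet
    · rw [hg, indicator_of_mem hy, indicator_of_mem hy]
      exact pow_le_one₀ zero_le (hf1e y)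
    · simp [hg, indicator_of_notMem hy]
  have hg2 : ∫⁻ y, ‖g y‖ₑ ^ 2 ≤ 2 ^ n * volume Q.toSet := by
    refine (lintegral_mono hge).trans ?_
    rw [lintegral_indicator_one hD, Q.volume_double]
  have hgi : Integrable g := by
    rw [hg, integrable_indicator_iff hD]
    exact Measure.integrableOn_of_bounded Q.double.volume_ne_top hf.aestronglyMeasurable
      (ae_of_all _ hf1)
  have hgL : MemLp g 2 := by
    refine ⟨hgm.aestronglyMeasurable, ?_⟩
    rw [eLpNorm_lt_top_iff_lintegral_rpow_enorm_lt_top (by norm_num) (by norm_num)]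
    simp only [ENNReal.toReal_ofNat, ENNReal.rpow_ofNat]
    refine hg2.trans_lt (ENNReal.mul_lt_top (by finiteness) Q.volume_ne_top.lt_top)
  set τ : ℝ → ℝ≥0∞ := fun t =>
    (ENNReal.ofReal ((2 * t / Q.side) ^ δ) * (A * bumpMass n M)) ^ 2 with hτ
  have hτm : Measurable τ := by fun_prop
  have hpt : ∀ x ∈ Q.toSet, ∀ t ∈ Ioc 0 Q.side, ‖∫ y, k t x y * f y‖ₑ ^ 2 ≤
      2 * (‖∫ y, k t x y * g y‖ₑ ^ 2 + τ t) := by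
    intro x hx t ht
    have hK := hk t ht.1 x
    have hkf : Integrable fun y => k t x y * f y := by
      have := (hK.integrable hn hM hδ ht.1).bdd_mul (c := 1) hf.aestronglyMeasurable
        (ae_of_all _ hf1)
      simpa only [mul_comm] using this
    have e : ∫ y, k t x y * f y = (∫ y, k t x y * g y) +
        ∫ y in (Q.double.toSet)ᶜ, k t x y * f y := by
      rw [← integral_add_compl hD hkf, ← integral_indicator hD]
      congr 2
      funext y
      by_cases hy : y ∈ Q.double.toSet <;> simp [hg, hy]
    rw [e]
    refine (pow_le_pow_left' (enorm_add_le _ _) 2).trans ((add_sq_le_two_mul _ _).trans ?_)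
    refine mul_le_mul' le_rfl (add_le_add le_rfl (pow_le_pow_left' ?_ 2))
    calc _ ≤ ∫⁻ y in (Q.double.toSet)ᶜ, A * bump (M + δ) t (x - y) := by
          refine (enorm_integral_le_lintegral_enorm _).trans (lintegral_mono fun y => ?_)
          rw [enorm_mul]
          exact (mul_le_of_le_one_right zero_le (hf1e y)).trans (hK.size y)
      _ = A * ∫⁻ y in (Q.double.toSet)ᶜ, bump (M + δ) t (x - y) :=
          lintegral_const_mul' _ _ ENNReal.coe_ne_top
      _ ≤ A * (ENNReal.ofReal ((2 * t / Q.side) ^ δ) * bumpMass n M) := by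
          gcongr
          exact setLIntegral_compl_double_bump_le hδ.le ht.1 Q hx
      _ = _ := by ring
  calc _ ≤ ∫⁻ x in Q.toSet, ∫⁻ t in Ioc 0 Q.side, 2 * (‖∫ y, k t x y * g y‖ₑ ^ 2 + τ t) ∂dtOverT :=
        setLIntegral_mono' Q.measurableSet_toSet fun x hx =>
          setLIntegral_mono' measurableSet_Ioc (hpt x hx)
    _ = 2 * ∫⁻ x in Q.toSet, ((∫⁻ t in Ioc 0 Q.side, ‖∫ y, k t x y * g y‖ₑ ^ 2 ∂dtOverT) +
          ∫⁻ t in Ioc 0 Q.side, τ t ∂dtOverT) := by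
        simp_rw [lintegral_const_mul' _ _ (by norm_num : (2 : ℝ≥0∞) ≠ ∞)]
        simp_rw [fun x => lintegral_add_right (μ := dtOverT.restrict (Ioc 0 Q.side))
          (fun t => ‖∫ y, k t x y * g y‖ₑ ^ 2) hτm]
    _ = 2 * ((∫⁻ x in Q.toSet, ∫⁻ t in Ioc 0 Q.side, ‖∫ y, k t x y * g y‖ₑ ^ 2 ∂dtOverT) +
          ENNReal.ofReal (2 ^ (2 * δ) * (2 * δ)⁻¹) * (A * bumpMass n M) ^ 2 *
            volume Q.toSet) := by
        rw [lintegral_add_right _ measurable_const, setLIntegral_const,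
          setLIntegral_Ioc_tail_sq hδ hs]
    _ ≤ 2 * (B * (2 ^ n * volume Q.toSet) +
          ENNReal.ofReal (2 ^ (2 * δ) * (2 * δ)⁻¹) * (A * bumpMass n M) ^ 2 *
            volume Q.toSet) := by
        gcongr
        calc _ ≤ ∫⁻ x, ∫⁻ t, ‖∫ y, k t x y * g y‖ₑ ^ 2 ∂dtOverT :=
              (setLIntegral_le_lintegral _ _).trans
                (lintegral_mono fun x => setLIntegral_le_lintegral _ _)
          _ ≤ B * ∫⁻ x, ‖g x‖ₑ ^ 2 := hB g hgm hgi hgL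
          _ ≤ _ := by gcongr
    _ = _ := by
        rw [boundedCarlesonConst]
        ring

end

section

variable {n m : ℕ}

/-! ### Integrals over products -/

lemma lintegral_insertNth (j : Fin (m + 1)) (F : (Fin (m + 1) → E n) → ℝ≥0∞) :
    ∫⁻ y, F y = ∫⁻ p : E n × (Fin m → E n), F (j.insertNth p.1 p.2) := by
  have h := (volume_preserving_piFinSuccAbove (fun _ : Fin (m + 1) => E n) j).symm
  rw [← h.lintegral_comp_emb (MeasurableEquiv.measurableEmbedding _)]
  rfl

lemma integral_insertNth (j : Fin (m + 1)) (F : (Fin (m + 1) → E n) → ℂ) :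
    ∫ y, F y = ∫ p : E n × (Fin m → E n), F (j.insertNth p.1 p.2) := by
  have h := (volume_preserving_piFinSuccAbove (fun _ : Fin (m + 1) => E n) j).symm
  rw [← h.integral_comp']
  rfl

lemma enorm_finset_prod {ι : Type*} (s : Finset ι) (f : ι → ℂ) :
    ‖∏ i ∈ s, f i‖ₑ = ∏ i ∈ s, ‖f i‖ₑ := by
  classical
  induction s using Finset.induction_on with
  | empty => simp
  | insert i s hi ih => rw [Finset.prod_insert hi, Finset.prod_insert hi, enorm_mul, ih]

lemma lintegral_pi_prod {g : Fin m → E n → ℝ≥0∞} (hg : ∀ i, Measurable (g i)) :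
    ∫⁻ y : Fin m → E n, ∏ i, g i (y i) = ∏ i, ∫⁻ x, g i x := by
  induction m with
  | zero => simp [volume_pi, Measure.pi_empty_univ]
  | succ m ih =>
    have h1 : ∀ p : E n × (Fin m → E n), ∏ i, g i
        ((Fin.insertNth 0 p.1 p.2 : Fin (m + 1) → E n) i) =
        g 0 p.1 * ∏ i : Fin m, g i.succ (p.2 i) := fun p => by
      rw [Fin.prod_univ_succ]; simp
    rw [lintegral_insertNth 0, lintegral_congr h1, Measure.volume_eq_prod,
      lintegral_prod_mul (f := g 0) (g := fun y : Fin m → E n => ∏ i, g i.succ (y i)),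
      ih (fun i => hg i.succ), Fin.prod_univ_succ]
    · exact (hg 0).aemeasurable
    · exact (Finset.measurable_prod _ fun i _ =>
        (hg i.succ).comp (measurable_pi_apply i)).aemeasurable

/-! ### Multilinear kernels -/

/-- Size and regularity of a multilinear kernel function around `x` at scale `t`. -/
structure IsMultiKernel (κ : (Fin m → E n) → ℂ) (M δ t : ℝ) (A : ℝ≥0) (x : E n) : Prop where
  cont : Continuous κ
  size : ∀ y, ‖κ y‖ₑ ≤ A * ∏ i, bump (M + δ) t (x - y i)
  reg : ∀ y i z, ‖y i - z‖ ≤ n * t →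
    ‖κ y - κ (Function.update y i z)‖ₑ ≤
      A * ENNReal.ofReal ((‖y i - z‖ / t) ^ δ) * ∏ i, bump M t (x - y i)

namespace IsMultiKernel

variable {κ : (Fin m → E n) → ℂ} {M δ t : ℝ} {A : ℝ≥0} {x : E n}

lemma measurable_mul_prod (h : IsMultiKernel κ M δ t A x) {f : Fin m → E n → ℂ}
    (hf : ∀ i, Measurable (f i)) : Measurable fun y => κ y * ∏ i, f i (y i) :=
  h.cont.measurable.mul (Finset.measurable_prod _ fun i _ => (hf i).comp (measurable_pi_apply i))

lemma lintegral_enorm_mul_prod_le (h : IsMultiKernel κ M δ t A x) {f : Fin m → E n → ℂ}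
    (hf : ∀ i, Measurable (f i)) :
    ∫⁻ y, ‖κ y * ∏ i, f i (y i)‖ₑ ≤ A * ∏ i, ∫⁻ y, bump (M + δ) t (x - y) * ‖f i y‖ₑ := by
  have hb := measurable_bump (n := n) (M + δ) t
  rw [← lintegral_pi_prod (g := fun i y => bump (M + δ) t (x - y) * ‖f i y‖ₑ)
      (fun i => by have := hf i; fun_prop),
    ← lintegral_const_mul' _ _ ENNReal.coe_ne_top]
  refine lintegral_mono fun y => ?_
  rw [enorm_mul, enorm_finset_prod, Finset.prod_mul_distrib, ← mul_assoc]
  exact mul_le_mul' (h.size y) le_rfl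

lemma integrable_mul_prod (h : IsMultiKernel κ M δ t A x) {f : Fin m → E n → ℂ}
    (hf : ∀ i, Measurable (f i)) (hfin : ∀ i, ∫⁻ y, bump (M + δ) t (x - y) * ‖f i y‖ₑ < ∞) :
    Integrable fun y => κ y * ∏ i, f i (y i) := by
  refine ⟨(h.measurable_mul_prod hf).aestronglyMeasurable, ?_⟩
  refine (h.lintegral_enorm_mul_prod_le hf).trans_lt ?_
  exact ENNReal.mul_lt_top ENNReal.coe_lt_top (ENNReal.prod_lt_top fun i _ => hfin i)

end IsMultiKernel

lemma lintegral_bump_mul_lt_top_of_bounded {M t : ℝ} (hM : (n : ℝ) < M) (ht : 0 < t) (x : E n)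
    {f : E n → ℂ} (hf : ∀ y, ‖f y‖ₑ ≤ 1) : ∫⁻ y, bump M t (x - y) * ‖f y‖ₑ < ∞ := by
  refine lt_of_le_of_lt (lintegral_mono fun y => mul_le_of_le_one_right zero_le (hf y)) ?_
  rw [lintegral_bump_sub M ht]
  exact bumpMass_lt_top hM

lemma lintegral_bump_mul_lt_top_of_integrable {M t : ℝ} (hM : 0 ≤ M) (ht : 0 < t) (x : E n)
    {f : E n → ℂ} (hf : Integrable f) : ∫⁻ y, bump M t (x - y) * ‖f y‖ₑ < ∞ := by
  refine lt_of_le_of_lt (lintegral_mono fun y => mul_le_mul' (bump_le hM ht _) le_rfl) ?_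
  rw [lintegral_const_mul' _ _ ENNReal.ofReal_ne_top]
  exact ENNReal.mul_lt_top ENNReal.ofReal_lt_top hf.2

/-- Freezing all the functions but one in a multilinear operator gives a linear operator with this
kernel. -/
def slice (κ : (Fin (m + 1) → E n) → ℂ) (f : Fin (m + 1) → E n → ℂ) (j : Fin (m + 1))
    (a : E n) : ℂ :=
  ∫ y : Fin m → E n, κ (j.insertNth a y) * ∏ i, f (j.succAbove i) (y i)

namespace IsMultiKernel

variable {κ : (Fin (m + 1) → E n) → ℂ} {M δ t : ℝ} {A : ℝ≥0} {x : E n}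

lemma continuous_insertNth_left (j : Fin (m + 1)) (a : E n) :
    Continuous fun y : Fin m → E n => (j.insertNth a y : Fin (m + 1) → E n) :=
  continuous_const.finInsertNth j continuous_id

lemma integral_slice_mul (h : IsMultiKernel κ M δ t A x) {f : Fin (m + 1) → E n → ℂ}
    (hf : ∀ i, Measurable (f i)) {j : Fin (m + 1)}
    (hfin : ∀ i, ∫⁻ y, bump (M + δ) t (x - y) * ‖f i y‖ₑ < ∞) :
    ∫ a, slice κ f j a * f j a = ∫ y, κ y * ∏ i, f i (y i) := by
  have hi := h.integrable_mul_prod hf hfin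
  have hi' : Integrable (fun p : E n × (Fin m → E n) => κ (j.insertNth p.1 p.2) *
      ∏ i, f i ((j.insertNth p.1 p.2 : Fin (m + 1) → E n) i)) := by
    have hp := (volume_preserving_piFinSuccAbove (fun _ : Fin (m + 1) => E n) j).symm
    exact (hp.integrable_comp_emb (MeasurableEquiv.measurableEmbedding _)).2 hi
  rw [integral_insertNth j, Measure.volume_eq_prod, integral_prod _ hi']
  congr 1
  funext a
  rw [slice, ← integral_mul_const]
  congr 1
  funext y
  rw [Fin.prod_univ_succAbove _ j]
  simp only [Fin.insertNth_apply_same, Fin.insertNth_apply_succAbove]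
  ring

lemma isLocalKernel_slice (h : IsMultiKernel κ M δ t A x) (hM : (n : ℝ) < M) (hδ : 0 < δ)
    (ht : 0 < t) {f : Fin (m + 1) → E n → ℂ} (hf : ∀ i, Measurable (f i)) {j : Fin (m + 1)}
    (hf1 : ∀ i, i ≠ j → ∀ y, ‖f i y‖ₑ ≤ 1) :
    IsLocalKernel (slice κ f j) M δ t
      (A * ((bumpMass n M).toNNReal + (bumpMass n (M + δ)).toNNReal + 1) ^ m) x := by
  have hb := measurable_bump (n := n) (M + δ) t
  have hb' := measurable_bump (n := n) M t
  have hM' : (n : ℝ) < M + δ := by linarith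
  set c := (bumpMass n M).toNNReal + (bumpMass n (M + δ)).toNNReal + 1
  have hc1 : bumpMass n M ≤ c := by
    rw [← ENNReal.coe_toNNReal (bumpMass_lt_top hM).ne]
    exact ENNReal.coe_le_coe.2 (by simp only [c]; rw [add_assoc]; exact le_self_add)
  have hc2 : bumpMass n (M + δ) ≤ c := by
    rw [← ENNReal.coe_toNNReal (bumpMass_lt_top hM').ne]
    exact ENNReal.coe_le_coe.2 (by simp only [c]; rw [add_right_comm]; exact le_add_self)
  have hf1' : ∀ y : Fin m → E n, ‖∏ i, f (j.succAbove i) (y i)‖ₑ ≤ 1 := fun y => by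
    rw [enorm_finset_prod]
    exact Finset.prod_le_one' fun i _ => hf1 _ (Fin.succAbove_ne j i) _
  have hlin : ∀ N : ℝ, ∫⁻ y : Fin m → E n, ∏ i, bump N t (x - y i) = bumpMass n N ^ m := by
    intro N
    have hbN := measurable_bump (n := n) N t
    rw [lintegral_pi_prod (g := fun _ y => bump N t (x - y)) (fun i => by fun_prop)]
    simp [lintegral_bump_sub N ht]
  have hprod : ∀ (N : ℝ) (a : E n) (y : Fin m → E n),
      ∏ i, bump N t (x - (j.insertNth a y : Fin (m + 1) → E n) i) =
      bump N t (x - a) * ∏ i, bump N t (x - y i) := by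
    intro N a y
    rw [Fin.prod_univ_succAbove _ j]
    simp only [Fin.insertNth_apply_same, Fin.insertNth_apply_succAbove]
  have hmeas : ∀ a, Measurable fun y : Fin m → E n =>
      κ (j.insertNth a y) * ∏ i, f (j.succAbove i) (y i) := fun a =>
    (h.cont.comp (continuous_insertNth_left j a)).measurable.mul
      (Finset.measurable_prod _ fun i _ => (hf _).comp (measurable_pi_apply i))
  have hle : ∀ a, ∫⁻ y : Fin m → E n, ‖κ (j.insertNth a y) * ∏ i, f (j.succAbove i) (y i)‖ₑ ≤
      A * bump (M + δ) t (x - a) * bumpMass n (M + δ) ^ m := by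
    intro a
    rw [← hlin, ← lintegral_const_mul' _ _ (ENNReal.mul_ne_top ENNReal.coe_ne_top
      (by simp [bump]))]
    refine lintegral_mono fun y => ?_
    rw [enorm_mul]
    refine (mul_le_of_le_one_right zero_le (hf1' y)).trans ((h.size _).trans ?_)
    rw [hprod, mul_assoc]
  have hint : ∀ a, Integrable fun y : Fin m → E n =>
      κ (j.insertNth a y) * ∏ i, f (j.succAbove i) (y i) := fun a => by
    refine ⟨(hmeas a).aestronglyMeasurable, (hle a).trans_lt ?_⟩
    exact ENNReal.mul_lt_top (ENNReal.mul_lt_top ENNReal.coe_lt_top (by simp [bump]))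
      (ENNReal.pow_lt_top (bumpMass_lt_top hM'))
  refine ⟨fun a => ?_, fun a z haz => ?_⟩
  · refine (enorm_integral_le_lintegral_enorm _).trans ((hle a).trans ?_)
    push_cast
    rw [mul_right_comm]
    gcongr
  · rw [slice, slice, ← integral_sub (hint a) (hint z)]
    calc _ ≤ ∫⁻ y : Fin m → E n, A * ENNReal.ofReal ((‖a - z‖ / t) ^ δ) * bump M t (x - a) *
          ∏ i, bump M t (x - y i) := by
          refine (enorm_integral_le_lintegral_enorm _).trans (lintegral_mono fun y => ?_)
          rw [← sub_mul, enorm_mul]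
          refine (mul_le_of_le_one_right zero_le (hf1' y)).trans ?_
          have h1 := h.reg (j.insertNth a y) j z (by simpa using haz)
          rw [Fin.update_insertNth, Fin.insertNth_apply_same, hprod, ← mul_assoc] at h1
          exact h1
      _ = A * ENNReal.ofReal ((‖a - z‖ / t) ^ δ) * bump M t (x - a) * bumpMass n M ^ m := by
          rw [lintegral_const_mul' _ _ (ENNReal.mul_ne_top (by finiteness) (by simp [bump])), hlin]
      _ ≤ _ := by
          push_cast
          rw [mul_right_comm, mul_right_comm (A : ℝ≥0∞)]
          gcongr

end IsMultiKernel

/-! ### From the size and regularity conditions to multilinear kernels -/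

lemma SizeCondition.exists_enorm_le {θ : Kernels n m} {N : ℝ} (h : SizeCondition θ N) :
    ∃ A : ℝ≥0, ∀ t, 0 < t → ∀ (x : E n) (y : Fin m → E n),
      ‖θ t x y‖ₑ ≤ A * ∏ i, bump N t (x - y i) := by
  obtain ⟨C, hC⟩ := h
  refine ⟨C.toNNReal, fun t ht x y => ?_⟩
  rw [← ofReal_norm]
  simp only [bump]
  rw [← ENNReal.ofReal_prod_of_nonneg (fun i _ => by positivity)]
  refine (ENNReal.ofReal_le_ofReal (hC t ht x y)).trans ?_
  rw [ENNReal.ofReal_mul' (Finset.prod_nonneg fun i _ => by positivity)]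
  rfl

lemma continuous_of_regularity {κ : (Fin m → E n) → ℂ} {ω : ℝ → ℝ} (hω0 : ω 0 = 0)
    (hω : Continuous ω)
    (h : ∀ y i z, ‖κ y - κ (Function.update y i z)‖ ≤ ω ‖y i - z‖) : Continuous κ := by
  classical
  have key : ∀ (y z : Fin m → E n) (s : Finset (Fin m)),
      ‖κ y - κ (s.piecewise z y)‖ ≤ ∑ i ∈ s, ω ‖y i - z i‖ := by
    intro y z s
    induction s using Finset.induction_on with
    | empty => simp
    | insert j s hj ih =>
      rw [Finset.sum_insert hj, Finset.piecewise_insert, add_comm]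
      have h1 := h (s.piecewise z y) j (z j)
      rw [Finset.piecewise_eq_of_notMem _ _ _ hj] at h1
      calc _ ≤ ‖κ y - κ (s.piecewise z y)‖ +
            ‖κ (s.piecewise z y) - κ (Function.update (s.piecewise z y) j (z j))‖ :=
            norm_sub_le_norm_sub_add_norm_sub _ _ _
        _ ≤ _ := add_le_add ih h1
  rw [continuous_iff_continuousAt]
  intro y
  rw [ContinuousAt, tendsto_iff_norm_sub_tendsto_zero]
  have hlim : Tendsto (fun z : Fin m → E n => ∑ i, ω ‖y i - z i‖) (𝓝 y) (𝓝 0) := by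
    have hc : Continuous fun z : Fin m → E n => ∑ i, ω ‖y i - z i‖ := by fun_prop
    simpa [hω0] using hc.tendsto y
  refine squeeze_zero (fun _ => norm_nonneg _) (fun z => ?_) hlim
  rw [norm_sub_rev]
  simpa using key y z Finset.univ

lemma exists_isMultiKernel {θ : Kernels n m} {N γ : ℝ} (hn : 1 ≤ n) (hN : (n : ℝ) < N)
    (hγ₀ : 0 < γ) (hγ₁ : γ ≤ 1) (hsize : SizeCondition θ N) (hreg : RegularityCondition θ γ) :
    ∃ (M δ : ℝ) (A : ℝ≥0), (n : ℝ) < M ∧ 0 < δ ∧ δ ≤ 1 ∧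
      ∀ t, 0 < t → ∀ x, IsMultiKernel (θ t x) M δ t A x := by
  have hn' : (1 : ℝ) ≤ n := by exact_mod_cast hn
  have hN0 : 0 < N := by linarith
  obtain ⟨A₀, hA₀⟩ := hsize.exists_enorm_le
  obtain ⟨C, hC⟩ := hreg
  set ε := (N - n) / (2 * N) with hε
  have hε0 : 0 < ε := div_pos (by linarith) (by linarith)
  have hε1 : ε < 1 := by rw [hε, div_lt_one (by linarith)]; linarith
  have hεN : N * ε = (N - n) / 2 := by rw [hε]; field_simp
  have hδε : ε * γ ≤ ε := mul_le_of_le_one_right hε0.le hγ₁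
  have hεNε : ε ≤ N * ε := by nlinarith
  set b₀ : ℝ≥0 := A₀ * (1 + ((1 + n : ℝ) ^ N).toNNReal) with hb₀
  set B : ℝ≥0 := C.toNNReal ^ ε * b₀ ^ (1 - ε) with hB
  refine ⟨N * (1 - ε), ε * γ, A₀ + B, by rw [mul_one_sub]; linarith, by positivity, by linarith,
    fun t ht x => ⟨?_, fun y => ?_, fun y i z hyz => ?_⟩⟩
  · refine continuous_of_regularity (ω := fun s => C * ((t ^ (m * n))⁻¹ * (t⁻¹ * s) ^ γ)) ?_ ?_
      (hC t ht x)
    · simp [Real.zero_rpow hγ₀.ne']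
    · exact continuous_const.mul (continuous_const.mul
        ((continuous_const.mul continuous_id).rpow_const fun _ => Or.inr hγ₀.le))
  · refine (hA₀ t ht x y).trans ?_
    gcongr with i
    · exact le_self_add
    · exact bump_anti (by rw [mul_one_sub]; linarith) ht _
  · have h1 : ‖θ t x y - θ t x (Function.update y i z)‖ₑ ≤
        C.toNNReal * (ENNReal.ofReal ((t ^ n)⁻¹) ^ m * ENNReal.ofReal ((‖y i - z‖ / t) ^ γ)) := by
      rw [← ofReal_norm]
      refine (ENNReal.ofReal_le_ofReal (hC t ht x y i z)).trans ?_
      rw [ENNReal.ofReal_mul' (by positivity), ENNReal.ofReal_mul (by positivity),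
        ← ENNReal.ofReal_pow (by positivity), inv_pow, ← pow_mul, mul_comm n m, div_eq_inv_mul]
      rfl
    have h2 : ‖θ t x y - θ t x (Function.update y i z)‖ₑ ≤ b₀ * ∏ i, bump N t (x - y i) := by
      have h3 : ∏ l, bump N t (x - Function.update y i z l) ≤
          ENNReal.ofReal ((1 + n) ^ N) * ∏ l, bump N t (x - y l) := by
        rw [← Finset.mul_prod_erase _ _ (Finset.mem_univ i),
          ← Finset.mul_prod_erase _ (fun l => bump N t (x - y l)) (Finset.mem_univ i),
          Function.update_self, ← mul_assoc,
          Finset.prod_congr rfl (g := fun l => bump N t (x - y l))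
            (fun l hl => by rw [Function.update_of_ne (Finset.ne_of_mem_erase hl)])]
        gcongr
        exact bump_sub_le hN0.le (by positivity) ht x hyz
      calc _ ≤ A₀ * (∏ l, bump N t (x - y l)) +
            A₀ * (ENNReal.ofReal ((1 + n) ^ N) * ∏ l, bump N t (x - y l)) :=
            enorm_sub_le.trans (add_le_add (hA₀ t ht x y)
              ((hA₀ t ht x _).trans (mul_le_mul' le_rfl h3)))
        _ = _ := by
            rw [hb₀]
            push_cast
            rw [ENNReal.ofReal]
            ring
    clear_value b₀
    set X := ‖θ t x y - θ t x (Function.update y i z)‖ₑ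
    have h3 : ∀ l, ENNReal.ofReal ((t ^ n)⁻¹) ^ ε * bump N t (x - y l) ^ (1 - ε) =
        bump (N * (1 - ε)) t (x - y l) := by
      intro l
      have hp : 0 < 1 + t⁻¹ * ‖x - y l‖ := by positivity
      rw [bump, bump, ENNReal.ofReal_rpow_of_pos (by positivity),
        ENNReal.ofReal_rpow_of_pos (by positivity), ← ENNReal.ofReal_mul (by positivity),
        Real.div_rpow (by positivity) (by positivity), ← mul_div_assoc,
        ← Real.rpow_add (by positivity), ← Real.rpow_mul hp.le, add_sub_cancel, Real.rpow_one]
    calc X = X ^ ε * X ^ (1 - ε) := by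
          rw [← ENNReal.rpow_add_of_nonneg _ _ hε0.le (by linarith), add_sub_cancel,
            ENNReal.rpow_one]
      _ ≤ (C.toNNReal * (ENNReal.ofReal ((t ^ n)⁻¹) ^ m *
            ENNReal.ofReal ((‖y i - z‖ / t) ^ γ))) ^ ε *
            (b₀ * ∏ i, bump N t (x - y i)) ^ (1 - ε) := by
          gcongr
      _ = B * ENNReal.ofReal ((‖y i - z‖ / t) ^ (ε * γ)) *
            ∏ i, (ENNReal.ofReal ((t ^ n)⁻¹) ^ ε * bump N t (x - y i) ^ (1 - ε)) := by
          have hε1' : 0 ≤ 1 - ε := by linarith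
          rw [ENNReal.mul_rpow_of_nonneg _ _ hε0.le, ENNReal.mul_rpow_of_nonneg _ _ hε0.le,
            ENNReal.mul_rpow_of_nonneg _ _ hε1', Finset.prod_mul_distrib, Finset.prod_const,
            Finset.card_univ, Fintype.card_fin, ENNReal.prod_rpow_of_nonneg hε1', hB,
            ENNReal.coe_mul, ENNReal.coe_rpow_of_nonneg _ hε0.le,
            ENNReal.coe_rpow_of_nonneg _ hε1', ENNReal.ofReal_rpow_of_nonneg (by positivity) hε0.le,
            ← Real.rpow_mul (by positivity), mul_comm γ ε, ← ENNReal.rpow_natCast,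
            ← ENNReal.rpow_natCast, ← ENNReal.rpow_mul, ← ENNReal.rpow_mul, mul_comm (m : ℝ) ε]
          ring
      _ ≤ _ := by
          simp_rw [h3]
          gcongr
          exact le_add_self

end

section

variable {n m : ℕ}

/-! ### Measurability -/

lemma ae_prod_dtOverT_pos : ∀ᵐ q ∂((volume : Measure (E n)).prod dtOverT), 0 < q.2 :=
  Measure.quasiMeasurePreserving_snd.ae ae_dtOverT_pos

lemma KernelMeasurable.aestronglyMeasurable {θ : Kernels n m} (h : KernelMeasurable θ) :
    AEStronglyMeasurable (fun p : (E n × ℝ) × (Fin m → E n) => θ p.1.2 p.1.1 p.2)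
      ((volume.prod dtOverT).prod volume) := by
  have h1 : MeasurePreserving (fun p : (E n × ℝ) × (Fin m → E n) => ((p.1.2, p.1.1), p.2))
      (((volume : Measure (E n)).prod dtOverT).prod (volume : Measure (Fin m → E n)))
      ((dtOverT.prod (volume : Measure (E n))).prod (volume : Measure (Fin m → E n))) :=
    (Measure.measurePreserving_swap (μ := (volume : Measure (E n))) (ν := dtOverT)).prod
      (MeasurePreserving.id _)
  have h2 := (measurePreserving_prodAssoc dtOverT (volume : Measure (E n))
    (volume : Measure (Fin m → E n))).comp h1
  have h3 : AEStronglyMeasurable (fun q : ℝ × E n × (Fin m → E n) => θ q.1 q.2.1 q.2.2)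
      (dtOverT.prod ((volume : Measure (E n)).prod (volume : Measure (Fin m → E n)))) :=
    AEStronglyMeasurable.mono_ac
      (dtOverT_absolutelyContinuous.prod (Measure.AbsolutelyContinuous.refl _)) h
  exact h3.comp_quasiMeasurePreserving h2.quasiMeasurePreserving

lemma measurable_prod_apply {f : Fin m → E n → ℂ} (hf : ∀ i, Measurable (f i)) :
    Measurable fun y : Fin m → E n => ∏ i, f i (y i) :=
  Finset.measurable_prod _ fun i _ => (hf i).comp (measurable_pi_apply i)

lemma KernelMeasurable.aestronglyMeasurable_Theta {θ : Kernels n m} (h : KernelMeasurable θ)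
    {f : Fin m → E n → ℂ} (hf : ∀ i, Measurable (f i)) :
    AEStronglyMeasurable (fun q : E n × ℝ => Theta θ q.2 f q.1) (volume.prod dtOverT) := by
  have h1 : Measurable fun p : (E n × ℝ) × (Fin m → E n) => ∏ i, f i (p.2 i) :=
    (measurable_prod_apply hf).comp measurable_snd
  exact (h.aestronglyMeasurable.mul h1.aestronglyMeasurable).integral_prod_right'

lemma KernelMeasurable.aemeasurable_enorm_Theta_sq {θ : Kernels n m} (h : KernelMeasurable θ)
    {f : Fin m → E n → ℂ} (hf : ∀ i, Measurable (f i)) :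
    AEMeasurable (fun q : E n × ℝ => ‖Theta θ q.2 f q.1‖ₑ ^ 2) (volume.prod dtOverT) :=
  (h.aestronglyMeasurable_Theta hf).enorm.pow_const 2

/-! ### Freezing slots -/

lemma slice_update (κ : (Fin (m + 1) → E n) → ℂ) (f : Fin (m + 1) → E n → ℂ) (j : Fin (m + 1))
    (g : E n → ℂ) : slice κ (Function.update f j g) j = slice κ f j := by
  funext a
  simp only [slice, Function.update_of_ne (Fin.succAbove_ne j _)]

/-- Families of multilinear kernels with uniform size and regularity. -/
structure IsKernelFamily (θ : Kernels n m) (M δ : ℝ) (A : ℝ≥0) : Prop where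
  one_le : 1 ≤ n
  lt : (n : ℝ) < M
  pos : 0 < δ
  le_one : δ ≤ 1
  meas : KernelMeasurable θ
  kernel : ∀ t, 0 < t → ∀ x, IsMultiKernel (θ t x) M δ t A x

/-- The size constant of the kernels obtained by freezing slots. -/
def sliceConst (n m : ℕ) (M δ : ℝ) (A : ℝ≥0) : ℝ≥0 :=
  A * ((bumpMass n M).toNNReal + (bumpMass n (M + δ)).toNNReal + 1) ^ m

namespace IsKernelFamily

variable {θ : Kernels n (m + 1)} {M δ : ℝ} {A : ℝ≥0}

lemma integral_slice_mul (h : IsKernelFamily θ M δ A) {f : Fin (m + 1) → E n → ℂ}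
    (hf : ∀ i, Measurable (f i)) {j : Fin (m + 1)} (hf1 : ∀ i, i ≠ j → ∀ y, ‖f i y‖ₑ ≤ 1)
    {g : E n → ℂ} (hg : Measurable g) (hg' : Integrable g ∨ ∀ y, ‖g y‖ₑ ≤ 1) {t : ℝ} (ht : 0 < t)
    (x : E n) :
    ∫ a, slice (θ t x) f j a * g a = Theta θ t (Function.update f j g) x := by
  have hM' : (n : ℝ) < M + δ := by linarith [h.lt, h.pos]
  have hfm : ∀ i, Measurable (Function.update f j g i) := by
    intro i
    rcases eq_or_ne i j with rfl | hij
    · simpa using hg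
    · simpa [hij] using hf i
  have := (h.kernel t ht x).integral_slice_mul hfm (j := j) (fun i => by
    rcases eq_or_ne i j with rfl | hij
    · simp only [Function.update_self]
      rcases hg' with hg' | hg'
      · exact lintegral_bump_mul_lt_top_of_integrable ((Nat.cast_nonneg n).trans hM'.le) ht x hg'
      · exact lintegral_bump_mul_lt_top_of_bounded hM' ht x hg'
    · simp only [Function.update_of_ne hij]
      exact lintegral_bump_mul_lt_top_of_bounded hM' ht x (hf1 i hij))
  rw [slice_update, Function.update_self] at this
  exact this

/-- The `T(1)` theorem in one slot. -/
lemma lintegral_Theta_sq_le (h : IsKernelFamily θ M δ A) {f : Fin (m + 1) → E n → ℂ}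
    (hf : ∀ i, Measurable (f i)) {j : Fin (m + 1)} (hf1 : ∀ i, i ≠ j → ∀ y, ‖f i y‖ₑ ≤ 1)
    {C : ℝ≥0}
    (hC : CarlesonBound (fun q => ‖Theta θ q.2 (Function.update f j fun _ => 1) q.1‖ₑ ^ 2) C)
    {g : E n → ℂ} (hgm : Measurable g) (hg : Integrable g) (hg2 : MemLp g 2) :
    ∫⁻ x, ∫⁻ t, ‖∫ a, slice (θ t x) f j a * g a‖ₑ ^ 2 ∂dtOverT ≤
      squareConst n M δ (sliceConst n m M δ A) C * ∫⁻ x, ‖g x‖ₑ ^ 2 := by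
  have hupd : ∀ g' : E n → ℂ, Measurable g' → ∀ i, Measurable (Function.update f j g' i) := by
    intro g' hg' i
    rcases eq_or_ne i j with rfl | hij
    · simpa using hg'
    · simpa [hij] using hf i
  have e1 : (fun q : E n × ℝ => ‖Theta θ q.2 (Function.update f j fun _ => 1) q.1‖ₑ ^ 2)
      =ᵐ[volume.prod dtOverT] fun q => ‖∫ y, slice (θ q.2 q.1) f j y‖ₑ ^ 2 := by
    filter_upwards [ae_prod_dtOverT_pos] with q hq
    rw [← h.integral_slice_mul hf hf1 measurable_const (Or.inr fun _ => by simp) hq]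
    simp
  have e2 : (fun q : E n × ℝ => ‖Theta θ q.2 (Function.update f j g) q.1‖ₑ ^ 2)
      =ᵐ[volume.prod dtOverT] fun q => ‖∫ y, slice (θ q.2 q.1) f j y * g y‖ₑ ^ 2 := by
    filter_upwards [ae_prod_dtOverT_pos] with q hq
    rw [← h.integral_slice_mul hf hf1 hgm (Or.inl hg) hq]
  exact lintegral_square_le (k := fun t x => slice (θ t x) f j) h.one_le h.lt h.pos h.le_one
    (fun t ht x => (h.kernel t ht x).isLocalKernel_slice h.lt h.pos ht hf hf1) (hC.congr e1)
    ((h.meas.aemeasurable_enorm_Theta_sq (hupd _ measurable_const)).congr e1) hgm hg hg2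
    ((h.meas.aemeasurable_enorm_Theta_sq (hupd _ hgm)).congr e2)

lemma carlesonBound_Theta (h : IsKernelFamily θ M δ A) {f : Fin (m + 1) → E n → ℂ}
    (hf : ∀ i, Measurable (f i)) (hf1 : ∀ i y, ‖f i y‖ ≤ 1) (j : Fin (m + 1)) {C : ℝ≥0}
    (hC : CarlesonBound (fun q => ‖Theta θ q.2 (Function.update f j fun _ => 1) q.1‖ₑ ^ 2) C) :
    CarlesonBound (fun q => ‖Theta θ q.2 f q.1‖ₑ ^ 2) (boundedCarlesonConst n M δ
      (sliceConst n m M δ A) (squareConst n M δ (sliceConst n m M δ A) C)).toNNReal := by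
  have hf1' : ∀ i y, ‖f i y‖ₑ ≤ 1 := fun i y => by
    rw [← ofReal_norm]
    exact ENNReal.ofReal_le_one.2 (hf1 i y)
  intro Q
  rw [ENNReal.coe_toNNReal (boundedCarlesonConst_ne_top h.lt _
    (squareConst_ne_top h.lt h.pos _ _))]
  refine le_of_eq_of_le ?_ (lintegral_cube_le_of_bounded (k := fun t x => slice (θ t x) f j)
    (f := f j) h.one_le h.lt h.pos
    (fun t ht x => (h.kernel t ht x).isLocalKernel_slice h.lt h.pos ht hf fun i _ => hf1' i)
    (fun g hgm hg hg2 => h.lintegral_Theta_sq_le hf (fun i _ => hf1' i) hC hgm hg hg2)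
    (hf j) (hf1 j) Q)
  refine lintegral_congr fun x => setLIntegral_congr_fun measurableSet_Ioc fun t ht => ?_
  have := h.integral_slice_mul (j := j) hf (fun i _ => hf1' i) (hf j) (Or.inr (hf1' j)) ht.1 x
  rw [Function.update_eq_self] at this
  simp only [this]

lemma exists_carlesonBound (h : IsKernelFamily θ M δ A) {C : ℝ≥0}
    (hC : CarlesonBound (fun q => ‖Theta θ q.2 (fun _ _ => 1) q.1‖ₑ ^ 2) C)
    (s : Finset (Fin (m + 1))) :
    ∃ C' : ℝ≥0, ∀ f : Fin (m + 1) → E n → ℂ, (∀ i, Measurable (f i)) → (∀ i y, ‖f i y‖ ≤ 1) →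
      (∀ i ∉ s, f i = fun _ => 1) → CarlesonBound (fun q => ‖Theta θ q.2 f q.1‖ₑ ^ 2) C' := by
  induction s using Finset.induction_on with
  | empty =>
    refine ⟨C, fun f _ _ hf => ?_⟩
    rwa [show f = fun _ _ => 1 from funext fun i => hf i (Finset.notMem_empty i)]
  | insert j s hj ih =>
    obtain ⟨C', hC'⟩ := ih
    refine ⟨_, fun f hfm hf1 hfs => h.carlesonBound_Theta hfm hf1 j (hC' _ ?_ ?_ ?_)⟩
    · intro i
      rcases eq_or_ne i j with rfl | hij
      · simp
      · simpa [hij] using hfm i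
    · intro i y
      rcases eq_or_ne i j with rfl | hij
      · simp
      · simpa [hij] using hf1 i y
    · intro i hi
      rcases eq_or_ne i j with rfl | hij
      · simp
      · simpa [hij] using hfs i (by simp [hij, hi])

/-- The `L² × L^∞ × ⋯ × L^∞ → L²` estimates, with the `L²` function in an arbitrary slot. -/
theorem exists_lintegral_Theta_sq_le (h : IsKernelFamily θ M δ A) {C : ℝ≥0}
    (hC : CarlesonBound (fun q => ‖Theta θ q.2 (fun _ _ => 1) q.1‖ₑ ^ 2) C) :
    ∃ B : ℝ≥0, ∀ (j : Fin (m + 1)) (f : Fin (m + 1) → E n → ℂ), (∀ i, Measurable (f i)) →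
      (∀ i, i ≠ j → ∀ y, ‖f i y‖ ≤ 1) → Integrable (f j) → MemLp (f j) 2 →
      ∫⁻ x, ∫⁻ t, ‖Theta θ t f x‖ₑ ^ 2 ∂dtOverT ≤ B * ∫⁻ x, ‖f j x‖ₑ ^ 2 := by
  obtain ⟨C', hC'⟩ := h.exists_carlesonBound hC Finset.univ
  refine ⟨(squareConst n M δ (sliceConst n m M δ A) C').toNNReal, fun j f hfm hf1 hfi hf2 => ?_⟩
  have hf1' : ∀ i, i ≠ j → ∀ y, ‖f i y‖ₑ ≤ 1 := fun i hi y => by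
    rw [← ofReal_norm]
    exact ENNReal.ofReal_le_one.2 (hf1 i hi y)
  rw [ENNReal.coe_toNNReal (squareConst_ne_top h.lt h.pos _ _)]
  have hCf : CarlesonBound
      (fun q => ‖Theta θ q.2 (Function.update f j fun _ => 1) q.1‖ₑ ^ 2) C' := by
    refine hC' _ ?_ ?_ (fun i hi => absurd (Finset.mem_univ i) hi)
    · intro i
      rcases eq_or_ne i j with rfl | hij
      · simp
      · simpa [hij] using hfm i
    · intro i y
      rcases eq_or_ne i j with rfl | hij
      · simp
      · simpa [hij] using hf1 i hij y
  refine le_of_eq_of_le ?_ (h.lintegral_Theta_sq_le hfm hf1' hCf (hfm j) hfi hf2)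
  refine lintegral_congr fun x => lintegral_congr_ae ?_
  filter_upwards [ae_dtOverT_pos] with t ht
  have := h.integral_slice_mul hfm hf1' (hfm j) (Or.inl hfi) ht x
  rw [Function.update_eq_self] at this
  rw [this]

end IsKernelFamily

end

section

/-! ### Holomorphic families -/

lemma differentiable_integral_mul_cexp {α : Type*} [MeasurableSpace α] {μ : Measure α}
    {W : α → ℂ} (hW : Integrable W μ) {Λ : α → ℝ} (hΛ : Measurable Λ) {L : ℝ}
    (hL : ∀ a, |Λ a| ≤ L) :
    Differentiable ℂ fun z : ℂ => ∫ a, W a * Complex.exp (z * Λ a) ∂μ := by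
  intro z₀
  have hexp : ∀ z : ℂ, Measurable fun a => Complex.exp (z * Λ a) := fun z => by fun_prop
  have hbound : ∀ (z : ℂ) a, ‖Complex.exp (z * Λ a)‖ ≤ Real.exp (‖z‖ * L) := by
    intro z a
    refine (Complex.norm_exp_le_exp_norm _).trans (Real.exp_le_exp.2 ?_)
    rw [norm_mul, Complex.norm_real, Real.norm_eq_abs]
    gcongr
    exact hL a
  refine (hasDerivAt_integral_of_dominated_loc_of_deriv_le (𝕜 := ℂ) (μ := μ)
    (F := fun z a => W a * Complex.exp (z * Λ a))
    (F' := fun z a => W a * (Complex.exp (z * Λ a) * Λ a))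
    (bound := fun a => ‖W a‖ * (Real.exp ((‖z₀‖ + 1) * L) * L))
    (Metric.ball_mem_nhds z₀ one_pos) ?_ ?_ ?_ ?_ ?_ ?_).2.differentiableAt
  · exact Eventually.of_forall fun z => hW.1.mul (hexp z).aestronglyMeasurable
  · exact hW.mul_bdd (c := Real.exp (‖z₀‖ * L)) (hexp z₀).aestronglyMeasurable
      (ae_of_all _ (hbound z₀))
  · exact hW.1.mul ((hexp z₀).mul (Complex.measurable_ofReal.comp hΛ)).aestronglyMeasurable
  · refine ae_of_all _ fun a z hz => ?_
    have hL0 : 0 ≤ L := (abs_nonneg _).trans (hL a)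
    rw [norm_mul, norm_mul, Complex.norm_real, Real.norm_eq_abs]
    have hz' : ‖z‖ ≤ ‖z₀‖ + 1 := by
      have := Metric.mem_ball.1 hz
      rw [dist_eq_norm] at this
      have h2 := norm_add_le z₀ (z - z₀)
      rw [add_sub_cancel] at h2
      linarith
    gcongr
    · exact (hbound z a).trans (Real.exp_le_exp.2 (by gcongr))
    · exact hL a
  · exact hW.norm.mul_const _
  · refine ae_of_all _ fun a z _ => ?_
    have h1 : HasDerivAt (fun z : ℂ => z * Λ a) (Λ a : ℂ) z := by
      simpa using (hasDerivAt_id z).mul_const (Λ a : ℂ)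
    exact h1.cexp.const_mul _

lemma norm_integral_mul_cexp_le {α : Type*} [MeasurableSpace α] {μ : Measure α}
    {W : α → ℂ} (hW : Integrable W μ) {Λ : α → ℝ} {L : ℝ}
    (hL : ∀ a, |Λ a| ≤ L) {z : ℂ} (hz0 : 0 ≤ z.re) (hz1 : z.re ≤ 1) :
    ‖∫ a, W a * Complex.exp (z * Λ a) ∂μ‖ ≤ (∫ a, ‖W a‖ ∂μ) * Real.exp L := by
  rw [← integral_mul_const]
  refine norm_integral_le_of_norm_le (hW.norm.mul_const _) (ae_of_all _ fun a => ?_)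
  rw [norm_mul, Complex.norm_exp]
  gcongr
  have e : (z * Λ a).re = z.re * Λ a := by simp
  rw [e]
  calc z.re * Λ a ≤ z.re * |Λ a| := by gcongr; exact le_abs_self _
    _ ≤ 1 * |Λ a| := by gcongr
    _ ≤ L := by rw [one_mul]; exact hL a

/-- Cauchy–Schwarz against a function in `L²`. -/
lemma norm_integral_mul_le_sqrt {α : Type*} [MeasurableSpace α] {μ : Measure α} {F G : α → ℂ}
    (hF : AEStronglyMeasurable F μ) (hG : AEStronglyMeasurable G μ) {a b : ℝ} (ha : 0 ≤ a)
    (hb : 0 ≤ b) (hFa : ∫⁻ x, ‖F x‖ₑ ^ 2 ∂μ ≤ ENNReal.ofReal (a ^ 2))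
    (hGb : ∫⁻ x, ‖G x‖ₑ ^ 2 ∂μ ≤ ENNReal.ofReal (b ^ 2)) :
    ‖∫ x, F x * G x ∂μ‖ ≤ a * b := by
  have h1 : ‖∫ x, F x * G x ∂μ‖ₑ ^ 2 ≤ ENNReal.ofReal ((a * b) ^ 2) := by
    calc _ ≤ (∫⁻ x, ‖F x‖ₑ * ‖G x‖ₑ ∂μ) ^ 2 := by
          refine pow_le_pow_left' ((enorm_integral_le_lintegral_enorm _).trans ?_) 2
          exact lintegral_mono fun x => (enorm_mul _ _).le
      _ ≤ _ := sq_lintegral_mul_le μ hF.enorm hG.enorm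
      _ ≤ ENNReal.ofReal (a ^ 2) * ENNReal.ofReal (b ^ 2) := mul_le_mul' hFa hGb
      _ = _ := by rw [← ENNReal.ofReal_mul (by positivity), mul_pow]
  rw [← ofReal_norm, ← ENNReal.ofReal_pow (norm_nonneg _),
    ENNReal.ofReal_le_ofReal_iff (by positivity)] at h1
  exact le_of_sq_le_sq h1 (by positivity)

end

section

variable {n m : ℕ}

/-! ### Interpolation -/

lemma IsKernelFamily.lintegral_enorm_mul_prod_le {θ : Kernels n m} {M δ : ℝ} {A : ℝ≥0}
    (h : IsKernelFamily θ M δ A) {f : Fin m → E n → ℂ} (hf : ∀ i, Measurable (f i)) {T t : ℝ}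
    (hT : 0 < T) (ht : T⁻¹ ≤ t) (x : E n) :
    ∫⁻ y, ‖θ t x y * ∏ i, f i (y i)‖ₑ ≤ A * ∏ i, (ENNReal.ofReal (T ^ n) * ∫⁻ y, ‖f i y‖ₑ) := by
  have ht0 : 0 < t := (inv_pos.2 hT).trans_le ht
  have hM : 0 ≤ M + δ := by linarith [h.lt, h.pos, Nat.cast_nonneg (α := ℝ) n]
  refine ((h.kernel t ht0 x).lintegral_enorm_mul_prod_le hf).trans ?_
  refine mul_le_mul' le_rfl (Finset.prod_le_prod' fun i _ => ?_)
  rw [← lintegral_const_mul' _ _ ENNReal.ofReal_ne_top]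
  refine lintegral_mono fun y => mul_le_mul' ((bump_le hM ht0 _).trans ?_) le_rfl
  refine ENNReal.ofReal_le_ofReal ?_
  rw [← inv_pow]
  exact pow_le_pow_left₀ (by positivity) (inv_le_of_inv_le₀ hT ht) n

lemma dtOverT_Icc_lt_top {a : ℝ} (ha : 0 < a) (b : ℝ) : dtOverT (Icc a b) < ∞ := by
  have h := setLIntegral_dtOverT (s := Icc a b) measurableSet_Icc
    (fun t ht => ha.trans_le ht.1) (g := fun _ => 1) measurable_const
  rw [setLIntegral_one] at h
  rw [h]
  refine lt_of_le_of_lt (setLIntegral_mono' (g := fun _ => ENNReal.ofReal (1 / a))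
    measurableSet_Icc fun t ht => ?_) ?_
  · rw [mul_one]
    exact ENNReal.ofReal_le_ofReal (one_div_le_one_div_of_le ha ht.1)
  · rw [setLIntegral_const]
    exact ENNReal.mul_lt_top ENNReal.ofReal_lt_top (by simp)

/-- The square function estimate with constant `c`, uniformly over the functions that are
dominated by `exp (τ i * w i)` on `S i`. -/
def StripBound (θ : Kernels n m) (w : Fin m → E n → ℝ) (S : Fin m → Set (E n)) (τ : Fin m → ℝ)
    (c : ℝ) : Prop :=
  ∀ u : Fin m → E n → ℂ, (∀ i, Measurable (u i)) → (∀ i y, ‖u i y‖ ≤ 1) →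
    (∀ i y, y ∉ S i → u i y = 0) →
    ∫⁻ q, ‖Theta θ q.2 (fun i y => u i y * Complex.exp (τ i * w i y)) q.1‖ₑ ^ 2
      ∂((volume : Measure (E n)).prod dtOverT) ≤ ENNReal.ofReal (c ^ 2)

section Strip

variable {θ : Kernels n m} {M δ : ℝ} {A : ℝ≥0} {w : Fin m → E n → ℝ} {S : Fin m → Set (E n)}
  {L : ℝ}

lemma lintegral_enorm_mul_cexp_le {u : E n → ℂ} {v : E n → ℝ} {s : Set (E n)}
    (hs : MeasurableSet s) (hL : ∀ y, |v y| ≤ L)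
    (hu : ∀ y, ‖u y‖ ≤ 1) (hus : ∀ y, y ∉ s → u y = 0) (r : ℝ) :
    ∫⁻ y, ‖u y * Complex.exp (r * v y)‖ₑ ≤ ENNReal.ofReal (Real.exp (|r| * L)) * volume s := by
  rw [← lintegral_indicator_const hs]
  refine lintegral_mono fun y => ?_
  by_cases hy : y ∈ s
  · rw [indicator_of_mem hy, ← ofReal_norm]
    refine ENNReal.ofReal_le_ofReal ?_
    rw [norm_mul, ← Complex.ofReal_mul, Complex.norm_exp_ofReal]
    refine (mul_le_of_le_one_left (Real.exp_pos _).le (hu y)).trans (Real.exp_le_exp.2 ?_)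
    refine (le_abs_self _).trans ?_
    rw [abs_mul]
    gcongr
    exact hL y
  · simp [hus y hy]

lemma StripBound.setLIntegral_le (h : IsKernelFamily θ M δ A) (hw : ∀ i, Measurable (w i))
    (hL : ∀ i y, |w i y| ≤ L) (hS : ∀ i, MeasurableSet (S i)) (hSfin : ∀ i, volume (S i) ≠ ∞)
    {τ₀ τ₁ : Fin m → ℝ} {c₀ c₁ : ℝ} (hc₀ : 0 < c₀) (hc₁ : 0 < c₁) (h₀ : StripBound θ w S τ₀ c₀)
    (h₁ : StripBound θ w S τ₁ c₁) {s : ℝ} (hs0 : 0 ≤ s) (hs1 : s ≤ 1)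
    {u : Fin m → E n → ℂ} (hu : ∀ i, Measurable (u i)) (hu1 : ∀ i y, ‖u i y‖ ≤ 1)
    (huS : ∀ i y, y ∉ S i → u i y = 0) {Y : Set (E n × ℝ)} (hY : MeasurableSet Y)
    (hYfin : (volume : Measure (E n)).prod dtOverT Y ≠ ∞) {T : ℝ} (hT : 0 < T)
    (hYT : ∀ q ∈ Y, T⁻¹ ≤ q.2) :
    ∫⁻ q in Y, ‖Theta θ q.2 (fun i y => u i y * Complex.exp (((1 - s) * τ₀ i + s * τ₁ i : ℝ) *
      w i y)) q.1‖ₑ ^ 2 ∂((volume : Measure (E n)).prod dtOverT) ≤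
      ENNReal.ofReal ((c₀ ^ (1 - s) * c₁ ^ s) ^ 2) := by
  set ν := ((volume : Measure (E n)).prod dtOverT).restrict Y with hν
  have hνfin : ν univ ≠ ∞ := by rwa [hν, Measure.restrict_apply_univ]
  set f : ℂ → Fin m → E n → ℂ := fun z i y =>
    u i y * Complex.exp ((τ₀ i + z * (τ₁ i - τ₀ i)) * w i y) with hf
  have hfm : ∀ z i, Measurable (f z i) := fun z i => by
    have := hw i; have := hu i; simp only [hf]; fun_prop
  have hfr : ∀ r : ℝ, f r = fun i y =>
      u i y * Complex.exp ((τ₀ i + r * (τ₁ i - τ₀ i) : ℝ) * w i y) := by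
    intro r; funext i y; simp [hf]
  have hfs : (fun i y => u i y * Complex.exp (((1 - s) * τ₀ i + s * τ₁ i : ℝ) * w i y)) = f s := by
    rw [hfr]; funext i y; congr 4; ring
  rw [hfs]
  have hΘm : ∀ z, AEStronglyMeasurable (fun q : E n × ℝ => Theta θ q.2 (f z) q.1) ν := fun z =>
    (h.meas.aestronglyMeasurable_Theta (hfm z)).mono_measure Measure.restrict_le_self
  have hbd : ∀ r : ℝ, ∃ c : ℝ≥0, ∀ q ∈ Y, ∫⁻ y, ‖θ q.2 q.1 y * ∏ i, f r i (y i)‖ₑ ≤ c := by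
    intro r
    have hfin : (A : ℝ≥0∞) * ∏ i, (ENNReal.ofReal (T ^ n) * ∫⁻ y, ‖f r i y‖ₑ) ≠ ∞ := by
      refine ENNReal.mul_ne_top ENNReal.coe_ne_top (ENNReal.prod_ne_top fun i _ => ?_)
      rw [hfr]
      exact ENNReal.mul_ne_top ENNReal.ofReal_ne_top (ne_top_of_le_ne_top
        (ENNReal.mul_ne_top ENNReal.ofReal_ne_top (hSfin i))
        (lintegral_enorm_mul_cexp_le (hS i) (hL i) (hu1 i) (huS i) _))
    refine ⟨(A * ∏ i, (ENNReal.ofReal (T ^ n) * ∫⁻ y, ‖f r i y‖ₑ)).toNNReal, fun q hq => ?_⟩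
    rw [ENNReal.coe_toNNReal hfin]
    exact h.lintegral_enorm_mul_prod_le (hfm r) hT (hYT q hq) _
  obtain ⟨c, hc⟩ := hbd s
  obtain ⟨c', hc'⟩ := hbd 0
  set G : E n × ℝ → ℂ := fun q => Theta θ q.2 (f s) q.1 with hG
  have hGm : AEStronglyMeasurable G ν := hΘm s
  have hGc : ∀ q ∈ Y, ‖G q‖ₑ ≤ c := fun q hq =>
    (enorm_integral_le_lintegral_enorm _).trans (hc q hq)
  have hGconj : AEStronglyMeasurable (fun q => (starRingEnd ℂ) (G q)) ν :=
    Complex.continuous_conj.comp_aestronglyMeasurable hGm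
  set D := ∫⁻ q, ‖G q‖ₑ ^ 2 ∂ν with hD
  have hDfin : D ≠ ∞ := by
    refine ne_top_of_le_ne_top (b := (c : ℝ≥0∞) ^ 2 * ν univ)
      (ENNReal.mul_ne_top (by finiteness) hνfin) ?_
    rw [← lintegral_const]
    exact setLIntegral_mono' hY fun q hq => pow_le_pow_left' (hGc q hq) 2
  set d := √D.toReal with hd
  have hDd : D = ENNReal.ofReal (d ^ 2) := by
    rw [hd, Real.sq_sqrt ENNReal.toReal_nonneg, ENNReal.ofReal_toReal hDfin]
  set W : (E n × ℝ) × (Fin m → E n) → ℂ := fun p =>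
    (starRingEnd ℂ) (G p.1) * (θ p.1.2 p.1.1 p.2 * ∏ i, f (0 : ℝ) i (p.2 i)) with hW
  set Λ : (E n × ℝ) × (Fin m → E n) → ℝ := fun p => ∑ i, (τ₁ i - τ₀ i) * w i (p.2 i) with hΛ
  have hWm : AEStronglyMeasurable W (ν.prod volume) := by
    refine hGconj.comp_fst.mul (AEStronglyMeasurable.mul ?_ ?_)
    · refine h.meas.aestronglyMeasurable.mono_ac ?_
      exact Measure.AbsolutelyContinuous.prod Measure.restrict_le_self.absolutelyContinuous
        (Measure.AbsolutelyContinuous.refl _)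
    · exact ((measurable_prod_apply (hfm _)).comp measurable_snd).aestronglyMeasurable
  have hWi : Integrable W (ν.prod volume) := by
    refine ⟨hWm, ?_⟩
    rw [hasFiniteIntegral_iff_enorm, lintegral_prod _ hWm.enorm]
    refine lt_of_le_of_lt (b := ∫⁻ q, (c : ℝ≥0∞) * c' ∂ν)
      (setLIntegral_mono' hY fun q hq => ?_) ?_
    · simp only [hW, enorm_mul]
      rw [lintegral_const_mul' _ _ (by simp)]
      refine mul_le_mul' ?_ ?_
      · rw [RCLike.enorm_conj]; exact hGc q hq
      · simpa only [enorm_mul] using hc' q hq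
    · rw [lintegral_const]
      exact ENNReal.mul_lt_top (by finiteness) hνfin.lt_top
  have hΛm : Measurable Λ := by
    refine Finset.measurable_sum _ fun i _ => ?_
    have := hw i
    have h2 : Measurable fun p : (E n × ℝ) × (Fin m → E n) => w i (p.2 i) :=
      this.comp ((measurable_pi_apply i).comp measurable_snd)
    exact h2.const_mul _
  have hΛL : ∀ p, |Λ p| ≤ ∑ i, |τ₁ i - τ₀ i| * L := fun p =>
    (Finset.abs_sum_le_sum_abs _ _).trans (Finset.sum_le_sum fun i _ => by
      rw [abs_mul]; gcongr; exact hL i _)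
  set Φ : ℂ → ℂ := fun z => ∫ p, W p * Complex.exp (z * Λ p) ∂(ν.prod volume) with hΦ
  have hΦd : Differentiable ℂ Φ := differentiable_integral_mul_cexp hWi hΛm hΛL
  have hΦeq : ∀ z, Φ z = ∫ q, (starRingEnd ℂ) (G q) * Theta θ q.2 (f z) q.1 ∂ν := by
    intro z
    have hexp : Measurable fun p => Complex.exp (z * Λ p) := by fun_prop
    have hi : Integrable (fun p => W p * Complex.exp (z * Λ p)) (ν.prod volume) := by
      refine hWi.mul_bdd (c := Real.exp (‖z‖ * ∑ i, |τ₁ i - τ₀ i| * L))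
        hexp.aestronglyMeasurable (ae_of_all _ fun p => ?_)
      refine (Complex.norm_exp_le_exp_norm _).trans (Real.exp_le_exp.2 ?_)
      rw [norm_mul, Complex.norm_real, Real.norm_eq_abs]
      gcongr
      exact hΛL p
    simp only [hΦ]
    rw [integral_prod _ hi]
    refine integral_congr_ae (ae_of_all _ fun q => ?_)
    simp only [Theta]
    rw [← integral_const_mul]
    refine integral_congr_ae (ae_of_all _ fun y => ?_)
    simp only [hW, hΛ, hf]
    rw [mul_assoc, mul_assoc]
    congr 2
    push_cast
    rw [Finset.mul_sum, Complex.exp_sum, ← Finset.prod_mul_distrib]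
    refine Finset.prod_congr rfl fun i _ => ?_
    rw [mul_assoc, ← Complex.exp_add]
    congr 2
    ring
  have hconj2 : ∫⁻ q, ‖(starRingEnd ℂ) (G q)‖ₑ ^ 2 ∂ν ≤ ENNReal.ofReal (d ^ 2) := by
    simp only [RCLike.enorm_conj]
    exact hDd.le
  have hline : ∀ (r : ℝ) (c : ℝ), 0 < c → StripBound θ w S (fun i => τ₀ i + r * (τ₁ i - τ₀ i)) c →
      ∀ z : ℂ, z.re = r → ‖Φ z‖ ≤ d * c := by
    intro r c hc hb z hz
    rw [hΦeq]
    refine norm_integral_mul_le_sqrt hGconj (hΘm z) (Real.sqrt_nonneg _) hc.le hconj2 ?_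
    have := hb (fun i y => u i y * Complex.exp ((z.im * (τ₁ i - τ₀ i) * w i y : ℝ) * Complex.I))
      (fun i => by have := hw i; have := hu i; fun_prop)
      (fun i y => by rw [norm_mul, Complex.norm_exp_ofReal_mul_I, mul_one]; exact hu1 i y)
      (fun i y hy => by rw [huS i y hy, zero_mul])
    refine (lintegral_mono' Measure.restrict_le_self le_rfl).trans (le_of_eq_of_le ?_ this)
    congr 1
    funext q
    congr 3
    funext i y
    simp only [hf]
    rw [mul_assoc, ← Complex.exp_add]
    congr 2
    nth_rewrite 1 [← Complex.re_add_im z]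
    rw [hz]
    push_cast
    ring
  have h3 := Complex.HadamardThreeLines.norm_le_interp_of_mem_verticalClosedStrip' (f := Φ)
    (z := (s : ℂ)) (a := d * c₀) (b := d * c₁) (l := 0) (u := 1) zero_lt_one
    (by simp [Complex.HadamardThreeLines.verticalClosedStrip, hs0, hs1]) hΦd.diffContOnCl
    (by
      refine ⟨(∫ p, ‖W p‖ ∂(ν.prod volume)) * Real.exp (∑ i, |τ₁ i - τ₀ i| * L), ?_⟩
      rintro _ ⟨z, hz, rfl⟩
      exact norm_integral_mul_cexp_le hWi hΛL hz.1 hz.2)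
    (fun z hz => hline 0 c₀ hc₀ (by simpa using h₀) z hz)
    (fun z hz => hline 1 c₁ hc₁ (by simpa using h₁) z hz)
  have hΦs : Φ s = (d ^ 2 : ℝ) := by
    have e1 : ∀ q, (starRingEnd ℂ) (G q) * Theta θ q.2 (f s) q.1 = ((‖G q‖ ^ 2 : ℝ) : ℂ) :=
      fun q => by rw [Complex.conj_mul' (G q)]; push_cast; rfl
    rw [hΦeq, hd, Real.sq_sqrt ENNReal.toReal_nonneg, hD, integral_congr_ae (ae_of_all _ e1),
      integral_complex_ofReal, integral_eq_lintegral_of_nonneg_ae (ae_of_all _ fun _ => sq_nonneg _)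
      (hGm.norm.pow 2)]
    congr 3
    funext q
    rw [ENNReal.ofReal_pow (norm_nonneg _), ofReal_norm]
  rw [hΦs, Complex.norm_real, Real.norm_of_nonneg (sq_nonneg d), Complex.ofReal_re, sub_zero,
    sub_zero, div_one, Real.mul_rpow (Real.sqrt_nonneg _) hc₀.le,
    Real.mul_rpow (Real.sqrt_nonneg _) hc₁.le] at h3
  rw [hDd]
  refine ENNReal.ofReal_le_ofReal ?_
  rcases (Real.sqrt_nonneg D.toReal).eq_or_lt with hd0 | hd0
  · rw [hd, ← hd0, zero_pow two_ne_zero]; exact sq_nonneg _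
  · have h4 : d ^ 2 ≤ d * (c₀ ^ (1 - s) * c₁ ^ s) := by
      refine h3.trans_eq ?_
      have : d ^ (1 - s) * d ^ s = d := by
        rw [← Real.rpow_add hd0, sub_add_cancel, Real.rpow_one]
      rw [← hd, mul_mul_mul_comm, this]
    have h5 : d ≤ c₀ ^ (1 - s) * c₁ ^ s := by
      rw [sq] at h4
      exact le_of_mul_le_mul_left h4 hd0
    gcongr

lemma StripBound.interp (h : IsKernelFamily θ M δ A) (hw : ∀ i, Measurable (w i))
    (hL : ∀ i y, |w i y| ≤ L) (hS : ∀ i, MeasurableSet (S i)) (hSfin : ∀ i, volume (S i) ≠ ∞)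
    {τ₀ τ₁ : Fin m → ℝ} {c₀ c₁ : ℝ} (hc₀ : 0 < c₀) (hc₁ : 0 < c₁) (h₀ : StripBound θ w S τ₀ c₀)
    (h₁ : StripBound θ w S τ₁ c₁) {s : ℝ} (hs0 : 0 ≤ s) (hs1 : s ≤ 1) :
    StripBound θ w S (fun i => (1 - s) * τ₀ i + s * τ₁ i) (c₀ ^ (1 - s) * c₁ ^ s) := by
  intro u hu hu1 huS
  set Y : ℕ → Set (E n × ℝ) := fun k =>
    Metric.closedBall 0 k ×ˢ Icc ((k + 1 : ℝ)⁻¹) (k + 1) with hYdef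
  have hYm : ∀ k, MeasurableSet (Y k) := fun k =>
    Metric.isClosed_closedBall.measurableSet.prod measurableSet_Icc
  have hmono : Monotone Y := by
    intro k l hkl
    have : (k : ℝ) ≤ l := by exact_mod_cast hkl
    exact Set.prod_mono (Metric.closedBall_subset_closedBall this)
      (Icc_subset_Icc (by gcongr) (by gcongr))
  have hYfin : ∀ k, (volume : Measure (E n)).prod dtOverT (Y k) ≠ ∞ := by
    intro k
    rw [Measure.prod_prod]
    refine ENNReal.mul_ne_top (Metric.isBounded_closedBall.measure_lt_top).ne ?_
    exact (dtOverT_Icc_lt_top (by positivity) _).ne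
  have hU : ∀ᵐ q ∂((volume : Measure (E n)).prod dtOverT), q ∈ ⋃ k, Y k := by
    filter_upwards [ae_prod_dtOverT_pos] with q hq
    obtain ⟨a, ha⟩ := exists_nat_ge ‖q.1‖
    obtain ⟨b, hb⟩ := exists_nat_ge q.2
    obtain ⟨c, hc⟩ := exists_nat_ge q.2⁻¹
    refine mem_iUnion.2 ⟨a + b + c, ⟨?_, ?_, ?_⟩⟩
    · rw [mem_closedBall_zero_iff]
      push_cast
      linarith [Nat.cast_nonneg (α := ℝ) b, Nat.cast_nonneg (α := ℝ) c]
    · refine inv_le_of_inv_le₀ hq (hc.trans ?_)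
      push_cast
      linarith [Nat.cast_nonneg (α := ℝ) b, Nat.cast_nonneg (α := ℝ) a]
    · push_cast
      linarith [Nat.cast_nonneg (α := ℝ) a, Nat.cast_nonneg (α := ℝ) c]
  rw [← Measure.restrict_eq_self_of_ae_mem hU,
    setLIntegral_iUnion_of_directed _ hmono.directed_le]
  exact iSup_le fun k => StripBound.setLIntegral_le h hw hL hS hSfin hc₀ hc₁ h₀ h₁ hs0 hs1 hu hu1
    huS (hYm k) (hYfin k) (T := k + 1) (by positivity) fun q hq => hq.2.1

/-- Interpolation between the vertices of the simplex. -/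
lemma StripBound.of_mem_stdSimplex (h : IsKernelFamily θ M δ A) (hw : ∀ i, Measurable (w i))
    (hL : ∀ i y, |w i y| ≤ L) (hS : ∀ i, MeasurableSet (S i)) (hSfin : ∀ i, volume (S i) ≠ ∞)
    {b : ℝ} (hb : 0 < b) {α : Fin m → ℝ} (hα : ∀ i, 0 < α i)
    (hv : ∀ j, StripBound θ w S (Pi.single j 1) (b * α j)) {τ : Fin m → ℝ}
    (hτ : τ ∈ stdSimplex ℝ (Fin m)) : StripBound θ w S τ (b * ∏ i, α i ^ τ i) := by
  have hpos : ∀ τ : Fin m → ℝ, 0 < b * ∏ i, α i ^ τ i := fun τ =>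
    mul_pos hb (Finset.prod_pos fun i _ => Real.rpow_pos_of_pos (hα i) _)
  have hconv : Convex ℝ {τ : Fin m → ℝ | StripBound θ w S τ (b * ∏ i, α i ^ τ i)} := by
    intro τ₀ h₀ τ₁ h₁ r s hr hs hrs
    obtain rfl : r = 1 - s := by linarith
    have := StripBound.interp h hw hL hS hSfin (hpos _) (hpos _) h₀ h₁ hs (by linarith)
    rw [mem_ofPred_eq]
    change StripBound θ w S (fun i => (1 - s) * τ₀ i + s * τ₁ i) _
    convert this using 1
    rw [Real.mul_rpow hb.le (Finset.prod_nonneg fun i _ => (Real.rpow_pos_of_pos (hα i) _).le),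
      Real.mul_rpow hb.le (Finset.prod_nonneg fun i _ => (Real.rpow_pos_of_pos (hα i) _).le),
      mul_mul_mul_comm, ← Real.rpow_add hb, sub_add_cancel, Real.rpow_one,
      ← Real.finsetProd_rpow _ _ (fun i _ => (Real.rpow_pos_of_pos (hα i) _).le),
      ← Real.finsetProd_rpow _ _ (fun i _ => (Real.rpow_pos_of_pos (hα i) _).le),
      ← Finset.prod_mul_distrib]
    congr 1
    refine Finset.prod_congr rfl fun i _ => ?_
    rw [← Real.rpow_mul (hα i).le, ← Real.rpow_mul (hα i).le, ← Real.rpow_add (hα i)]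
    simp only [Pi.add_apply, Pi.smul_apply, smul_eq_mul]
    ring_nf
  rw [← convexHull_rangle_single_eq_stdSimplex] at hτ
  refine convexHull_min ?_ hconv hτ
  rintro _ ⟨j, rfl⟩
  rw [mem_ofPred_eq]
  convert hv j using 2
  rw [Finset.prod_eq_single j (fun i _ hij => by simp [hij]) (by simp)]
  simp

end Strip

end

section

variable {n m : ℕ}

/-! ### Estimates in `L^p` -/

/-- The `L² × L^∞ × ⋯ × L^∞ → L²` estimates, with the `L²` function in an arbitrary slot. -/
def VertexBound (θ : Kernels n m) (B : ℝ≥0) : Prop :=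
  ∀ (j : Fin m) (f : Fin m → E n → ℂ), (∀ i, Measurable (f i)) →
    (∀ i, i ≠ j → ∀ y, ‖f i y‖ ≤ 1) → Integrable (f j) → MemLp (f j) 2 →
    ∫⁻ x, ∫⁻ t, ‖Theta θ t f x‖ₑ ^ 2 ∂dtOverT ≤ B * ∫⁻ x, ‖f j x‖ₑ ^ 2

lemma lintegral_Theta_prod {θ : Kernels n m} (hθ : KernelMeasurable θ) {f : Fin m → E n → ℂ}
    (hf : ∀ i, Measurable (f i)) :
    ∫⁻ q, ‖Theta θ q.2 f q.1‖ₑ ^ 2 ∂((volume : Measure (E n)).prod dtOverT) =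
      ∫⁻ x, ∫⁻ t, ‖Theta θ t f x‖ₑ ^ 2 ∂dtOverT :=
  lintegral_prod _ (hθ.aemeasurable_enorm_Theta_sq hf)

lemma VertexBound.stripBound {θ : Kernels n m} (hθ : KernelMeasurable θ) {B : ℝ≥0}
    (hB : VertexBound θ B) {w : Fin m → E n → ℝ} {S : Fin m → Set (E n)} {L : ℝ}
    (hw : ∀ i, Measurable (w i)) (hL : ∀ i y, |w i y| ≤ L) (hS : ∀ i, MeasurableSet (S i))
    (hSfin : ∀ i, volume (S i) ≠ ∞) {α : Fin m → ℝ}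
    (hα : ∀ i, ∫⁻ y in S i, ENNReal.ofReal (Real.exp (2 * w i y)) ≤ ENNReal.ofReal (α i ^ 2))
    (j : Fin m) : StripBound θ w S (Pi.single j 1) (√B * α j) := by
  intro u hu hu1 huS
  set f : Fin m → E n → ℂ := fun i y =>
    u i y * Complex.exp ((Pi.single (M := fun _ => ℝ) j 1 i : ℝ) * w i y) with hf
  have hfm : ∀ i, Measurable (f i) := fun i => by
    have := hw i; have := hu i; simp only [hf]; fun_prop
  have hfj : Integrable (f j) := by
    refine ⟨(hfm j).aestronglyMeasurable, ?_⟩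
    refine (lintegral_enorm_mul_cexp_le (hS j) (hL j) (hu1 j) (huS j) _).trans_lt ?_
    exact ENNReal.mul_lt_top ENNReal.ofReal_lt_top (hSfin j).lt_top
  have hsq : ∫⁻ y, ‖f j y‖ₑ ^ 2 ≤ ENNReal.ofReal (α j ^ 2) := by
    refine le_trans ?_ (hα j)
    rw [← lintegral_indicator (hS j)]
    refine lintegral_mono fun y => ?_
    by_cases hy : y ∈ S j
    · rw [indicator_of_mem hy, ← ofReal_norm, ← ENNReal.ofReal_pow (norm_nonneg _)]
      refine ENNReal.ofReal_le_ofReal ?_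
      simp only [hf, Pi.single_eq_same]
      rw [norm_mul, ← Complex.ofReal_mul, Complex.norm_exp_ofReal, one_mul, mul_pow,
        ← Real.exp_nat_mul]
      exact mul_le_of_le_one_left (Real.exp_pos _).le (pow_le_one₀ (norm_nonneg _) (hu1 j y))
    · simp [hf, huS j y hy]
  have hf2 : MemLp (f j) 2 := by
    refine ⟨(hfm j).aestronglyMeasurable, ?_⟩
    rw [eLpNorm_lt_top_iff_lintegral_rpow_enorm_lt_top two_ne_zero ENNReal.ofNat_ne_top]
    simp only [ENNReal.toReal_ofNat, ENNReal.rpow_ofNat]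
    exact hsq.trans_lt ENNReal.ofReal_lt_top
  have hf1 : ∀ i, i ≠ j → ∀ y, ‖f i y‖ ≤ 1 := fun i hij y => by
    simpa [hf, hij] using hu1 i y
  rw [lintegral_Theta_prod hθ hfm]
  refine (hB j f hfm hf1 hfj hf2).trans ((mul_le_mul' le_rfl hsq).trans_eq ?_)
  rw [mul_pow, Real.sq_sqrt (NNReal.coe_nonneg B), ENNReal.ofReal_mul (NNReal.coe_nonneg B),
    ENNReal.ofReal_coe_nnreal]

/-- The `L^p` estimate for functions that are bounded above and below on a set of finite measure. -/
lemma VertexBound.lintegral_le_of_bounded {θ : Kernels n m} {M δ : ℝ} {A : ℝ≥0}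
    (h : IsKernelFamily θ M δ A) {B : ℝ≥0} (hB : VertexBound θ B) (hB0 : 0 < B) {p : Fin m → ℝ}
    (hp : ∀ i, 0 < p i) (hps : ∑ i, 1 / p i = 1 / 2) {g : Fin m → E n → ℂ}
    (hg : ∀ i, Measurable (g i)) {S : Fin m → Set (E n)} (hS : ∀ i, MeasurableSet (S i))
    (hSfin : ∀ i, volume (S i) ≠ ∞) {K : ℝ} (hK : 0 < K)
    (hg1 : ∀ i, ∀ y ∈ S i, K⁻¹ ≤ ‖g i y‖) (hg2 : ∀ i, ∀ y ∈ S i, ‖g i y‖ ≤ K)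
    (hgS : ∀ i y, y ∉ S i → g i y = 0) {β : Fin m → ℝ} (hβ : ∀ i, 0 < β i)
    (hgβ : ∀ i, ∫⁻ y, ‖g i y‖ₑ ^ p i ≤ ENNReal.ofReal (β i ^ p i)) :
    ∫⁻ q, ‖Theta θ q.2 g q.1‖ₑ ^ 2 ∂((volume : Measure (E n)).prod dtOverT) ≤
      ENNReal.ofReal ((√B * ∏ i, β i) ^ 2) := by
  set w : Fin m → E n → ℝ := fun i => (S i).indicator fun y => p i / 2 * Real.log ‖g i y‖ with hw
  have hwm : ∀ i, Measurable (w i) := fun i =>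
    Measurable.indicator (by have := hg i; fun_prop) (hS i)
  have hpos : ∀ i, ∀ y ∈ S i, 0 < ‖g i y‖ := fun i y hy => (inv_pos.2 hK).trans_le (hg1 i y hy)
  have hwL : ∀ i y, |w i y| ≤ ∑ i, p i / 2 * |Real.log K| := by
    intro i y
    refine le_trans ?_ (Finset.single_le_sum (f := fun i => p i / 2 * |Real.log K|)
      (fun i _ => mul_nonneg (half_pos (hp i)).le (abs_nonneg _)) (Finset.mem_univ i))
    by_cases hy : y ∈ S i
    · simp only [hw, indicator_of_mem hy]
      rw [abs_mul, abs_of_pos (half_pos (hp i))]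
      refine mul_le_mul_of_nonneg_left ?_ (half_pos (hp i)).le
      have h1 := Real.log_le_log (inv_pos.2 hK) (hg1 i y hy)
      have h2 := Real.log_le_log (hpos i y hy) (hg2 i y hy)
      rw [Real.log_inv] at h1
      rw [abs_le]
      constructor
      · linarith [le_abs_self (Real.log K)]
      · exact h2.trans (le_abs_self _)
    · simp only [hw, indicator_of_notMem hy, abs_zero]
      exact mul_nonneg (half_pos (hp i)).le (abs_nonneg _)
  have hexp : ∀ i, ∀ y ∈ S i, Real.exp (2 * w i y) = ‖g i y‖ ^ p i := by
    intro i y hy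
    simp only [hw, indicator_of_mem hy]
    rw [Real.rpow_def_of_pos (hpos i y hy)]
    congr 1; ring
  have hα : ∀ i, ∫⁻ y in S i, ENNReal.ofReal (Real.exp (2 * w i y)) ≤
      ENNReal.ofReal ((β i ^ (p i / 2)) ^ 2) := by
    intro i
    rw [← Real.rpow_natCast, ← Real.rpow_mul (hβ i).le, Nat.cast_ofNat,
      div_mul_cancel₀ _ (two_ne_zero' ℝ)]
    refine le_trans ?_ (hgβ i)
    refine le_trans ?_ (setLIntegral_le_lintegral (S i) _)
    refine setLIntegral_mono' (hS i) fun y hy => ?_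
    rw [hexp i y hy, ← ENNReal.ofReal_rpow_of_nonneg (norm_nonneg _) (hp i).le, ofReal_norm]
  have hτ : (fun i => 2 / p i) ∈ stdSimplex ℝ (Fin m) := by
    refine ⟨fun i => (div_pos two_pos (hp i)).le, ?_⟩
    have : ∀ i, 2 / p i = 2 * (1 / p i) := fun i => by ring
    simp only [this]
    rw [← Finset.mul_sum, hps]
    norm_num
  have := StripBound.of_mem_stdSimplex h hwm hwL hS hSfin (b := √B)
    (Real.sqrt_pos.2 (NNReal.coe_pos.2 hB0)) (fun i => Real.rpow_pos_of_pos (hβ i) (p i / 2))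
    (hB.stripBound h.meas hwm hwL hS hSfin hα) hτ (fun i y => g i y / ‖g i y‖)
    (fun i => by have := hg i; fun_prop)
    (fun i y => by
      rw [norm_div, Complex.norm_real, norm_norm]
      exact div_self_le_one _)
    (fun i y hy => by rw [hgS i y hy, zero_div])
  have e1 : (fun i y => g i y / ‖g i y‖ * Complex.exp ((2 / p i : ℝ) * w i y)) = g := by
    funext i y
    by_cases hy : y ∈ S i
    · have h1 : (2 / p i : ℝ) * w i y = Real.log ‖g i y‖ := by
        simp only [hw, indicator_of_mem hy]
        have := (hp i).ne'
        field_simp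
      rw [← Complex.ofReal_mul, h1, ← Complex.ofReal_exp, Real.exp_log (hpos i y hy)]
      exact div_mul_cancel₀ _ (Complex.ofReal_ne_zero.2 (hpos i y hy).ne')
    · simp [hgS i y hy]
  have e2 : ∀ i, (β i ^ (p i / 2)) ^ (2 / p i) = β i := by
    intro i
    rw [← Real.rpow_mul (hβ i).le]
    have := (hp i).ne'
    rw [show p i / 2 * (2 / p i) = 1 by field_simp, Real.rpow_one]
  rw [e1] at this
  simpa only [e2] using this

lemma le_one_add_rpow {p : ℝ} (hp : 1 ≤ p) (a : ℝ≥0∞) : a ≤ 1 + a ^ p := by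
  rcases le_total a 1 with h | h
  · exact h.trans le_self_add
  · refine le_trans ?_ le_add_self
    simpa using ENNReal.rpow_le_rpow_of_exponent_le h hp

lemma lintegral_bump_mul_lt_top_of_rpow {M t : ℝ} (hM : (n : ℝ) < M) (ht : 0 < t) (x : E n)
    {g : E n → ℂ} {p : ℝ} (hp : 1 ≤ p) (hg : ∫⁻ y, ‖g y‖ₑ ^ p < ∞) :
    ∫⁻ y, bump M t (x - y) * ‖g y‖ₑ < ∞ := by
  have hb := measurable_bump (n := n) M t
  have hM0 : 0 ≤ M := (Nat.cast_nonneg n).trans hM.le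
  calc _ ≤ ∫⁻ y, (bump M t (x - y) + ENNReal.ofReal (t ^ n)⁻¹ * ‖g y‖ₑ ^ p) := by
        refine lintegral_mono fun y => ?_
        refine (mul_le_mul' le_rfl (le_one_add_rpow hp _)).trans ?_
        rw [mul_add, mul_one]
        gcongr
        exact bump_le hM0 ht _
    _ = bumpMass n M + ENNReal.ofReal (t ^ n)⁻¹ * ∫⁻ y, ‖g y‖ₑ ^ p := by
        rw [lintegral_add_left (by fun_prop), lintegral_bump_sub M ht,
          lintegral_const_mul' _ _ ENNReal.ofReal_ne_top]
    _ < ∞ := ENNReal.add_lt_top.2 ⟨bumpMass_lt_top hM, ENNReal.mul_lt_top ENNReal.ofReal_lt_top hg⟩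

/-- The set where `g` is neither too large nor too small. -/
def levelSet (g : E n → ℂ) (k : ℕ) : Set (E n) := {y | (k + 1 : ℝ)⁻¹ ≤ ‖g y‖ ∧ ‖g y‖ ≤ k + 1}

lemma measurableSet_levelSet {g : E n → ℂ} (hg : Measurable g) (k : ℕ) :
    MeasurableSet (levelSet g k) :=
  (measurableSet_le measurable_const hg.norm).inter (measurableSet_le hg.norm measurable_const)

lemma volume_levelSet_ne_top {g : E n → ℂ} (hg : Measurable g) {p : ℝ} (hp : 0 < p)
    (hgp : ∫⁻ y, ‖g y‖ₑ ^ p < ∞) (k : ℕ) : volume (levelSet g k) ≠ ∞ := by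
  have hε : ENNReal.ofReal ((k + 1 : ℝ)⁻¹) ^ p ≠ 0 := by
    rw [ENNReal.ofReal_rpow_of_pos (by positivity)]
    simp only [ne_eq, ENNReal.ofReal_eq_zero, not_le]
    positivity
  refine ((measure_mono fun y hy => ?_).trans_lt ((meas_ge_le_lintegral_div
    (f := fun y => ‖g y‖ₑ ^ p) (by fun_prop) hε (by finiteness)).trans_lt
    (ENNReal.div_lt_top hgp.ne hε))).ne
  refine ENNReal.rpow_le_rpow ?_ hp.le
  rw [← ofReal_norm]
  exact ENNReal.ofReal_le_ofReal hy.1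

lemma tendsto_indicator_levelSet (g : E n → ℂ) (y : E n) :
    Tendsto (fun k => (levelSet g k).indicator g y) atTop (𝓝 (g y)) := by
  rcases eq_or_ne (g y) 0 with h0 | h0
  · have : ∀ k, (levelSet g k).indicator g y = 0 := fun k => by
      by_cases hy : y ∈ levelSet g k <;> simp [hy, h0]
    simp [this, h0]
  · refine tendsto_const_nhds.congr' ?_
    obtain ⟨a, ha⟩ := exists_nat_ge ‖g y‖
    obtain ⟨b, hb⟩ := exists_nat_ge ‖g y‖⁻¹
    filter_upwards [eventually_ge_atTop (a + b)] with k hk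
    have hk' : (a + b : ℝ) ≤ k := by exact_mod_cast hk
    have ha0 := Nat.cast_nonneg (α := ℝ) a
    have hb0 := Nat.cast_nonneg (α := ℝ) b
    rw [indicator_of_mem]
    refine ⟨inv_le_of_inv_le₀ (norm_pos_iff.2 h0) ?_, ?_⟩ <;> linarith

/-- The `L^p` estimate for measurable functions. -/
lemma VertexBound.lintegral_le {θ : Kernels n m} {M δ : ℝ} {A : ℝ≥0}
    (h : IsKernelFamily θ M δ A) {B : ℝ≥0} (hB : VertexBound θ B) (hB0 : 0 < B) {p : Fin m → ℝ}
    (hp : ∀ i, 1 ≤ p i) (hps : ∑ i, 1 / p i = 1 / 2) {g : Fin m → E n → ℂ}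
    (hg : ∀ i, Measurable (g i)) {β : Fin m → ℝ} (hβ : ∀ i, 0 < β i)
    (hgβ : ∀ i, ∫⁻ y, ‖g i y‖ₑ ^ p i ≤ ENNReal.ofReal (β i ^ p i)) :
    ∫⁻ q, ‖Theta θ q.2 g q.1‖ₑ ^ 2 ∂((volume : Measure (E n)).prod dtOverT) ≤
      ENNReal.ofReal ((√B * ∏ i, β i) ^ 2) := by
  have hp0 : ∀ i, 0 < p i := fun i => zero_lt_one.trans_le (hp i)
  have hgfin : ∀ i, ∫⁻ y, ‖g i y‖ₑ ^ p i < ∞ := fun i => (hgβ i).trans_lt ENNReal.ofReal_lt_top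
  set G : ℕ → Fin m → E n → ℂ := fun k i => (levelSet (g i) k).indicator (g i) with hG
  have hGm : ∀ k i, Measurable (G k i) := fun k i =>
    (hg i).indicator (measurableSet_levelSet (hg i) k)
  have hGle : ∀ k i y, ‖G k i y‖ ≤ ‖g i y‖ := fun k i y => norm_indicator_le_norm_self _ _
  have hbd : ∀ k, ∫⁻ q, ‖Theta θ q.2 (G k) q.1‖ₑ ^ 2 ∂((volume : Measure (E n)).prod dtOverT) ≤
      ENNReal.ofReal ((√B * ∏ i, β i) ^ 2) := by
    intro k
    refine hB.lintegral_le_of_bounded h hB0 hp0 hps (hGm k) (S := fun i => levelSet (g i) k)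
      (fun i => measurableSet_levelSet (hg i) k)
      (fun i => volume_levelSet_ne_top (hg i) (hp0 i) (hgfin i) k) (K := k + 1) (by positivity)
      (fun i y hy => ?_) (fun i y hy => ?_) (fun i y hy => indicator_of_notMem hy _) hβ
      (fun i => le_trans (lintegral_mono fun y => ?_) (hgβ i))
    · simpa only [hG, indicator_of_mem hy] using hy.1
    · simpa only [hG, indicator_of_mem hy] using hy.2
    · exact ENNReal.rpow_le_rpow (by
        rw [← ofReal_norm, ← ofReal_norm]; exact ENNReal.ofReal_le_ofReal (hGle k i y)) (hp0 i).le
  have hlim : ∀ᵐ q ∂((volume : Measure (E n)).prod dtOverT),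
      Tendsto (fun k => ‖Theta θ q.2 (G k) q.1‖ₑ ^ 2) atTop (𝓝 (‖Theta θ q.2 g q.1‖ₑ ^ 2)) := by
    filter_upwards [ae_prod_dtOverT_pos] with q hq
    refine ENNReal.Tendsto.pow (Tendsto.enorm ?_)
    have hi := (h.kernel q.2 hq q.1).integrable_mul_prod hg fun i =>
      lintegral_bump_mul_lt_top_of_rpow (by linarith [h.lt, h.pos]) hq q.1 (hp i) (hgfin i)
    refine tendsto_integral_of_dominated_convergence _
      (fun k => ((h.kernel q.2 hq q.1).measurable_mul_prod (hGm k)).aestronglyMeasurable) hi.norm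
      (fun k => ae_of_all _ fun y => ?_) (ae_of_all _ fun y => ?_)
    · rw [norm_mul, norm_mul, norm_prod, norm_prod]
      gcongr with i
      exact hGle k i _
    · exact (tendsto_finsetProd _ fun i _ =>
        tendsto_indicator_levelSet (g i) (y i)).const_mul _
  calc _ = ∫⁻ q, liminf (fun k => ‖Theta θ q.2 (G k) q.1‖ₑ ^ 2) atTop
        ∂((volume : Measure (E n)).prod dtOverT) :=
        lintegral_congr_ae (hlim.mono fun q hq => hq.liminf_eq.symm)
    _ ≤ _ := lintegral_liminf_le' fun k => h.meas.aemeasurable_enorm_Theta_sq (hGm k)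
    _ ≤ _ := liminf_le_of_le (by isBoundedDefault) fun b hb => by
        obtain ⟨k, hk⟩ := hb.exists
        exact hk.trans (hbd k)

lemma Theta_congr_ae (θ : Kernels n m) {f g : Fin m → E n → ℂ} (hfg : ∀ i, f i =ᵐ[volume] g i)
    (t : ℝ) (x : E n) : Theta θ t f x = Theta θ t g x := by
  have : ∀ᵐ y : Fin m → E n, ∀ i, f i (y i) = g i (y i) :=
    ae_all_iff.2 fun i =>
    (Measure.quasiMeasurePreserving_eval (fun _ : Fin m => (volume : Measure (E n))) i).ae
      (p := fun a => f i a = g i a) (hfg i)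
  exact integral_congr_ae (this.mono fun y hy => by simp only [hy])

lemma lintegral_rpow_le_of_eLpNorm_le {f : E n → ℂ} {p β : ℝ} (hp : 0 < p) (hβ : 0 ≤ β)
    (h : eLpNorm f (ENNReal.ofReal p) volume ≤ ENNReal.ofReal β) :
    ∫⁻ y, ‖f y‖ₑ ^ p ≤ ENNReal.ofReal (β ^ p) := by
  rw [eLpNorm_eq_lintegral_rpow_enorm_toReal (by simpa using hp) ENNReal.ofReal_ne_top,
    ENNReal.toReal_ofReal hp.le, one_div, ENNReal.rpow_inv_le_iff hp,
    ENNReal.ofReal_rpow_of_nonneg hβ hp.le] at h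
  exact h

theorem VertexBound.eLpNorm_squareFunction_le {θ : Kernels n m} {M δ : ℝ} {A : ℝ≥0}
    (h : IsKernelFamily θ M δ A) {B : ℝ≥0} (hB : VertexBound θ B) (hB0 : 0 < B) {p : Fin m → ℝ}
    (hp : ∀ i, 1 ≤ p i) (hps : ∑ i, 1 / p i = 1 / 2) {f : Fin m → E n → ℂ}
    (hf : ∀ i, MemLp (f i) (ENNReal.ofReal (p i)) volume) :
    eLpNorm (squareFunction θ f) 2 volume ≤
      NNReal.sqrt B * ∏ i, eLpNorm (f i) (ENNReal.ofReal (p i)) volume := by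
  set g : Fin m → E n → ℂ := fun i => (hf i).1.mk (f i) with hg
  have hfg : ∀ i, f i =ᵐ[volume] g i := fun i => (hf i).1.ae_eq_mk
  have hgm : ∀ i, Measurable (g i) := fun i => (hf i).1.stronglyMeasurable_mk.measurable
  set a : Fin m → ℝ := fun i => (eLpNorm (f i) (ENNReal.ofReal (p i)) volume).toReal with ha
  have hae : ∀ i, eLpNorm (f i) (ENNReal.ofReal (p i)) volume = ENNReal.ofReal (a i) := fun i =>
    (ENNReal.ofReal_toReal (hf i).2.ne).symm
  have ha0 : ∀ i, 0 ≤ a i := fun i => ENNReal.toReal_nonneg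
  have hle : ∀ ε : ℝ, 0 < ε →
      eLpNorm (squareFunction θ f) 2 volume ≤ ENNReal.ofReal (√B * ∏ i, (a i + ε)) := by
    intro ε hε
    have hβ : ∀ i, 0 < a i + ε := fun i => by linarith [ha0 i]
    have h1 := hB.lintegral_le h hB0 hp hps hgm hβ fun i =>
      lintegral_rpow_le_of_eLpNorm_le (zero_lt_one.trans_le (hp i)) (hβ i).le (by
        rw [← eLpNorm_congr_ae (hfg i), hae]
        exact ENNReal.ofReal_le_ofReal (by linarith))
    rw [lintegral_Theta_prod h.meas hgm] at h1
    rw [eLpNorm_eq_lintegral_rpow_enorm_toReal two_ne_zero ENNReal.ofNat_ne_top,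
      ENNReal.toReal_ofNat, one_div, ENNReal.rpow_inv_le_iff two_pos,
      ENNReal.ofReal_rpow_of_nonneg (mul_nonneg (Real.sqrt_nonneg _)
        (Finset.prod_nonneg fun i _ => (hβ i).le)) two_pos.le, Real.rpow_two]
    refine le_of_eq_of_le (lintegral_congr fun x => ?_) h1
    rw [enorm_eq_self, squareFunction, ← ENNReal.rpow_mul]
    norm_num
    simp only [Theta_congr_ae θ hfg]
  have hrhs : (NNReal.sqrt B : ℝ≥0∞) * ∏ i, eLpNorm (f i) (ENNReal.ofReal (p i)) volume =
      ENNReal.ofReal (√B * ∏ i, (a i + 0)) := by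
    simp only [add_zero, hae]
    rw [ENNReal.ofReal_mul (Real.sqrt_nonneg _), ENNReal.ofReal_prod_of_nonneg fun i _ => ha0 i,
      ← ENNReal.ofReal_coe_nnreal, Real.coe_sqrt]
  rw [hrhs]
  have hc : Continuous fun ε : ℝ => ENNReal.ofReal (√B * ∏ i, (a i + ε)) :=
    ENNReal.continuous_ofReal.comp (by fun_prop)
  exact ge_of_tendsto ((hc.tendsto 0).mono_left nhdsWithin_le_nhds)
    (eventually_nhdsWithin_of_forall (s := Ioi 0) fun ε hε => hle ε hε)

end

section

variable {n m : ℕ}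

/-! ### Differentiation along cubes -/

/-- If the averages of `F` over small cubes are bounded by `C`, then so is `F`. -/
lemma ae_le_of_setLIntegral_cube_le {F : E n → ℝ≥0∞} (hF : AEMeasurable F) {c : ℝ≥0∞}
    (hc : c ≠ ∞) (hFc : ∀ x, F x ≤ c) {Q : Cube n} {C : ℝ≥0} {ε : ℝ} (hε : 0 < ε)
    (h : ∀ R : Cube n, R.side < ε → R.toSet ⊆ Q.double.toSet →
      ∫⁻ x in R.toSet, F x ≤ C * volume R.toSet) :
    ∀ᵐ x ∂volume.restrict Q.toSet, F x ≤ C := by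
  rw [ae_restrict_iff' Q.measurableSet_toSet]
  have hmp := PiLp.volume_preserving_ofLp (Fin n)
  have hemb : MeasurableEmbedding (WithLp.ofLp : E n → Fin n → ℝ) :=
    (MeasurableEquiv.toLp 2 (Fin n → ℝ)).symm.measurableEmbedding
  have hmp' := PiLp.volume_preserving_toLp (Fin n)
  set F' : (Fin n → ℝ) → ℝ≥0∞ := fun v => Q.double.toSet.indicator F (WithLp.toLp 2 v) with hF'
  have hF'm : AEMeasurable F' :=
    (hF.indicator Q.double.measurableSet_toSet).comp_quasiMeasurePreserving
      hmp'.quasiMeasurePreserving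
  have hint : ∀ s : Set (Fin n → ℝ), ∫⁻ v in s, F' v =
      ∫⁻ x in (WithLp.ofLp ⁻¹' s : Set (E n)), Q.double.toSet.indicator F x := fun s => by
    rw [← hmp.setLIntegral_comp_preimage_emb hemb]
  have hF'fin : ∫⁻ v, F' v ≠ ∞ := by
    rw [← setLIntegral_univ, hint, preimage_univ, setLIntegral_univ,
      lintegral_indicator Q.double.measurableSet_toSet]
    refine ne_top_of_le_ne_top (ENNReal.mul_ne_top hc Q.double.volume_ne_top) ?_
    rw [← setLIntegral_const]
    exact lintegral_mono hFc
  set v := IsUnifLocDoublingMeasure.vitaliFamily (volume : Measure (Fin n → ℝ)) 1 with hv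
  have hae := hmp.quasiMeasurePreserving.ae (v.ae_tendsto_lintegral_div hF'm hF'fin)
  filter_upwards [hae] with x hx hxQ
  have hlim := hx.comp (IsUnifLocDoublingMeasure.tendsto_closedBall_filterAt volume (K := 1)
    (x := WithLp.ofLp x) (fun _ : ℝ => WithLp.ofLp x) id (l := 𝓝[>] 0) tendsto_id (by
      filter_upwards [self_mem_nhdsWithin] with r hr
      exact Metric.mem_closedBall_self (by simpa using (mem_Ioi.1 hr).le)))
  have hxQ2 : x ∈ Q.double.toSet := fun i => (hxQ i).trans (by
    have := Q.side_pos
    simp only [Cube.double]; linarith)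
  have e1 : F' (WithLp.ofLp x) = F x := by simp [hF', hxQ2]
  rw [e1] at hlim
  refine le_of_tendsto hlim ?_
  have hs := Q.side_pos
  filter_upwards [Ioo_mem_nhdsGT (show (0 : ℝ) < min (ε / 2) (Q.side / 2) by positivity)]
    with r hr
  have hr0 : 0 < r := hr.1
  have hr1 : r < ε / 2 := hr.2.trans_le (min_le_left _ _)
  have hr2 : r < Q.side / 2 := hr.2.trans_le (min_le_right _ _)
  set R : Cube n := ⟨x, 2 * r, by positivity⟩ with hR
  have hball : (WithLp.ofLp ⁻¹' Metric.closedBall (WithLp.ofLp x) r : Set (E n)) = R.toSet := by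
    ext y
    simp only [mem_preimage, Metric.mem_closedBall, Cube.toSet, mem_ofPred_eq, hR]
    rw [dist_pi_le_iff hr0.le]
    simp [Real.dist_eq]
  have hsub : R.toSet ⊆ Q.double.toSet := by
    intro y hy i
    have h1 := hy i
    have h2 := hxQ i
    have h3 := abs_sub_le (y i) (x i) (Q.center i)
    simp only [hR, Cube.double] at h1 ⊢
    linarith
  have hvol : volume (Metric.closedBall (WithLp.ofLp x) r) = volume R.toSet := by
    rw [← hball, hmp.measure_preimage Metric.isClosed_closedBall.measurableSet.nullMeasurableSet]
  simp only [Function.comp_apply, id]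
  rw [hint, hball, hvol]
  refine ENNReal.div_le_of_le_mul ((setLIntegral_mono' R.measurableSet_toSet fun y _ => ?_).trans
    (h R (by simp only [hR]; linarith) hsub))
  exact indicator_le_self' (fun _ _ => zero_le) y

/-! ### The strong Carleson condition -/

lemma measurable_indicator_one {s : Set (E n)} (hs : MeasurableSet s) :
    Measurable (s.indicator fun _ => (1 : ℂ)) := measurable_const.indicator hs

lemma lintegral_bump_mul_indicator (N t : ℝ) (x : E n) {s : Set (E n)} (hs : MeasurableSet s) :
    ∫⁻ y, bump N t (x - y) * ‖s.indicator (fun _ => (1 : ℂ)) y‖ₑ = ∫⁻ y in s, bump N t (x - y) := by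
  rw [← lintegral_indicator hs]
  refine lintegral_congr fun y => ?_
  by_cases hy : y ∈ s <;> simp [hy]

section

variable {κ : (Fin m → E n) → ℂ} {M δ t : ℝ} {A : ℝ≥0} {x : E n}

lemma IsMultiKernel.enorm_integral_le (h : IsMultiKernel κ M δ t A x) {f : Fin m → E n → ℂ}
    (hf : ∀ i, Measurable (f i)) :
    ‖∫ y, κ y * ∏ i, f i (y i)‖ₑ ≤ A * ∏ i, ∫⁻ y, bump (M + δ) t (x - y) * ‖f i y‖ₑ :=
  (enorm_integral_le_lintegral_enorm _).trans (h.lintegral_enorm_mul_prod_le hf)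

lemma IsMultiKernel.enorm_integral_one_le (h : IsMultiKernel κ M δ t A x) (ht : 0 < t) :
    ‖∫ y, κ y * ∏ _i : Fin m, (1 : ℂ)‖ₑ ≤ A * bumpMass n (M + δ) ^ m := by
  refine (h.enorm_integral_le (f := fun _ _ => 1) fun _ => measurable_const).trans ?_
  simp [lintegral_bump_sub _ ht]

lemma one_sub_prod_indicator_le {ι : Type*} (s : Finset ι) (a : ι → E n) (S : Set (E n)) :
    ‖1 - ∏ i ∈ s, Sᶜ.indicator (fun _ => (1 : ℂ)) (a i)‖ₑ ≤
      ∑ i ∈ s, ‖S.indicator (fun _ => (1 : ℂ)) (a i)‖ₑ := by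
  by_cases hs : ∃ i ∈ s, a i ∈ S
  · obtain ⟨i, hi, hiS⟩ := hs
    rw [Finset.prod_eq_zero hi (by simp [hiS])]
    refine le_trans ?_ (Finset.single_le_sum (fun _ _ => zero_le) hi)
    simp [hiS]
  · push Not at hs
    rw [Finset.prod_eq_one fun i hi => by simp [hs i hi]]
    simp

/-- Removing a cube from the domain of integration changes little at scales that are large
compared to the cube. -/
lemma IsMultiKernel.enorm_sub_off_le (h : IsMultiKernel κ M δ t A x) (hM : (n : ℝ) < M)
    (hδ : 0 < δ) (ht : 0 < t) (R : Cube n) :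
    ‖(∫ y, κ y * ∏ _i : Fin m, (1 : ℂ)) -
      ∫ y, κ y * ∏ i, (R.double.toSet)ᶜ.indicator (fun _ => (1 : ℂ)) (y i)‖ₑ ≤
      m * (A * (bumpMass n (M + δ) + 1) ^ m) * ENNReal.ofReal ((2 * R.side / t) ^ n) := by
  have hM' : (n : ℝ) < M + δ := by linarith
  have hM0 : 0 ≤ M + δ := (Nat.cast_nonneg n).trans hM'.le
  set S := R.double.toSet with hS
  have hSm : MeasurableSet S := R.double.measurableSet_toSet
  have hb1 : ∀ s : Set (E n), ∀ y, ‖s.indicator (fun _ => (1 : ℂ)) y‖ₑ ≤ 1 := fun s y => by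
    by_cases hy : y ∈ s <;> simp [hy]
  have hi1 := h.integrable_mul_prod (f := fun _ _ => 1) (fun _ => measurable_const) fun i =>
    lintegral_bump_mul_lt_top_of_bounded hM' ht x fun y => by simp
  have hi2 := h.integrable_mul_prod (f := fun _ => Sᶜ.indicator fun _ => 1)
    (fun _ => measurable_indicator_one hSm.compl) fun i =>
    lintegral_bump_mul_lt_top_of_bounded hM' ht x (hb1 _)
  set g : Fin m → Fin m → E n → ℂ := fun i =>
    Function.update (fun _ _ => 1) i (S.indicator fun _ => 1) with hg
  have hgm : ∀ i j, Measurable (g i j) := by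
    intro i j
    rcases eq_or_ne j i with rfl | hij
    · simpa [hg] using measurable_indicator_one hSm
    · simp [hg, hij]
  have hgprod : ∀ i (y : Fin m → E n), ∏ j, g i j (y j) = S.indicator (fun _ => 1) (y i) := by
    intro i y
    rw [Finset.prod_eq_single i (fun j _ hij => by simp [hg, hij]) (by simp)]
    simp [hg]
  have hvol : ∫⁻ y in S, bump (M + δ) t (x - y) ≤ ENNReal.ofReal ((2 * R.side / t) ^ n) := by
    have hs := R.side_pos
    calc _ ≤ ∫⁻ _y in S, ENNReal.ofReal (t ^ n)⁻¹ :=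
          setLIntegral_mono measurable_const fun y _ => bump_le hM0 ht _
      _ = _ := by
          rw [setLIntegral_const, hS, Cube.volume_toSet, ← ENNReal.ofReal_pow R.double.side_pos.le,
            ← ENNReal.ofReal_mul (by positivity), div_pow, div_eq_inv_mul]
          rfl
  have hterm : ∀ i, ∫⁻ y, ‖κ y * ∏ j, g i j (y j)‖ₑ ≤
      A * (bumpMass n (M + δ) + 1) ^ m * ENNReal.ofReal ((2 * R.side / t) ^ n) := by
    intro i
    refine (h.lintegral_enorm_mul_prod_le (hgm i)).trans ?_
    rw [mul_assoc]
    refine mul_le_mul' le_rfl ?_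
    rw [← Finset.mul_prod_erase _ _ (Finset.mem_univ i), mul_comm]
    refine mul_le_mul' ?_ ?_
    · calc _ = ∏ j ∈ Finset.univ.erase i, bumpMass n (M + δ) := by
            refine Finset.prod_congr rfl fun j hj => ?_
            simp [hg, Finset.ne_of_mem_erase hj, lintegral_bump_sub _ ht]
        _ ≤ (bumpMass n (M + δ) + 1) ^ (m - 1) := by
            rw [Finset.prod_const, Finset.card_erase_of_mem (Finset.mem_univ i), Finset.card_univ,
              Fintype.card_fin]
            exact pow_le_pow_left' le_self_add _
        _ ≤ _ := pow_le_pow_right₀ le_add_self (Nat.sub_le m 1)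
    · simp only [hg, Function.update_self]
      rw [lintegral_bump_mul_indicator _ _ _ hSm]
      exact hvol
  rw [← integral_sub hi1 hi2]
  calc _ ≤ ∫⁻ y, ∑ i, ‖κ y * ∏ j, g i j (y j)‖ₑ := by
        refine (enorm_integral_le_lintegral_enorm _).trans (lintegral_mono fun y => ?_)
        rw [← mul_sub, enorm_mul, Finset.prod_const_one]
        refine (mul_le_mul' le_rfl (one_sub_prod_indicator_le Finset.univ y S)).trans_eq ?_
        rw [Finset.mul_sum]
        refine Finset.sum_congr rfl fun i _ => ?_
        rw [hgprod, enorm_mul]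
    _ = ∑ i, ∫⁻ y, ‖κ y * ∏ j, g i j (y j)‖ₑ :=
        lintegral_finsetSum _ fun i _ => (h.measurable_mul_prod (hgm i)).enorm
    _ ≤ ∑ _i : Fin m, A * (bumpMass n (M + δ) + 1) ^ m *
          ENNReal.ofReal ((2 * R.side / t) ^ n) := Finset.sum_le_sum fun i _ => hterm i
    _ = _ := by simp [mul_assoc]

lemma IsMultiKernel.enorm_off_le {κ : (Fin (m + 1) → E n) → ℂ} (h : IsMultiKernel κ M δ t A x)
    (hδ : 0 < δ) (ht : 0 < t) (Q : Cube n) (hx : x ∈ Q.toSet) :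
    ‖∫ y, κ y * ∏ i, (Q.double.toSet)ᶜ.indicator (fun _ => (1 : ℂ)) (y i)‖ₑ ≤
      ENNReal.ofReal ((2 * t / Q.side) ^ δ) * (bumpMass n M * A * bumpMass n (M + δ) ^ m) := by
  have hSm : MeasurableSet (Q.double.toSet)ᶜ := Q.double.measurableSet_toSet.compl
  refine (h.enorm_integral_le (f := fun _ => (Q.double.toSet)ᶜ.indicator fun _ => 1)
    fun _ => measurable_indicator_one hSm).trans ?_
  rw [Finset.prod_const, lintegral_bump_mul_indicator _ _ _ hSm, Finset.card_univ, Fintype.card_fin,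
    pow_succ]
  have h1 : ∫⁻ y in (Q.double.toSet)ᶜ, bump (M + δ) t (x - y) ≤ bumpMass n (M + δ) :=
    (setLIntegral_le_lintegral _ _).trans_eq (lintegral_bump_sub _ ht x)
  calc _ ≤ A * (bumpMass n (M + δ) ^ m *
        (ENNReal.ofReal ((2 * t / Q.side) ^ δ) * bumpMass n M)) := by
        gcongr
        exact setLIntegral_compl_double_bump_le hδ.le ht Q hx
    _ = _ := by ring

end

lemma setLIntegral_Ioi_tail_sq (hn : 1 ≤ n) {ℓ : ℝ} (hℓ : 0 < ℓ) (c : ℝ≥0∞) :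
    ∫⁻ t in Ioi ℓ, (c * ENNReal.ofReal ((2 * ℓ / t) ^ n)) ^ 2 ∂dtOverT =
      c ^ 2 * ENNReal.ofReal (2 ^ (2 * n) * (2 * n : ℝ)⁻¹) := by
  have hn' : (0 : ℝ) < n := by exact_mod_cast hn
  have e : ∫⁻ t in Ioi ℓ, (c * ENNReal.ofReal ((2 * ℓ / t) ^ n)) ^ 2 ∂dtOverT =
      ∫⁻ t in Ioi ℓ, (c ^ 2 * ENNReal.ofReal (2 ^ (2 * n))) *
        ENNReal.ofReal ((ℓ / t) ^ (2 * n : ℝ)) ∂dtOverT := by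
    refine setLIntegral_congr_fun measurableSet_Ioi fun t ht => ?_
    have ht0 : 0 < t := hℓ.trans ht
    have h1 : ((2 * ℓ / t) ^ n) ^ 2 = 2 ^ (2 * n) * (ℓ / t) ^ (2 * n : ℝ) := by
      rw [← Nat.cast_ofNat (R := ℝ) (n := 2), ← Nat.cast_mul, Real.rpow_natCast]
      push_cast
      rw [mul_div_assoc, mul_pow, mul_pow, ← pow_mul, ← pow_mul, mul_comm n 2]
    simp only [mul_pow]
    rw [← ENNReal.ofReal_pow (by positivity), h1, ENNReal.ofReal_mul (by positivity), mul_assoc]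
  rw [e, lintegral_const_mul _ (by fun_prop), lintegral_Ioi_div_rpow (by positivity) hℓ,
    mul_assoc, ← ENNReal.ofReal_mul (by positivity)]

namespace IsKernelFamily

variable {θ : Kernels n (m + 1)} {M δ : ℝ} {A : ℝ≥0}

lemma enorm_Theta_one_le (h : IsKernelFamily θ M δ A) {t : ℝ} (ht : 0 < t) (x : E n) :
    ‖Theta θ t (fun _ _ => 1) x‖ₑ ≤ A * bumpMass n (M + δ) ^ (m + 1) :=
  (h.kernel t ht x).enorm_integral_one_le ht

lemma aestronglyMeasurable_thetaOneSq (h : IsKernelFamily θ M δ A) :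
    AEStronglyMeasurable (thetaOneSq θ) (volume.prod dtOverT) :=
  (h.meas.aestronglyMeasurable_Theta fun _ => measurable_const).norm.pow 2

lemma thetaOneConst_ne_top (h : IsKernelFamily θ M δ A) :
    (A : ℝ≥0∞) * bumpMass n (M + δ) ^ (m + 1) ≠ ∞ :=
  ENNReal.mul_ne_top ENNReal.coe_ne_top
    (ENNReal.pow_ne_top (bumpMass_lt_top (by linarith [h.lt, h.pos])).ne)

lemma locallyIntegrableOn_thetaOneSq (h : IsKernelFamily θ M δ A) :
    LocallyIntegrableOn (thetaOneSq θ) (univ ×ˢ Ioi (0 : ℝ)) (volume.prod dtOverT) := by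
  rintro ⟨x, t⟩ ⟨-, ht⟩
  have ht0 : 0 < t := ht
  refine ⟨Metric.closedBall x 1 ×ˢ Icc (t / 2) (t + 1), mem_nhdsWithin_of_mem_nhds
    (prod_mem_nhds (Metric.closedBall_mem_nhds x one_pos) (Icc_mem_nhds (by linarith)
      (by linarith))), ?_⟩
  refine Measure.integrableOn_of_bounded
    (M := (A * bumpMass n (M + δ) ^ (m + 1) : ℝ≥0∞).toReal ^ 2) ?_
    h.aestronglyMeasurable_thetaOneSq ?_
  · rw [Measure.prod_prod]
    exact ENNReal.mul_ne_top (Metric.isBounded_closedBall.measure_lt_top).ne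
      (dtOverT_Icc_lt_top (by linarith) _).ne
  · filter_upwards [ae_restrict_of_ae ae_prod_dtOverT_pos] with q hq
    rw [thetaOneSq, Real.norm_of_nonneg (sq_nonneg _)]
    have := ENNReal.toReal_mono h.thetaOneConst_ne_top (h.enorm_Theta_one_le hq q.1)
    rw [toReal_enorm] at this
    gcongr

/-- The average over a cube `R` inside a cube `Q` of the square function of `1` truncated to
`(ℓ(R), ℓ(Q)]` is bounded. -/
lemma exists_setLIntegral_le_of_twoCube (h : IsKernelFamily θ M δ A) (h2 : TwoCubeCondition θ) :
    ∃ C : ℝ≥0, ∀ R Q : Cube n, R.toSet ⊆ Q.toSet →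
      ∫⁻ x in R.toSet, ∫⁻ t in Ioc R.side Q.side, ‖Theta θ t (fun _ _ => 1) x‖ₑ ^ 2 ∂dtOverT ≤
        C * volume R.toSet := by
  obtain ⟨C, hC⟩ := h2
  have hm1 : bumpMass n M ≠ ∞ := (bumpMass_lt_top h.lt).ne
  have hm2 : bumpMass n (M + δ) ≠ ∞ := (bumpMass_lt_top (by linarith [h.lt, h.pos])).ne
  set c₁ : ℝ≥0∞ := ((m + 1 : ℕ) : ℝ≥0∞) * (A * (bumpMass n (M + δ) + 1) ^ (m + 1)) with hc₁
  set c₂ : ℝ≥0∞ := bumpMass n M * A * bumpMass n (M + δ) ^ m with hc₂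
  set D : ℝ≥0∞ := 4 * (c₁ ^ 2 * ENNReal.ofReal (2 ^ (2 * n) * (2 * n : ℝ)⁻¹)) +
    4 * (ENNReal.ofReal (2 ^ (2 * δ) * (2 * δ)⁻¹) * c₂ ^ 2) with hD
  have hDfin : D + 2 * C ≠ ∞ := by
    simp only [hD, hc₁, hc₂]
    finiteness
  refine ⟨(D + 2 * C).toNNReal, fun R Q hRQ => ?_⟩
  rw [ENNReal.coe_toNNReal hDfin]
  have hpt : ∀ x ∈ R.toSet, ∀ t ∈ Ioc R.side Q.side, ‖Theta θ t (fun _ _ => 1) x‖ₑ ^ 2 ≤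
      4 * (c₁ * ENNReal.ofReal ((2 * R.side / t) ^ n)) ^ 2 +
        (4 * (ENNReal.ofReal ((2 * t / Q.side) ^ δ) * c₂) ^ 2 +
          2 * ‖thetaOff θ t R x - thetaOff θ t Q x‖ₑ ^ 2) := by
    intro x hx t ht
    have ht0 : 0 < t := R.side_pos.trans ht.1
    have h1 : ‖Theta θ t (fun _ _ => 1) x - thetaOff θ t R x‖ₑ ≤ _ :=
      (h.kernel t ht0 x).enorm_sub_off_le h.lt h.pos ht0 R
    have h3 : ‖thetaOff θ t Q x‖ₑ ≤ _ :=
      (h.kernel t ht0 x).enorm_off_le h.pos ht0 Q (hRQ hx)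
    calc _ ≤ ((‖Theta θ t (fun _ _ => 1) x - thetaOff θ t R x‖ₑ + ‖thetaOff θ t Q x‖ₑ) +
          ‖thetaOff θ t R x - thetaOff θ t Q x‖ₑ) ^ 2 := by
          refine pow_le_pow_left' ?_ 2
          rw [show Theta θ t (fun _ _ => 1) x = (Theta θ t (fun _ _ => 1) x - thetaOff θ t R x) +
            thetaOff θ t Q x + (thetaOff θ t R x - thetaOff θ t Q x) by ring]
          refine (enorm_add_le _ _).trans (add_le_add ((enorm_add_le _ _).trans ?_) le_rfl)
          rw [show (Theta θ t (fun _ _ => 1) x - thetaOff θ t R x) +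
            thetaOff θ t Q x + (thetaOff θ t R x - thetaOff θ t Q x) =
            Theta θ t (fun _ _ => 1) x by ring]
      _ ≤ 2 * (2 * ((c₁ * ENNReal.ofReal ((2 * R.side / t) ^ n)) ^ 2 +
            (ENNReal.ofReal ((2 * t / Q.side) ^ δ) * c₂) ^ 2) +
            ‖thetaOff θ t R x - thetaOff θ t Q x‖ₑ ^ 2) := by
          refine (add_sq_le_two_mul _ _).trans (mul_le_mul' le_rfl (add_le_add ?_ le_rfl))
          refine (add_sq_le_two_mul _ _).trans (mul_le_mul' le_rfl (add_le_add ?_ ?_))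
          · exact pow_le_pow_left' h1 2
          · exact pow_le_pow_left' h3 2
      _ = _ := by ring
  have hin : ∀ x ∈ R.toSet,
      ∫⁻ t in Ioc R.side Q.side, ‖Theta θ t (fun _ _ => 1) x‖ₑ ^ 2 ∂dtOverT ≤
      D + 2 * ∫⁻ t in Ioc R.side Q.side, ‖thetaOff θ t R x - thetaOff θ t Q x‖ₑ ^ 2 ∂dtOverT := by
    intro x hx
    refine (setLIntegral_mono' measurableSet_Ioc (hpt x hx)).trans ?_
    rw [lintegral_add_left (by fun_prop), lintegral_add_left (by fun_prop),
      lintegral_const_mul' _ _ (by finiteness), lintegral_const_mul' _ _ (by finiteness),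
      lintegral_const_mul' _ _ (by finiteness), ← add_assoc]
    refine add_le_add (add_le_add (mul_le_mul' le_rfl ?_) (mul_le_mul' le_rfl ?_)) le_rfl
    · rw [← setLIntegral_Ioi_tail_sq h.one_le R.side_pos]
      exact lintegral_mono_set Ioc_subset_Ioi_self
    · rw [← setLIntegral_Ioc_tail_sq h.pos Q.side_pos]
      exact lintegral_mono_set (Ioc_subset_Ioc_left R.side_pos.le)
  calc _ ≤ ∫⁻ x in R.toSet, (D + 2 * ∫⁻ t in Ioc R.side Q.side,
        ‖thetaOff θ t R x - thetaOff θ t Q x‖ₑ ^ 2 ∂dtOverT) :=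
        setLIntegral_mono' R.measurableSet_toSet hin
    _ = D * volume R.toSet + 2 * ∫⁻ x in R.toSet, ∫⁻ t in Ioc R.side Q.side,
        ‖thetaOff θ t R x - thetaOff θ t Q x‖ₑ ^ 2 ∂dtOverT := by
        rw [lintegral_add_left measurable_const, setLIntegral_const,
          lintegral_const_mul' _ _ (by finiteness)]
    _ ≤ D * volume R.toSet + 2 * (C * volume R.toSet) := by gcongr; exact hC R Q hRQ
    _ = _ := by ring

theorem strongCarlesonCondition (h : IsKernelFamily θ M δ A) (h2 : TwoCubeCondition θ) :
    StrongCarlesonCondition θ := by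
  refine ⟨h.locallyIntegrableOn_thetaOneSq, ?_⟩
  obtain ⟨C, hC⟩ := h.exists_setLIntegral_le_of_twoCube h2
  refine ⟨C, fun Q => ?_⟩
  have hae : ∀ k : ℕ, ∀ᵐ x ∂volume.restrict Q.toSet,
      ∫⁻ t in Ioc ((k + 1 : ℝ)⁻¹) Q.side, ‖Theta θ t (fun _ _ => 1) x‖ₑ ^ 2 ∂dtOverT ≤ C := by
    intro k
    have hk : (0 : ℝ) < (k + 1 : ℝ)⁻¹ := by positivity
    refine ae_le_of_setLIntegral_cube_le (ε := (k + 1 : ℝ)⁻¹) (c := ∫⁻ _t in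
      Ioc ((k + 1 : ℝ)⁻¹) Q.side, (A * bumpMass n (M + δ) ^ (m + 1)) ^ 2 ∂dtOverT) ?_ ?_ ?_ hk ?_
    · refine AEMeasurable.lintegral_prod_right' (f := fun q : E n × ℝ =>
        ‖Theta θ q.2 (fun _ _ => 1) q.1‖ₑ ^ 2) ?_
      exact (h.meas.aemeasurable_enorm_Theta_sq fun _ => measurable_const).mono_ac
        ((Measure.AbsolutelyContinuous.refl _).prod Measure.restrict_le_self.absolutelyContinuous)
    · rw [setLIntegral_const]
      refine ENNReal.mul_ne_top (ENNReal.pow_ne_top h.thetaOneConst_ne_top) ?_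
      exact ((measure_mono Ioc_subset_Icc_self).trans_lt (dtOverT_Icc_lt_top hk _)).ne
    · intro x
      exact setLIntegral_mono' measurableSet_Ioc fun t ht =>
        pow_le_pow_left' (h.enorm_Theta_one_le (hk.trans ht.1) x) 2
    · intro R hR hRQ
      refine (lintegral_mono fun x => ?_).trans (hC R Q.double hRQ)
      refine lintegral_mono_set (Ioc_subset_Ioc hR.le ?_)
      have := Q.side_pos
      simp only [Cube.double]
      linarith
  filter_upwards [ae_all_iff.2 hae] with x hx
  have hU : Ioc 0 Q.side = ⋃ k : ℕ, Ioc ((k + 1 : ℝ)⁻¹) Q.side := by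
    ext t
    simp only [mem_iUnion, mem_Ioc, exists_and_right]
    refine and_congr_left fun _ => ⟨fun ht => ?_, fun ⟨k, hk⟩ => lt_trans (by positivity) hk⟩
    obtain ⟨k, hk⟩ := exists_nat_one_div_lt ht
    exact ⟨k, by simpa using hk⟩
  have hmono : Monotone fun k : ℕ => Ioc ((k + 1 : ℝ)⁻¹) Q.side := fun k l hkl =>
    Ioc_subset_Ioc_left (by gcongr)
  rw [hU, setLIntegral_iUnion_of_directed _ hmono.directed_le]
  refine iSup_le fun k => le_of_eq_of_le (lintegral_congr fun t => ?_) (hx k)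
  rw [thetaOneSq, ENNReal.ofReal_pow (norm_nonneg _), ofReal_norm]

end IsKernelFamily

/-! ### The Carleson condition -/

lemma CarlesonCondition.exists_carlesonBound {θ : Kernels n m} (hθ : KernelMeasurable θ)
    (h : CarlesonCondition θ) :
    ∃ C : ℝ≥0, CarlesonBound (fun q => ‖Theta θ q.2 (fun _ _ => 1) q.1‖ₑ ^ 2) C := by
  obtain ⟨C, hC⟩ := h
  refine ⟨C, fun Q => le_of_eq_of_le ?_ (hC Q)⟩
  have e : (fun q => ENNReal.ofReal (thetaOneSq θ q)) =
      fun q : E n × ℝ => ‖Theta θ q.2 (fun _ _ => 1) q.1‖ₑ ^ 2 := by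
    funext q
    rw [thetaOneSq, ENNReal.ofReal_pow (norm_nonneg _), ofReal_norm]
  rw [e, withDensity_apply _ (Q.measurableSet_toSet.prod measurableSet_Ioc),
    ← Measure.prod_restrict, lintegral_prod]
  refine (hθ.aemeasurable_enorm_Theta_sq fun _ => measurable_const).mono_ac ?_
  exact Measure.restrict_le_self.absolutelyContinuous.prod
    Measure.restrict_le_self.absolutelyContinuous

end

end MultilinearSquare

end

theorem proposition3p4 (n m : ℕ) (hn : 1 ≤ n) (hm : 1 ≤ m) (N γ : ℝ) (hN : (n : ℝ) < N)
    (hγ₀ : 0 < γ) (hγ₁ : γ ≤ 1) (θ : Kernels n m) (hmeas : KernelMeasurable θ)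
    (hsize : SizeCondition θ N) (hreg : RegularityCondition θ γ)
    (hcarleson : CarlesonCondition θ) :
    (TwoCubeCondition θ → StrongCarlesonCondition θ) ∧
    (∀ p : Fin m → ℝ, (∀ i, 1 < p i) → ∑ i, 1 / p i = 1 / 2 →
      ∃ C : ℝ≥0, ∀ f : Fin m → E n → ℂ, (∀ i, MemLp (f i) (ENNReal.ofReal (p i)) volume) →
        eLpNorm (squareFunction θ f) 2 volume ≤
          C * ∏ i, eLpNorm (f i) (ENNReal.ofReal (p i)) volume) := by
  obtain ⟨m, rfl⟩ : ∃ k, m = k + 1 := ⟨m - 1, by omega⟩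
  obtain ⟨M, δ, A, hM, hδ, hδ1, hker⟩ := exists_isMultiKernel hn hN hγ₀ hγ₁ hsize hreg
  have hfam : IsKernelFamily θ M δ A := ⟨hn, hM, hδ, hδ1, hmeas, hker⟩
  refine ⟨fun h2 => hfam.strongCarlesonCondition h2, fun p hp hps => ?_⟩
  obtain ⟨C, hC⟩ := hcarleson.exists_carlesonBound hmeas
  obtain ⟨B, hB⟩ := hfam.exists_lintegral_Theta_sq_le hC
  have hB1 : VertexBound θ (B + 1) := fun j f hf hf1 hfi hf2 =>
    (hB j f hf hf1 hfi hf2).trans (mul_le_mul' (ENNReal.coe_le_coe.2 le_self_add) le_rfl)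
  exact ⟨NNReal.sqrt (B + 1), fun f hf => hB1.eLpNorm_squareFunction_le hfam (by positivity)
    (fun i => (hp i).le) hps hf⟩
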